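/- Let $\Gamma$ be the free group on a finite set $S$ and let $k$ be a positive integer. Let $\mathcal{S}^{\mathrm u}_k(\Gamma)$ be the space of positive definite maps $\phi:\Gamma\to \mathrm{M}_k(\mathbf{C})$ with $\phi(e)=I_k$, with the topology of pointwise convergence. For a finite set $F\subset\Gamma$ and $\phi\in\mathcal{S}^{\mathrm u}_k(\Gamma)$ write $\phi[F]:=[\phi(g^{-1}h)]_{g,h\in F}$, an $F$-by-$F$ block matrix with blocks in $\mathrm{M}_k(\mathbf{C})$. The left Cayley graph of $\Gamma$ has edges $\{g,sg\}$ for $g\in\Gamma$, $s\in S\cup S^{-1}$; a finite set $F\subset\Gamma$ is grounded if it contains $e$ and is connected in this graph; and $B_n$ is the closed ball of radius $n$ around $e$ in this graph. For a finite set $F\subset\Gamma$, let $\mathcal{S}^{\mathrm u}_k(F)$ be the set of positive semidefinite $F$-by-$F$ block matrices $q$ with blocks $q(g,h)\in\mathrm{M}_k(\mathbf{C})$ such that every diagonal block is $I_k$ and $q(g_1,h_1)=q(g_2,h_2)$ whenever $g_1^{-1}h_1=g_2^{-1}h_2$, and for $q\in\mathcal{S}^{\mathrm u}_k(F)$ put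 \[ h_F(q) := \begin{cases}\log\det q-\sum_{s\in S}\log\det q[F\cap sF] & \text{if } q \text{ is nonsingular},\\ -\infty & \text{if } q \text{ is singular,}\end{cases}\] where $q[E]$ is the submatrix of $q$ with block rows and columns indexed by $E\subseteq F$. For each $n$ let $\pi_n$ be a uniformly random $n$-dimensional unitary representation of $\Gamma$: the unitary matrices $\pi_n(s)$, $s\in S$, are independent and each is distributed according to the Haar probability measure of $\mathrm{U}(n)$. For each $n\ge k$ fix an $n$-by-$k$ complex matrix $V=V_n$ with orthonormal columns, and let $\Phi^{\pi_n}_V(g):=V^\ast\pi_n(g)V$ for $g\in\Gamma$, a random element of $\mathcal{S}^{\mathrm u}_k(\Gamma)$. Then the laws $\mu_n$ of $\Phi^{\pi_n}_V$ $(n\ge k)$ obey the large deviations principle in $\mathcal{S}^{\mathrm u}_k(\Gamma)$ with the rate function $I:\mathcal{S}^{\mathrm u}_k(\Gamma)\to[0,\infty]$ given by \[ I(\phi) = -\inf\{h_F(\phi[F]) : F \text{ grounded}\} = -\lim_{n\to\infty}h_{B_n}(\phi[B_n])\qquad(\phi\in\mathcal{S}^{\mathrm u}_k(\Gamma)),\]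 where the limit exists in $[-\infty,\infty)$ for every $\phi$. Explicitly, the large deviations principle means that: (i) if $a<I(\phi)$ is real, then some neighbourhood $U$ of $\phi$ satisfies $\mu_n(U)\le e^{-an+o(n)}$; (ii) if $a>I(\phi)$ is real, then every neighbourhood $U$ of $\phi$ satisfies $\mu_n(U)\ge e^{-an-o(n)}$ (for all sufficiently large $n$); (iii) for every real $a>0$ there is a compact set $K\subseteq\mathcal{S}^{\mathrm u}_k(\Gamma)$ with $\mu_n(\mathcal{S}^{\mathrm u}_k(\Gamma)\setminus K)\le e^{-an+o(n)}$. -/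

import Mathlib

open MeasureTheory ProbabilityTheory Filter Topology Asymptotics Matrix
open scoped Pointwise ComplexOrder

noncomputable section

/-! ### The left Cayley graph of a free group, grounded sets, balls -/

/-- The left Cayley graph of the free group on `S`: its edges are the pairs `{g, s g}` with
`s` a free generator (equivalently, a generator or the inverse of one). -/
def leftCayleyGraph (S : Type*) : SimpleGraph (FreeGroup S) :=
  SimpleGraph.fromRel fun g h => ∃ s : S, h = FreeGroup.of s * g

/-- A finite subset of the free group is grounded if it contains the identity and is connected
in the left Cayley graph. -/
def IsGrounded {S : Type*} (F : Finset (FreeGroup S)) : Prop :=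
  1 ∈ F ∧ ((leftCayleyGraph S).induce (F : Set (FreeGroup S))).Connected

theorem finite_cayleyBall (S : Type*) [Finite S] (n : ℕ) :
    {g : FreeGroup S | (leftCayleyGraph S).edist 1 g ≤ n}.Finite := by
  have key : ∀ m : ℕ,
      {g : FreeGroup S | ∃ p : (leftCayleyGraph S).Walk g 1, p.length ≤ m}.Finite := by
    intro m
    induction m with
    | zero =>
      refine (Set.finite_singleton (1 : FreeGroup S)).subset ?_
      rintro g ⟨p, hp⟩
      exact p.eq_of_length_eq_zero (Nat.le_zero.mp hp)
    | succ m ih =>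
      refine (((Set.finite_singleton (1 : FreeGroup S)).union
        (Set.finite_iUnion fun s : S => ih.image fun g => FreeGroup.of s * g)).union
        (Set.finite_iUnion fun s : S => ih.image fun g => (FreeGroup.of s)⁻¹ * g)).subset ?_
      rintro g ⟨p, hp⟩
      cases p with
      | nil => exact Or.inl (Or.inl rfl)
      | @cons _ h _ hadj q =>
        have hq : q.length ≤ m := by simpa using hp
        rw [leftCayleyGraph, SimpleGraph.fromRel_adj] at hadj
        obtain ⟨-, ⟨s, hs⟩ | ⟨s, hs⟩⟩ := hadj
        · exact Or.inr (Set.mem_iUnion.mpr ⟨s, h, ⟨q, hq⟩, by simp [hs]⟩)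
        · exact Or.inl (Or.inr (Set.mem_iUnion.mpr ⟨s, h, ⟨q, hq⟩, by simp [hs]⟩))
  refine (key n).subset fun g hg => ?_
  have hg' : (leftCayleyGraph S).edist 1 g ≤ n := hg
  have hne : (leftCayleyGraph S).edist 1 g ≠ ⊤ :=
    ne_top_of_le_ne_top (ENat.natCast_ne_top n) hg'
  obtain ⟨p, hp⟩ := SimpleGraph.exists_walk_of_edist_ne_top hne
  refine ⟨p.reverse, ?_⟩
  rw [← hp] at hg'
  simpa using hg'

/-- The closed ball `B_n` of radius `n` around the identity in the left Cayley graph. -/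
def cayleyBall (S : Type*) [Finite S] (n : ℕ) : Finset (FreeGroup S) :=
  (finite_cayleyBall S n).toFinset

/-! ### Positive definite functions and their finite restrictions -/

/-- The space `S^u_k(Γ)` of unital positive definite maps `φ : Γ → M_k`: those with `φ(e) = I_k` and
`∑_{g, h, i, j} conj (a_i(g)) a_j(h) φ_{ij}(g⁻¹ h) ≥ 0` for all finitely supported `a_1, …, a_k`.
(Boundedness is automatic.) As a subspace of a function space, it carries the topology of
pointwise convergence. -/
def unitalPD (Γ : Type*) [Group Γ] (k : ℕ) : Set (Γ → Matrix (Fin k) (Fin k) ℂ) :=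
  {φ | φ 1 = 1 ∧
    (Matrix.of fun p q : Γ × Fin k => φ (p.1⁻¹ * q.1) p.2 q.2).PosSemidef}

instance (Γ : Type*) [Group Γ] (k : ℕ) : MeasurableSpace (unitalPD Γ k) := borel _

instance (Γ : Type*) [Group Γ] (k : ℕ) : BorelSpace (unitalPD Γ k) := ⟨rfl⟩

/-- The space `S^u_k(F)` of partial positive definite functions over `F`: the positive semidefinite
`F`-by-`F` block matrices `Q`, with blocks `Q(g,h)` in `M_k`, whose diagonal blocks are `I_k` and
which satisfy `Q(g₁,h₁) = Q(g₂,h₂)` whenever `g₁⁻¹ h₁ = g₂⁻¹ h₂`. -/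
def partialPD {Γ : Type*} [Group Γ] (k : ℕ) (F : Finset Γ) :
    Set (Matrix (F × Fin k) (F × Fin k) ℂ) :=
  {Q | Q.PosSemidef ∧
    (∀ (g : F) (i j : Fin k), Q (g, i) (g, j) = (1 : Matrix (Fin k) (Fin k) ℂ) i j) ∧
    ∀ g₁ h₁ g₂ h₂ : F, (g₁ : Γ)⁻¹ * h₁ = (g₂ : Γ)⁻¹ * h₂ →
      ∀ i j : Fin k, Q (g₁, i) (h₁, j) = Q (g₂, i) (h₂, j)}

/-- The block matrix `φ[F] = [φ(g⁻¹ h)]_{g,h ∈ F}`. -/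
def restrictPD {Γ : Type*} [Group Γ] {k : ℕ} (φ : unitalPD Γ k) (F : Finset Γ) :
    partialPD k F :=
  ⟨Matrix.of fun p q : F × Fin k => φ.1 ((p.1 : Γ)⁻¹ * q.1) p.2 q.2,
    φ.2.2.submatrix fun p : F × Fin k => ((p.1 : Γ), p.2),
    fun g i j => by
      have h : φ.1 1 = 1 := φ.2.1
      simp [h],
    fun g₁ h₁ g₂ h₂ h i j => by simp [h]⟩

/-- The submatrix `q[E]` of an `F`-by-`F` block matrix `q` with block rows and block columns indexed
by `E ⊆ F`. -/
def subBlock {Γ : Type*} {k : ℕ} {E F : Finset Γ} (h : E ⊆ F)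
    (q : Matrix (F × Fin k) (F × Fin k) ℂ) : Matrix (E × Fin k) (E × Fin k) ℂ :=
  q.submatrix (fun p => (⟨p.1, h p.1.2⟩, p.2)) (fun p => (⟨p.1, h p.1.2⟩, p.2))

open Classical in
/-- `h_F(q) = log det q - ∑_{s ∈ S} log det q[F ∩ sF]` if `q` is nonsingular, and `-∞` otherwise.
(The determinants are real, because the matrices are positive semidefinite.) -/
def hF {S : Type*} [Fintype S] {k : ℕ} (F : Finset (FreeGroup S)) (q : partialPD k F) : EReal :=
  if IsUnit q.1 then
    ((Real.log q.1.det.re - ∑ s : S,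
      Real.log (subBlock
        (Finset.inter_subset_left : F ∩ (FreeGroup.of s • F) ⊆ F) q.1).det.re : ℝ) : EReal)
  else ⊥

/-! ### Types of tuples in representations -/

/-- The set `U(k,n)` of orthonormal `k`-tuples in `ℂⁿ`, as matrices with orthonormal columns. -/
def unitaryTuples (k n : ℕ) : Set (Matrix (Fin n) (Fin k) ℂ) := {V | Vᴴ * V = 1}

theorem posSemidef_gram {m ι : Type*} [Fintype m] (W : Matrix m ι ℂ) :
    (Wᴴ * W).PosSemidef := by
  classical
  refine ⟨Matrix.isHermitian_conjTranspose_mul_self W, fun x => ?_⟩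
  have h : (x.sum fun i xi => x.sum fun j xj => star xi * (Wᴴ * W) i j * xj)
      = ∑ a, star (∑ i ∈ x.support, W a i * x i) * ∑ j ∈ x.support, W a j * x j := by
    simp_rw [star_sum, Finset.sum_mul_sum]
    rw [Finset.sum_comm]
    refine Finset.sum_congr rfl fun i _ => ?_
    rw [Finset.sum_comm]
    refine Finset.sum_congr rfl fun j _ => ?_
    change star (x i) * (Wᴴ * W) i j * x j = _
    rw [Matrix.mul_apply, Finset.mul_sum, Finset.sum_mul]
    refine Finset.sum_congr rfl fun a _ => ?_
    rw [Matrix.conjTranspose_apply, star_mul']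
    ring
  rw [h]
  exact Finset.sum_nonneg fun a _ => star_mul_self_nonneg _

/-- The type `Φ^π_V(g) = V* π(g) V` of the tuple `V` in the representation `π`. -/
def typeOf {Γ : Type*} [Group Γ] {k n : ℕ} (π : Γ →* unitaryGroup (Fin n) ℂ)
    (V : unitaryTuples k n) : unitalPD Γ k :=
  ⟨fun g => (V.1)ᴴ * (π g : Matrix (Fin n) (Fin n) ℂ) * V.1, by
    have hV : (V.1)ᴴ * V.1 = 1 := V.2
    refine ⟨by simp [hV], ?_⟩
    have h := posSemidef_gram
      (Matrix.of fun (a : Fin n) (p : Γ × Fin k) =>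
        ((π p.1 : Matrix (Fin n) (Fin n) ℂ) * V.1) a p.2)
    convert h using 1
    ext p q
    have h2 : (V.1)ᴴ * (π (p.1⁻¹ * q.1) : Matrix (Fin n) (Fin n) ℂ) * V.1
        = ((π p.1 : Matrix (Fin n) (Fin n) ℂ) * V.1)ᴴ
          * ((π q.1 : Matrix (Fin n) (Fin n) ℂ) * V.1) := by
      rw [map_mul, map_inv, Matrix.conjTranspose_mul]
      simp [Matrix.mul_assoc, Matrix.star_eq_conjTranspose]
    simp only [Matrix.of_apply]
    rw [h2, Matrix.mul_apply, Matrix.mul_apply]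
    rfl⟩

/-! ### Uniformly random representations -/

instance (n : ℕ) : MeasurableSpace (unitaryGroup (Fin n) ℂ) := borel _

instance (n : ℕ) : BorelSpace (unitaryGroup (Fin n) ℂ) := ⟨rfl⟩

/-- `π` is a uniformly random `n`-dimensional unitary representation of the free group on `S`:
the unitary matrices `π(s)`, `s ∈ S`, are independent, and each of them is distributed according to
the Haar probability measure of `U(n)`. -/
structure IsUniformRandomRep {S Ω : Type*} [MeasurableSpace Ω] (P : Measure Ω)
    [IsProbabilityMeasure P] {n : ℕ}
    (π : Ω → (FreeGroup S →* unitaryGroup (Fin n) ℂ)) : Prop where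
  measurable : ∀ s : S, Measurable fun ω => π ω (FreeGroup.of s)
  indep : iIndepFun (fun (s : S) (ω : Ω) => π ω (FreeGroup.of s)) P
  haar : ∀ s : S, (P.map fun ω => π ω (FreeGroup.of s)).IsHaarMeasure

/-! ### Large deviations principles -/

/-- The sequence `(μ_n)_{n ≥ N}` of Borel probability measures on `X` obeys the large deviations
principle with rate function `I : X → [0,∞]`. Each `ε` is an error term `o(n)`. -/
structure LDP {X : Type*} [TopologicalSpace X] [MeasurableSpace X] {N : ℕ}
    (μ : ∀ n : ℕ, N ≤ n → Measure X) (I : X → EReal) : Prop where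
  prob : ∀ (n : ℕ) (hn : N ≤ n), IsProbabilityMeasure (μ n hn)
  nonneg : ∀ x, 0 ≤ I x
  upper : ∀ (x : X) (a : ℝ), (a : EReal) < I x → ∃ U ∈ 𝓝 x, ∃ ε : ℕ → ℝ,
    ε =o[atTop] (fun n : ℕ => (n : ℝ)) ∧
    ∀ᶠ n : ℕ in atTop, ∀ hn : N ≤ n, (μ n hn).real U ≤ Real.exp (-a * n + ε n)
  lower : ∀ (x : X) (a : ℝ), I x < (a : EReal) → ∀ U ∈ 𝓝 x, ∃ ε : ℕ → ℝ,
    ε =o[atTop] (fun n : ℕ => (n : ℝ)) ∧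
    ∀ᶠ n : ℕ in atTop, ∀ hn : N ≤ n, Real.exp (-a * n - ε n) ≤ (μ n hn).real U
  tight : ∀ a : ℝ, 0 < a → ∃ K : Set X, IsCompact K ∧ ∃ ε : ℕ → ℝ,
    ε =o[atTop] (fun n : ℕ => (n : ℝ)) ∧
    ∀ᶠ n : ℕ in atTop, ∀ hn : N ≤ n, (μ n hn).real Kᶜ ≤ Real.exp (-a * n + ε n)

end

/-!
Fix a finite set `F` that contains with each word all its suffixes; the grounded sets are exactly
of this kind. Then the left Cayley graph on `F` is a tree with root `1`. For unitaries
`U = (U_s)` and a tuple `W = (W_x)`, `x ∈ F`, with entries in `(ℂⁿ)ᵏ`, consider the defects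
`W_x - U_s W_{s⁻¹x}` along its edges. Passing from `W` to its root entry `W_1` and its defects is
unipotent along the tree, up to unitaries, and so preserves Lebesgue measure. Compute in two ways
the expected volume of the set of `W` with Gram matrix near `q` and all defects small:

* integrating over `W` first, small defects force `W` to be close to the orbit `(U(x) W_1)_x`,
  so one gets the probability that the orbit of a `k`-tuple has Gram matrix near `q`, times the
  volume of the small defects;
* integrating over `U` first, the tuples with Gram matrix near `q` have volume about `(det q)ⁿ`,
  and, by independence, for each of them the probability of small defects is a product over `s`.
  The factor of `s` is about `(det q[F ∩ sF])⁻ⁿ` times the volume of the small defects along the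
  edges labelled `s`.

Since Haar measure is invariant under conjugation and the unitary group acts transitively on the
tuples with a given Gram matrix, the first probability depends only on the Gram matrix of the
`k`-tuple, so for orthonormal tuples it is about `exp (n h_F(q))`. If `φ[F]` is singular, a minimal
suffix-closed `E` for which `φ[E]` is singular has nonsingular blocks `φ[E ∩ sE]`, so the upper
estimate still applies to `E`, with `det φ[E] = 0`, and the probability decays faster than
exponentially.
-/

/-! ### Gram matrices -/

section LinearCombinations

variable {R M N ι κ l : Type*} [CommRing R] [AddCommGroup M] [Module R M] [AddCommGroup N]
  [Module R N]

/-- The tuple of linear combinations of the vectors `Z i` whose coefficients are the columns of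
the matrix `D`. -/
def linComb [Fintype ι] (D : Matrix ι κ R) : (ι → M) →ₗ[R] (κ → M) where
  toFun Z j := ∑ i, D i j • Z i
  map_add' Z Z' := by ext; simp [Finset.sum_add_distrib]
  map_smul' c Z := by ext; simp [Finset.smul_sum, smul_smul, mul_comm]

theorem linComb_apply [Fintype ι] (D : Matrix ι κ R) (Z : ι → M) (j : κ) :
    linComb D Z j = ∑ i, D i j • Z i := rfl

theorem linComb_linComb [Fintype ι] [Fintype κ] (D : Matrix ι κ R) (D' : Matrix κ l R)
    (Z : ι → M) : linComb D' (linComb D Z) = linComb (D * D') Z := by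
  funext a
  simp only [linComb_apply, Matrix.mul_apply, Finset.smul_sum, Finset.sum_smul, smul_smul]
  rw [Finset.sum_comm]
  simp only [mul_comm]

theorem linComb_sub_one [Fintype ι] [DecidableEq ι] (D : Matrix ι ι R) (Z : ι → M) :
    linComb (D - 1) Z = linComb D Z - Z := by
  funext a
  simp [linComb_apply, Matrix.one_apply, sub_smul]

theorem linComb_one [Fintype ι] [DecidableEq ι] (Z : ι → M) :
    linComb (1 : Matrix ι ι R) Z = Z := by
  funext a
  simp [linComb_apply, Matrix.one_apply]

theorem linComb_map [Fintype ι] {F : Type*} [FunLike F M N] [LinearMapClass F R M N]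
    (D : Matrix ι κ R) (f : F) (Z : ι → M) :
    linComb D (f ∘ Z) = f ∘ linComb D Z := by
  funext a
  simp [linComb_apply]

theorem linComb_inv_linComb [Fintype ι] [DecidableEq ι] {D : Matrix ι ι R} (hD : IsUnit D.det)
    (W : ι → M) : linComb D (linComb D⁻¹ W) = W := by
  rw [linComb_linComb, nonsing_inv_mul _ hD, linComb_one]

theorem linComb_linComb_inv [Fintype ι] [DecidableEq ι] {D : Matrix ι ι R} (hD : IsUnit D.det)
    (W : ι → M) : linComb D⁻¹ (linComb D W) = W := by
  rw [linComb_linComb, mul_nonsing_inv _ hD, linComb_one]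

theorem image_linComb_eq_preimage [Fintype ι] [DecidableEq ι] {D : Matrix ι ι R}
    (hD : IsUnit D.det) (A : Set (ι → M)) : linComb D '' A = linComb D⁻¹ ⁻¹' A :=
  congrFun (Set.image_eq_preimage_of_inverse (linComb_linComb_inv hD) (linComb_inv_linComb hD)) A

theorem det_linComb [Fintype ι] [DecidableEq ι] [Nontrivial R] [Module.Free R M]
    [Module.Finite R M] (D : Matrix ι ι R) :
    LinearMap.det (linComb (M := M) D) = D.det ^ Module.finrank R M := by
  let b := Module.finBasis R M
  let e : (ι → M) ≃ₗ[R] (Fin (Module.finrank R M) → ι → R) :=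
    { toFun := fun Z a i => b.equivFun (Z i) a
      map_add' := fun _ _ => by ext; simp
      map_smul' := fun _ _ => by ext; simp
      invFun := fun Y i => b.equivFun.symm fun a => Y a i
      left_inv := fun _ => by ext; simp
      right_inv := fun Y => by
        ext a i
        exact congrFun (b.equivFun.apply_symm_apply fun a => Y a i) a }
  have he : e.toLinearMap ∘ₗ linComb D ∘ₗ e.symm.toLinearMap
      = LinearMap.pi fun a => toLin' Dᵀ ∘ₗ LinearMap.proj a := by
    refine LinearMap.ext fun Y => ?_
    ext a j
    change b.equivFun (∑ i, D i j • b.equivFun.symm fun a => Y a i) a = _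
    simp [map_sum, -Module.Basis.equivFun_symm_apply, mulVec, dotProduct]
  rw [← LinearMap.det_conj (linComb D) e, he, LinearMap.det_pi]
  simp

end LinearCombinations

section Gram

variable {𝕜 E ι κ : Type*} [RCLike 𝕜] [NormedAddCommGroup E] [InnerProductSpace 𝕜 E]

theorem gram_linComb [Fintype ι] (D : Matrix ι κ 𝕜) (Z : ι → E) :
    gram 𝕜 (linComb D Z) = Dᴴ * gram 𝕜 Z * D := by
  ext a b
  simp only [gram_apply, linComb_apply, sum_inner, inner_sum, inner_smul_left, inner_smul_right,
    Matrix.mul_apply, conjTranspose_apply, Finset.sum_mul, Finset.mul_sum, starRingEnd_apply]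
  exact Finset.sum_congr rfl fun i _ => Finset.sum_congr rfl fun j _ => by ring

theorem gram_linearIsometryEquiv (H : E ≃ₗᵢ[𝕜] E) (Z : ι → E) :
    gram 𝕜 (H ∘ Z) = gram 𝕜 Z := by
  ext i j
  simp

theorem continuous_gram : Continuous fun Z : ι → E => gram 𝕜 Z :=
  continuous_pi fun i => continuous_pi fun j => by
    simp only [gram_apply]
    fun_prop

theorem exists_linearIsometryEquiv_of_orthonormal [FiniteDimensional 𝕜 E] {Z Z' : ι → E}
    (hZ : Orthonormal 𝕜 Z) (hZ' : Orthonormal 𝕜 Z') : ∃ H : E ≃ₗᵢ[𝕜] E, ∀ j, H (Z j) = Z' j := by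
  let b := Module.Basis.span hZ.linearIndependent
  have hb (j : ι) : (b j : E) = Z j :=
    congrArg Subtype.val (Module.Basis.span_apply hZ.linearIndependent j)
  have hb_orthonormal : Orthonormal 𝕜 b := by
    refine (Submodule.subtypeₗᵢ _).orthonormal_comp_iff.1 ?_
    convert hZ using 1
    exact funext hb
  let L : Submodule.span 𝕜 (Set.range Z) →ₗᵢ[𝕜] E :=
    (b.constr 𝕜 Z').isometryOfOrthonormal hb_orthonormal (by
      convert hZ' using 1
      exact funext fun j => b.constr_basis 𝕜 Z' j)
  refine ⟨L.extend.toLinearIsometryEquiv rfl, fun j => ?_⟩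
  rw [LinearIsometry.coe_toLinearIsometryEquiv, ← hb j, L.extend_apply]
  exact b.constr_basis 𝕜 Z' j

end Gram

section EntryBall

variable {ι κ : Type*}

/-- The matrices all of whose entries are within `δ` of those of `M`: a basis of neighbourhoods
of `M`, used because `Matrix` carries no global metric. -/
def entryBall (M : Matrix ι κ ℂ) (δ : ℝ) : Set (Matrix ι κ ℂ) :=
  {M' | ∀ i j, ‖M' i j - M i j‖ < δ}

theorem isOpen_entryBall [Finite ι] [Finite κ] (M : Matrix ι κ ℂ) (δ : ℝ) :
    IsOpen (entryBall M δ) := by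
  simp only [entryBall, Set.ofPred_forall]
  exact isOpen_iInter_of_finite fun i => isOpen_iInter_of_finite fun j =>
    isOpen_lt (by fun_prop) continuous_const

theorem entryBall_mem_nhds [Finite ι] [Finite κ] (M : Matrix ι κ ℂ) {δ : ℝ} (hδ : 0 < δ) :
    entryBall M δ ∈ 𝓝 M :=
  (isOpen_entryBall M δ).mem_nhds fun i j => by simpa using hδ

theorem entryBall_mono (M : Matrix ι κ ℂ) {δ δ' : ℝ} (h : δ ≤ δ') :
    entryBall M δ ⊆ entryBall M δ' := fun _ hM i j => (hM i j).trans_le h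

theorem mem_entryBall_comm {M M' : Matrix ι κ ℂ} {δ : ℝ} :
    M ∈ entryBall M' δ ↔ M' ∈ entryBall M δ :=
  forall₂_congr fun i j => by rw [norm_sub_rev]

theorem entryBall_subset_entryBall {M M' : Matrix ι κ ℂ} {δ τ δ' : ℝ} (hM : M ∈ entryBall M' τ)
    (hδ : δ + τ ≤ δ') : entryBall M δ ⊆ entryBall M' δ' := fun X hX i j => by
  linarith [norm_sub_le_norm_sub_add_norm_sub (X i j) (M i j) (M' i j), hX i j, hM i j]

theorem exists_entryBall_subset [Finite ι] [Finite κ] {M : Matrix ι κ ℂ}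
    {N : Set (Matrix ι κ ℂ)} (hN : N ∈ 𝓝 M) : ∃ δ > 0, entryBall M δ ⊆ N := by
  cases nonempty_fintype ι
  cases nonempty_fintype κ
  obtain ⟨δ, hδ, h⟩ := (Metric.mem_nhds_iff (α := ι → κ → ℂ)).1 hN
  exact ⟨δ, hδ, fun M' hM' => h ((dist_pi_lt_iff hδ).2 fun i =>
    (dist_pi_lt_iff hδ).2 fun j => (dist_eq_norm _ _).trans_lt (hM' i j))⟩

end EntryBall

section NearlyOrthonormal

variable {E ι : Type*} [NormedAddCommGroup E] [InnerProductSpace ℂ E]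

theorem gram_apply_self (Z : ι → E) (j : ι) : gram ℂ Z j j = ((‖Z j‖ ^ 2 : ℝ) : ℂ) := by
  rw [gram_apply, inner_self_eq_norm_sq_to_K]
  norm_cast

theorem re_gram_apply_self (Z : ι → E) (j : ι) : (gram ℂ Z j j).re = ‖Z j‖ ^ 2 := by
  rw [gram_apply_self, Complex.ofReal_re]

variable [Fintype ι]

theorem re_conjTranspose_mul_self_apply {κ : Type*} (D : Matrix ι κ ℂ) (j : κ) :
    ((Dᴴ * D) j j).re = ∑ i, ‖D i j‖ ^ 2 := by
  simp only [Matrix.mul_apply, conjTranspose_apply, Complex.re_sum]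
  refine Finset.sum_congr rfl fun i _ => ?_
  rw [Complex.star_def, ← Complex.normSq_eq_conj_mul_self, Complex.normSq_eq_norm_sq,
    Complex.ofReal_re]

theorem norm_linComb_le {κ : Type*} [Fintype κ] {D : Matrix ι κ ℂ} {b : ℝ} (hb : 0 ≤ b)
    (hD : ∀ j, ((Dᴴ * D) j j).re ≤ b ^ 2) (Z : ι → E) :
    ‖linComb D Z‖ ≤ b * Fintype.card ι * ‖Z‖ := by
  refine (pi_norm_le_iff_of_nonneg (by positivity)).2 fun j => ?_
  have hD_entry (i : ι) : ‖D i j‖ ≤ b := by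
    have hj := hD j
    rw [re_conjTranspose_mul_self_apply] at hj
    exact le_of_sq_le_sq ((Finset.single_le_sum (f := fun i => ‖D i j‖ ^ 2)
      (fun _ _ => by positivity) (Finset.mem_univ i)).trans hj) hb
  calc ‖linComb D Z j‖ ≤ ∑ i, ‖D i j • Z i‖ := norm_sum_le _ _
    _ ≤ ∑ _i : ι, b * ‖Z‖ := Finset.sum_le_sum fun i _ => by
        rw [norm_smul]
        exact mul_le_mul (hD_entry i) (norm_le_pi_norm Z i) (norm_nonneg _) hb
    _ = b * Fintype.card ι * ‖Z‖ := by simp; ring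

open scoped MatrixOrder in
theorem exists_posSemidef_sqrt {A : Matrix ι ι ℂ} (hA : A.PosSemidef) :
    ∃ B : Matrix ι ι ℂ, B.PosSemidef ∧ B * B = A := by
  classical
  exact ⟨CFC.sqrt A, (CFC.sqrt_nonneg A).posSemidef, CFC.sqrt_mul_sqrt_self A hA.nonneg⟩

variable [DecidableEq ι]

theorem exists_conjTranspose_mul_self_eq {A : Matrix ι ι ℂ} (hA : A.PosDef) :
    ∃ D : Matrix ι ι ℂ, Dᴴ * D = A ∧ IsUnit D.det ∧ ‖D.det‖ ^ 2 = A.det.re := by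
  obtain ⟨B, hB, rfl⟩ := exists_posSemidef_sqrt hA.posSemidef
  refine ⟨B, by rw [hB.isHermitian.eq], ?_, ?_⟩
  · refine isUnit_iff_ne_zero.2 fun h => ?_
    simpa [h] using hA.det_pos
  · have h : (B * B).det = star B.det * B.det := by
      rw [← det_conjTranspose, ← det_mul, hB.isHermitian.eq]
    rw [h, Complex.star_def, ← Complex.normSq_eq_conj_mul_self, Complex.normSq_eq_norm_sq,
      Complex.ofReal_re]

theorem conjTranspose_inv_mul_conjTranspose_mul_self_mul_inv {D : Matrix ι ι ℂ}
    (hD : IsUnit D.det) : D⁻¹ᴴ * (Dᴴ * D) * D⁻¹ = 1 := by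
  rw [← Matrix.mul_assoc, ← conjTranspose_mul, mul_nonsing_inv _ hD, conjTranspose_one,
    Matrix.one_mul, mul_nonsing_inv _ hD]

theorem gram_linComb_inv_eq_one {D : Matrix ι ι ℂ} (hD : IsUnit D.det) {Z : ι → E}
    (hZ : Dᴴ * D = gram ℂ Z) : gram ℂ (linComb D⁻¹ Z) = 1 := by
  rw [gram_linComb, ← hZ, conjTranspose_inv_mul_conjTranspose_mul_self_mul_inv hD]

/-- With `P` the positive square root of the Gram matrix of `Z`, the orthonormal tuple is
`Z P⁻¹`; the bound is `(P - 1)² ≤ (P² - 1)²`, which holds because `P ≥ 0`. -/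
theorem exists_gram_eq_one_norm_sub_sq_le (Z : ι → E) (hdet : (gram ℂ Z).det ≠ 0) :
    ∃ Z₀ : ι → E, gram ℂ Z₀ = 1 ∧
      ∀ j, ‖Z j - Z₀ j‖ ^ 2 ≤ (((gram ℂ Z - 1)ᴴ * (gram ℂ Z - 1) : Matrix ι ι ℂ) j j).re := by
  obtain ⟨P, hP, hPP⟩ := exists_posSemidef_sqrt (Matrix.posSemidef_gram ℂ Z)
  have hP_star : Pᴴ = P := hP.isHermitian.eq
  have hP_unit : IsUnit P.det :=
    isUnit_iff_ne_zero.2 fun h => hdet (by rw [← hPP, det_mul, h, zero_mul])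
  have hZ₀ : gram ℂ (linComb P⁻¹ Z) = 1 := gram_linComb_inv_eq_one hP_unit (by rw [hP_star, hPP])
  refine ⟨linComb P⁻¹ Z, hZ₀, fun j => ?_⟩
  have hsub : Z j - linComb P⁻¹ Z j = linComb (P - 1) (linComb P⁻¹ Z) j := by
    rw [linComb_sub_one, linComb_inv_linComb hP_unit, Pi.sub_apply]
  have hfactor : (gram ℂ Z - 1)ᴴ * (gram ℂ Z - 1) - (P - 1)ᴴ * (P - 1)
      = (P - 1)ᴴ * (P * P + P + P) * (P - 1) := by
    rw [← hPP]
    simp only [conjTranspose_sub, conjTranspose_mul, hP_star, conjTranspose_one]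
    noncomm_ring
  have hpos : ((P - 1)ᴴ * (P * P + P + P) * (P - 1)).PosSemidef := by
    refine PosSemidef.conjTranspose_mul_mul_same ?_ _
    rw [hPP]
    exact ((Matrix.posSemidef_gram ℂ Z).add hP).add hP
  have hdiag := (Complex.le_def.1 (hpos.diag_nonneg (i := j))).1
  rw [← hfactor, Matrix.sub_apply, Complex.sub_re, Complex.zero_re, sub_nonneg] at hdiag
  rwa [hsub, ← re_gram_apply_self, gram_linComb, hZ₀, Matrix.mul_one]

theorem eventually_nhds_one_det_ne_zero_and_re_lt (ι : Type*) [Fintype ι] [DecidableEq ι]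
    {η : ℝ} (hη : 0 < η) :
    ∀ᶠ M in 𝓝 (1 : Matrix ι ι ℂ), M.det ≠ 0 ∧
      ∀ j, (((M - 1)ᴴ * (M - 1) : Matrix ι ι ℂ) j j).re < η := by
  have hdet : ∀ᶠ M in 𝓝 (1 : Matrix ι ι ℂ), M.det ≠ 0 :=
    (Continuous.matrix_det continuous_id).continuousAt.eventually_ne (by simp)
  refine hdet.and (eventually_all.2 fun j => ?_)
  have hcont : Continuous fun M : Matrix ι ι ℂ =>
      (((M - 1)ᴴ * (M - 1) : Matrix ι ι ℂ) j j).re := by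
    fun_prop
  exact (hcont.tendsto 1).eventually_lt_const (by simpa using hη)

theorem exists_entryBall_one_linearIsometryEquiv.{u} (ι : Type*) [Fintype ι] [DecidableEq ι]
    {η : ℝ} (hη : 0 < η) :
    ∃ δ > 0, ∀ (E : Type u) [NormedAddCommGroup E] [InnerProductSpace ℂ E]
      [FiniteDimensional ℂ E] (Z Z' : ι → E), gram ℂ Z ∈ entryBall 1 δ →
      gram ℂ Z' ∈ entryBall 1 δ → ∃ H : E ≃ₗᵢ[ℂ] E, dist (H ∘ Z) Z' < η := by
  obtain ⟨δ, hδ, hδη⟩ := exists_entryBall_subset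
    (eventually_nhds_one_det_ne_zero_and_re_lt ι (show 0 < (η / 2) ^ 2 by positivity))
  refine ⟨δ, hδ, fun E _ _ _ Z Z' hZ hZ' => ?_⟩
  obtain ⟨Y, hY, hYZ⟩ := exists_gram_eq_one_norm_sub_sq_le Z (hδη hZ).1
  obtain ⟨Y', hY', hYZ'⟩ := exists_gram_eq_one_norm_sub_sq_le Z' (hδη hZ').1
  obtain ⟨H, hH⟩ := exists_linearIsometryEquiv_of_orthonormal
    (gram_eq_one_iff_orthonormal.1 hY) (gram_eq_one_iff_orthonormal.1 hY')
  refine ⟨H, (dist_pi_lt_iff hη).2 fun j => ?_⟩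
  have hj : ‖Z j - Y j‖ < η / 2 :=
    lt_of_pow_lt_pow_left₀ 2 (by positivity) ((hYZ j).trans_lt ((hδη hZ).2 j))
  have hj' : ‖Z' j - Y' j‖ < η / 2 :=
    lt_of_pow_lt_pow_left₀ 2 (by positivity) ((hYZ' j).trans_lt ((hδη hZ').2 j))
  calc dist (H (Z j)) (Z' j) = ‖H (Z j - Y j) - (Z' j - Y' j)‖ := by
        rw [dist_eq_norm, map_sub, hH]
        congr 1
        abel
    _ ≤ ‖H (Z j - Y j)‖ + ‖Z' j - Y' j‖ := norm_sub_le _ _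
    _ < η := by
        rw [H.norm_map]
        linarith

theorem exists_linearIsometryEquiv_dist_linComb_lt.{u} (ι : Type*) [Fintype ι] [DecidableEq ι]
    {b η : ℝ} (hb : 0 ≤ b) (hη : 0 < η) :
    ∃ δ > 0, ∀ (E : Type u) [NormedAddCommGroup E] [InnerProductSpace ℂ E]
      [FiniteDimensional ℂ E] (D : Matrix ι ι ℂ) (Y Z : ι → E), IsUnit D.det →
      Dᴴ * D = gram ℂ Y → (∀ j, (gram ℂ Y j j).re ≤ b ^ 2) → gram ℂ Z ∈ entryBall 1 δ →
      ∃ H : E ≃ₗᵢ[ℂ] E, dist (H ∘ Y) (linComb D Z) < η := by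
  obtain ⟨δ, hδ, hH⟩ := exists_entryBall_one_linearIsometryEquiv ι
    (show 0 < η / (b * Fintype.card ι + 1) by positivity)
  refine ⟨δ, hδ, fun E _ _ _ D Y Z hD hDY hYb hZ => ?_⟩
  obtain ⟨H, hHZ⟩ := hH E (linComb D⁻¹ Y) Z
    (by
      rw [gram_linComb_inv_eq_one hD hDY]
      exact mem_of_mem_nhds (entryBall_mem_nhds 1 hδ)) hZ
  refine ⟨H, ?_⟩
  calc dist (H ∘ Y) (linComb D Z) = ‖linComb D (H ∘ linComb D⁻¹ Y - Z)‖ := by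
        rw [map_sub, linComb_map, linComb_inv_linComb hD, dist_eq_norm]
    _ ≤ b * Fintype.card ι * dist (H ∘ linComb D⁻¹ Y) Z := by
        rw [dist_eq_norm]
        exact norm_linComb_le hb (hDY ▸ hYb) _
    _ ≤ b * Fintype.card ι * (η / (b * Fintype.card ι + 1)) := by gcongr
    _ < η := by
        rw [mul_div_assoc', div_lt_iff₀ (by positivity)]
        nlinarith

end NearlyOrthonormal

/-! ### Volumes of sets of tuples -/

section Volume

/-- The Hermitian space `ℂⁿ`. -/
abbrev Cn (n : ℕ) : Type := EuclideanSpace ℂ (Fin n)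

/-- Lebesgue measure on `ℂⁿ`, normalised so that the unit ball has measure one: this makes the
volume of every ball an exact `n`-th power. -/
noncomputable def unitBallVolume (n : ℕ) : Measure (Cn n) :=
  (volume (Metric.ball (0 : Cn n) 1))⁻¹ • volume

instance (n : ℕ) : (unitBallVolume n).IsAddHaarMeasure :=
  Measure.IsAddHaarMeasure.smul _ (ENNReal.inv_ne_zero.2 measure_ball_lt_top.ne)
    (ENNReal.inv_ne_top.2 (Metric.measure_ball_pos _ _ one_pos).ne')

theorem unitBallVolume_ball {n : ℕ} (x : Cn n) {r : ℝ} (hr : 0 < r) :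
    unitBallVolume n (Metric.ball x r) = ENNReal.ofReal (r ^ 2) ^ n := by
  have hunit : unitBallVolume n (Metric.ball 0 1) = 1 := by
    rw [unitBallVolume, Measure.smul_apply, smul_eq_mul]
    exact ENNReal.inv_mul_cancel (Metric.measure_ball_pos _ _ one_pos).ne' measure_ball_lt_top.ne
  have hfinrank : Module.finrank ℝ (Cn n) = 2 * n := by
    rw [finrank_real_of_complex, finrank_euclideanSpace_fin]
  rw [Measure.addHaar_ball_of_pos _ _ hr, hunit, mul_one, hfinrank, pow_mul,
    ENNReal.ofReal_pow (by positivity)]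

theorem measurePreserving_unitBallVolume {n : ℕ} (H : Cn n ≃ₗᵢ[ℂ] Cn n) :
    MeasurePreserving H (unitBallVolume n) (unitBallVolume n) := by
  let H' : Cn n ≃ₗᵢ[ℝ] Cn n :=
    { H.toLinearEquiv.restrictScalars ℝ with norm_map' := H.norm_map }
  exact H'.measurePreserving.smul_measure _

variable {ι κ : Type*} [Fintype ι] {n : ℕ}

/-- Lebesgue measure on tuples of vectors, normalised on the product of unit balls. -/
noncomputable def tupleVolume (ι : Type*) [Fintype ι] (n : ℕ) : Measure (ι → Cn n) :=
  Measure.pi fun _ => unitBallVolume n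

instance : (tupleVolume ι n).IsAddHaarMeasure := Measure.pi.isAddHaarMeasure _

instance : SigmaFinite (tupleVolume ι n) := by
  unfold tupleVolume
  infer_instance

theorem tupleVolume_ball (X : ι → Cn n) {r : ℝ} (hr : 0 < r) :
    tupleVolume ι n (Metric.ball X r) = ENNReal.ofReal (r ^ (2 * Fintype.card ι)) ^ n := by
  rw [tupleVolume, ball_pi _ hr, Measure.pi_pi]
  simp_rw [unitBallVolume_ball _ hr]
  rw [Finset.prod_const, Finset.card_univ, pow_right_comm, pow_mul,
    ← ENNReal.ofReal_pow (by positivity)]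

theorem tupleVolume_image_linComb [DecidableEq ι] (D : Matrix ι ι ℂ) (A : Set (ι → Cn n)) :
    tupleVolume ι n (linComb D '' A)
      = ENNReal.ofReal (‖D.det‖ ^ 2) ^ n * tupleVolume ι n A := by
  have h := Measure.addHaar_image_linearMap (tupleVolume ι n) ((linComb D).restrictScalars ℝ) A
  rw [LinearMap.coe_restrictScalars] at h
  rw [h, LinearMap.det_restrictScalars, det_linComb, finrank_euclideanSpace_fin,
    Algebra.norm_complex_eq]
  simp [Complex.normSq_eq_norm_sq, ENNReal.ofReal_pow, ← pow_mul, mul_comm]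

end Volume

section GramVolumeUpper

variable {ι : Type*} [Fintype ι] [DecidableEq ι]

theorem exists_posDef_factor_perturbation {q : Matrix ι ι ℂ} (hq : q.PosSemidef) {c : ℝ}
    (hc : q.det.re < c) :
    ∃ τ : ℝ, 0 < τ ∧ ∃ D : Matrix ι ι ℂ, IsUnit D.det ∧
      Dᴴ * D = q + (τ : ℂ) • (1 : Matrix ι ι ℂ) ∧
      ‖D.det‖ ^ 2 * (1 + τ) ^ Fintype.card ι < c := by
  have hcont : Continuous fun τ : ℝ =>
      (q + (τ : ℂ) • (1 : Matrix ι ι ℂ)).det.re * (1 + τ) ^ Fintype.card ι := by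
    fun_prop
  obtain ⟨τ, hτc, hτ⟩ := (((hcont.tendsto 0).eventually_lt_const (by simpa using hc)).filter_mono
    nhdsWithin_le_nhds |>.and (self_mem_nhdsWithin : Set.Ioi (0 : ℝ) ∈ 𝓝[>] 0)).exists
  obtain ⟨D, hD, hD_unit, hD_det⟩ := exists_conjTranspose_mul_self_eq
    (PosDef.posSemidef_add hq (PosDef.one.smul (by exact_mod_cast hτ)))
  exact ⟨τ, hτ, D, hD_unit, hD, by rwa [hD_det]⟩

theorem tupleVolume_diag_gram_linComb_inv_lt_le {n : ℕ} {D : Matrix ι ι ℂ} (hD : IsUnit D.det)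
    {b : ℝ} (hb : 0 < b) :
    tupleVolume ι n {W | ∀ j, ((D⁻¹ᴴ * gram ℂ W * D⁻¹) j j).re < b}
      ≤ ENNReal.ofReal (‖D.det‖ ^ 2 * b ^ Fintype.card ι) ^ n := by
  have hsub : {W : ι → Cn n | ∀ j, ((D⁻¹ᴴ * gram ℂ W * D⁻¹) j j).re < b}
      ⊆ linComb D '' Metric.ball 0 (√b) := by
    refine fun W hW => ⟨linComb D⁻¹ W, ?_, linComb_inv_linComb hD W⟩
    rw [mem_ball_zero_iff, pi_norm_lt_iff (Real.sqrt_pos.2 hb)]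
    intro j
    have hj := hW j
    rw [← gram_linComb, re_gram_apply_self] at hj
    exact Real.lt_sqrt_of_sq_lt hj
  calc tupleVolume ι n _ ≤ tupleVolume ι n (linComb D '' Metric.ball 0 (√b)) := measure_mono hsub
    _ = ENNReal.ofReal (‖D.det‖ ^ 2 * b ^ Fintype.card ι) ^ n := by
      rw [tupleVolume_image_linComb, tupleVolume_ball _ (Real.sqrt_pos.2 hb), pow_mul,
        Real.sq_sqrt hb.le, ENNReal.ofReal_mul (by positivity), mul_pow]

theorem exists_nhds_tupleVolume_gram_le {q : Matrix ι ι ℂ} (hq : q.PosSemidef) {c : ℝ}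
    (hc : q.det.re < c) :
    ∃ N ∈ 𝓝 q, IsOpen N ∧ ∀ n, tupleVolume ι n {W | gram ℂ W ∈ N} ≤ ENNReal.ofReal c ^ n := by
  obtain ⟨τ, hτ, D, hD, hDq, hDc⟩ := exists_posDef_factor_perturbation hq hc
  have hopen : IsOpen {M : Matrix ι ι ℂ | ∀ j, ((D⁻¹ᴴ * M * D⁻¹) j j).re < 1 + τ} := by
    simp only [Set.ofPred_forall]
    exact isOpen_iInter_of_finite fun j => isOpen_lt (by fun_prop) continuous_const
  refine ⟨_, hopen.mem_nhds fun j => ?_, hopen, fun n =>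
    (tupleVolume_diag_gram_linComb_inv_lt_le hD (by positivity)).trans (by gcongr)⟩
  have hconj : D⁻¹ᴴ * q * D⁻¹ = 1 - (τ : ℂ) • (D⁻¹ᴴ * D⁻¹) := by
    rw [eq_sub_of_add_eq hDq.symm, Matrix.mul_sub, Matrix.sub_mul,
      conjTranspose_inv_mul_conjTranspose_mul_self_mul_inv hD]
    simp
  have hdiag : 0 ≤ ((D⁻¹ᴴ * D⁻¹) j j).re := by
    rw [re_conjTranspose_mul_self_apply]
    positivity
  simp only [hconj, Matrix.sub_apply, Matrix.one_apply_eq, Matrix.smul_apply, Complex.sub_re,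
    Complex.one_re, smul_eq_mul, Complex.re_ofReal_mul]
  nlinarith [mul_nonneg hτ.le hdiag]

end GramVolumeUpper

section NearOrthogonality

variable {ι κ : Type*} {n : ℕ}

theorem tupleVolume_pi_ball_ite [Fintype ι] [DecidableEq ι] (j : ι) {r : ℝ} (hr : 0 < r) :
    tupleVolume ι n (Set.univ.pi fun i => Metric.ball (0 : Cn n) (if i = j then r else 1))
      = ENNReal.ofReal (r ^ 2) ^ n := by
  rw [tupleVolume, Measure.pi_pi, Finset.prod_eq_single j]
  · rw [if_pos rfl, unitBallVolume_ball _ hr]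
  · intro i _ hi
    simp [hi, unitBallVolume_ball _ one_pos]
  · simp

theorem add_single_mem_pi_ball_ite [Fintype ι] [DecidableEq ι] {Z : ι → Cn n}
    (hZ : Z ∈ Metric.ball 0 1) {j : ι} {v : Cn n} {r : ℝ} (hv : ‖Z j + v‖ < r) :
    Z + Pi.single j v ∈
      Set.univ.pi fun i => Metric.ball (0 : Cn n) (if i = j then r else 1) := by
  intro i _
  rw [mem_ball_zero_iff]
  rw [mem_ball_zero_iff, pi_norm_lt_iff one_pos] at hZ
  by_cases hi : i = j
  · subst hi
    simpa using hv
  · simpa [hi] using hZ i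

theorem linComb_transvection {E : Type*} [AddCommGroup E] [Module ℂ E] [Fintype ι]
    [DecidableEq ι] (i j : ι) (c : ℂ) (Z : ι → E) :
    linComb (transvection i j c) Z = Z + Pi.single j (c • Z i) := by
  funext b
  simp only [linComb_apply, transvection, Matrix.add_apply, add_smul, Finset.sum_add_distrib,
    Matrix.one_apply, Matrix.single_apply, Pi.add_apply, Pi.single_apply]
  congr 1
  · simp
  · by_cases hb : b = j
    · simp [hb]
    · simp [hb, Ne.symm hb]

theorem norm_add_smul_lt_sqrt {E : Type*} [NormedAddCommGroup E] [InnerProductSpace ℂ E]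
    {x y : E} {z : ℂ} {δ : ℝ} (hδ : 0 < δ) (hz : ‖z‖ = 1) (hx : ‖x‖ ^ 2 ≤ 2) (hy : ‖y‖ < 1)
    (h : δ ≤ (z * inner ℂ x y).re) :
    ‖y + (-(δ / 2 : ℝ) * star z : ℂ) • x‖ < √(1 - δ ^ 2 / 2) := by
  apply Real.lt_sqrt_of_sq_lt
  have hinner : RCLike.re ((-(δ / 2 : ℝ) * star z : ℂ) * inner ℂ y x)
      = -(δ / 2) * (z * inner ℂ x y).re := by
    rw [← inner_conj_symm, show (-(δ / 2 : ℝ) * star z : ℂ) * (starRingEnd ℂ) (inner ℂ x y)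
      = ((-(δ / 2) : ℝ) : ℂ) * (starRingEnd ℂ) (z * inner ℂ x y) by simp; ring]
    exact (Complex.re_ofReal_mul _ _).trans (by rw [Complex.conj_re])
  have hnorm : ‖(-(δ / 2 : ℝ) * star z : ℂ)‖ = δ / 2 := by
    rw [norm_mul, norm_star, hz, norm_neg, Complex.norm_real, Real.norm_of_nonneg (by positivity),
      mul_one]
  rw [@norm_add_sq ℂ, inner_smul_right, norm_smul, hinner, hnorm, mul_pow]
  nlinarith [norm_nonneg y]

/-- Tuples in the product of unit balls that are nearly orthonormal and nearly orthogonal to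
the members of `X`; in high dimension they fill most of the product of unit balls. -/
def nearOrtho [Fintype ι] [DecidableEq ι] (δ : ℝ) (X : κ → Cn n) : Set (ι → Cn n) :=
  {Z | Z ∈ Metric.ball 0 1 ∧ gram ℂ Z ∈ entryBall 1 δ ∧ ∀ i j, ‖inner ℂ (X i) (Z j)‖ < δ}

theorem isOpen_nearOrtho [Fintype ι] [DecidableEq ι] [Finite κ] (δ : ℝ) (X : κ → Cn n) :
    IsOpen (nearOrtho (ι := ι) δ X) := by
  have hinner : IsOpen {Z : ι → Cn n | ∀ i j, ‖inner ℂ (X i) (Z j)‖ < δ} := by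
    simp only [Set.ofPred_forall]
    exact isOpen_iInter_of_finite fun i => isOpen_iInter_of_finite fun j =>
      isOpen_lt (by fun_prop) continuous_const
  exact Metric.isOpen_ball.inter (((isOpen_entryBall 1 δ).preimage continuous_gram).inter hinner)

/-- The fourth roots of unity: finitely many directions that detect the size of a complex number
through real parts. -/
def fourthRoot : Fin 4 → ℂ := ![1, -1, Complex.I, -Complex.I]

theorem norm_fourthRoot (a : Fin 4) : ‖fourthRoot a‖ = 1 := by
  fin_cases a <;> simp [fourthRoot]

theorem exists_le_re_fourthRoot_mul {z : ℂ} {δ : ℝ} (h : 2 * δ ≤ ‖z‖) :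
    ∃ a, δ ≤ (fourthRoot a * z).re := by
  by_contra! hlt
  have hre : |z.re| < δ :=
    abs_lt.2 ⟨by linarith [show -z.re < δ by simpa [fourthRoot] using hlt 1],
      by simpa [fourthRoot] using hlt 0⟩
  have him : |z.im| < δ :=
    abs_lt.2 ⟨by linarith [show -z.im < δ by simpa [fourthRoot] using hlt 2],
      by simpa [fourthRoot] using hlt 3⟩
  linarith [Complex.norm_le_abs_re_add_abs_im z]

section BadSets

variable [Fintype ι] {δ : ℝ}

theorem tupleVolume_pi_ball_ite_sqrt [DecidableEq ι] (hδ : 0 < δ) (hδ1 : δ < 1) (j : ι) :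
    tupleVolume ι n
        (Set.univ.pi fun i => Metric.ball (0 : Cn n) (if i = j then √(1 - δ ^ 2 / 2) else 1))
      = ENNReal.ofReal (1 - δ ^ 2 / 2) ^ n := by
  rw [tupleVolume_pi_ball_ite j (Real.sqrt_pos.2 (by nlinarith)), Real.sq_sqrt (by nlinarith)]

theorem tupleVolume_norm_sq_le_le (j : ι) (hδ : 0 < δ) (hδ1 : δ < 1) :
    tupleVolume ι n {Z | Z ∈ Metric.ball 0 1 ∧ ‖Z j‖ ^ 2 ≤ 1 - δ}
      ≤ ENNReal.ofReal (1 - δ ^ 2 / 2) ^ n := by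
  classical
  rw [← tupleVolume_pi_ball_ite_sqrt hδ hδ1 j]
  refine measure_mono fun Z hZ => ?_
  have hv : ‖Z j + 0‖ < √(1 - δ ^ 2 / 2) := by
    rw [add_zero]
    exact Real.lt_sqrt_of_sq_lt (by nlinarith [hZ.2])
  simpa only [Pi.single_zero, add_zero] using add_single_mem_pi_ball_ite hZ.1 hv

/-- A volume preserving shear moves this set into a product of balls one of which is smaller. -/
theorem tupleVolume_le_re_inner_apply_apply_le {i j : ι} (hij : i ≠ j) {z : ℂ} (hδ : 0 < δ)
    (hδ1 : δ < 1) (hz : ‖z‖ = 1) :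
    tupleVolume ι n {Z | Z ∈ Metric.ball 0 1 ∧ δ ≤ (z * inner ℂ (Z i) (Z j)).re}
      ≤ ENNReal.ofReal (1 - δ ^ 2 / 2) ^ n := by
  classical
  set A : Set (ι → Cn n) := {Z | Z ∈ Metric.ball 0 1 ∧ δ ≤ (z * inner ℂ (Z i) (Z j)).re}
  have hshear := tupleVolume_image_linComb (transvection i j (-(δ / 2 : ℝ) * star z : ℂ)) A
  rw [det_transvection_of_ne _ _ hij] at hshear
  simp only [norm_one, one_pow, ENNReal.ofReal_one, one_mul] at hshear
  rw [← hshear, ← tupleVolume_pi_ball_ite_sqrt hδ hδ1 j]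
  refine measure_mono ?_
  rintro _ ⟨Z, hZ, rfl⟩
  have hZ_norm := (pi_norm_lt_iff one_pos).1 (mem_ball_zero_iff.1 hZ.1)
  rw [linComb_transvection]
  exact add_single_mem_pi_ball_ite hZ.1 (norm_add_smul_lt_sqrt hδ hz
    (by nlinarith [hZ_norm i, norm_nonneg (Z i)]) (hZ_norm j) hZ.2)

theorem tupleVolume_le_re_inner_apply_le {x : Cn n} (hx : ‖x‖ ^ 2 ≤ 2) (j : ι) {z : ℂ}
    (hδ : 0 < δ) (hδ1 : δ < 1) (hz : ‖z‖ = 1) :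
    tupleVolume ι n {Z | Z ∈ Metric.ball 0 1 ∧ δ ≤ (z * inner ℂ x (Z j)).re}
      ≤ ENNReal.ofReal (1 - δ ^ 2 / 2) ^ n := by
  classical
  rw [← tupleVolume_pi_ball_ite_sqrt hδ hδ1 j, ← measure_preimage_add_right (tupleVolume ι n)
    (Pi.single j ((-(δ / 2 : ℝ) * star z : ℂ) • x)) (Set.univ.pi _)]
  refine measure_mono fun Z hZ => add_single_mem_pi_ball_ite hZ.1 ?_
  exact norm_add_smul_lt_sqrt hδ hz hx
    ((pi_norm_lt_iff one_pos).1 (mem_ball_zero_iff.1 hZ.1) j) hZ.2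

variable [DecidableEq ι]

theorem ball_subset_nearOrtho_union (hδ : 0 < δ) (X : κ → Cn n) :
    Metric.ball (0 : ι → Cn n) 1 ⊆
      (nearOrtho (2 * δ) X ∪ ⋃ j, {Z | Z ∈ Metric.ball 0 1 ∧ ‖Z j‖ ^ 2 ≤ 1 - δ}) ∪
      ((⋃ t : {p : ι × ι // p.1 ≠ p.2} × Fin 4, {Z | Z ∈ Metric.ball 0 1 ∧
          δ ≤ (fourthRoot t.2 * inner ℂ (Z t.1.1.1) (Z t.1.1.2)).re}) ∪
        ⋃ t : (κ × ι) × Fin 4, {Z | Z ∈ Metric.ball 0 1 ∧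
          δ ≤ (fourthRoot t.2 * inner ℂ (X t.1.1) (Z t.1.2)).re}) := by
  intro Z hZ
  by_contra hnot
  simp only [Set.mem_union, Set.mem_iUnion, Set.mem_ofPred_eq, not_or, not_exists, not_and,
    not_le] at hnot
  obtain ⟨⟨hnear, hlong⟩, hself, hX⟩ := hnot
  refine hnear ⟨hZ, fun i j => ?_, fun i j => ?_⟩
  · obtain rfl | hij := eq_or_ne i j
    · have hi := (pi_norm_lt_iff one_pos).1 (mem_ball_zero_iff.1 hZ) i
      rw [gram_apply_self, Matrix.one_apply_eq, ← Complex.ofReal_one, ← Complex.ofReal_sub,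
        Complex.norm_real, Real.norm_eq_abs, abs_lt]
      constructor <;> nlinarith [norm_nonneg (Z i), hlong i hZ]
    · rw [Matrix.one_apply_ne hij, sub_zero, gram_apply]
      by_contra! h
      obtain ⟨a, ha⟩ := exists_le_re_fourthRoot_mul h
      exact (hself (⟨(i, j), hij⟩, a) hZ).not_ge ha
  · by_contra! h
    obtain ⟨a, ha⟩ := exists_le_re_fourthRoot_mul h
    exact (hX ((i, j), a) hZ).not_ge ha

theorem measure_iUnion_le_card_mul {Ω T : Type*} [MeasurableSpace Ω] [Fintype T] (μ : Measure Ω)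
    {A : T → Set Ω} {v : ENNReal} (hA : ∀ t, μ (A t) ≤ v) :
    μ (⋃ t, A t) ≤ Fintype.card T * v := by
  refine (measure_iUnion_fintype_le _ _).trans ((Finset.sum_le_sum fun t _ => hA t).trans ?_)
  simp

theorem one_le_tupleVolume_nearOrtho_add [Fintype κ] (hδ : 0 < δ) (hδ1 : δ < 1) {X : κ → Cn n}
    (hX : ∀ i, ‖X i‖ ^ 2 ≤ 2) :
    1 ≤ tupleVolume ι n (nearOrtho (2 * δ) X) + (Fintype.card ι +
      (Fintype.card ({p : ι × ι // p.1 ≠ p.2} × Fin 4) + Fintype.card ((κ × ι) × Fin 4)) : ℕ) *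
        ENNReal.ofReal (1 - δ ^ 2 / 2) ^ n := by
  set v := ENNReal.ofReal (1 - δ ^ 2 / 2) ^ n
  calc (1 : ENNReal) = tupleVolume ι n (Metric.ball 0 1) := by
        rw [tupleVolume_ball _ one_pos]
        simp
    _ ≤ _ := measure_mono (ball_subset_nearOrtho_union hδ X)
    _ ≤ _ := (measure_union_le _ _).trans
        (add_le_add (measure_union_le _ _) (measure_union_le _ _))
    _ ≤ _ := add_le_add
        (add_le_add le_rfl
          (measure_iUnion_le_card_mul _ fun j => tupleVolume_norm_sq_le_le j hδ hδ1))
        (add_le_add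
          (measure_iUnion_le_card_mul _ fun t =>
            tupleVolume_le_re_inner_apply_apply_le t.1.2 hδ hδ1 (norm_fourthRoot t.2))
          (measure_iUnion_le_card_mul _ fun t =>
            tupleVolume_le_re_inner_apply_le (hX t.1.1) t.1.2 hδ hδ1 (norm_fourthRoot t.2)))
    _ = _ := by
        push_cast
        ring

end BadSets

theorem nearOrtho_mono [Fintype ι] [DecidableEq ι] {δ δ' : ℝ} (h : δ ≤ δ') (X : κ → Cn n) :
    nearOrtho (ι := ι) δ X ⊆ nearOrtho δ' X := fun _ hZ =>
  ⟨hZ.1, entryBall_mono 1 h hZ.2.1, fun i j => (hZ.2.2 i j).trans_le h⟩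

theorem eventually_half_le_tupleVolume_nearOrtho (ι κ : Type*) [Fintype ι] [DecidableEq ι]
    [Finite κ] {δ : ℝ} (hδ : 0 < δ) :
    ∀ᶠ n in atTop, ∀ X : κ → Cn n, (∀ i, ‖X i‖ ^ 2 ≤ 2) →
      2⁻¹ ≤ tupleVolume ι n (nearOrtho δ X) := by
  cases nonempty_fintype κ
  obtain ⟨d, hdδ, hd, hd1⟩ : ∃ d, 2 * d ≤ δ ∧ 0 < d ∧ d < 1 :=
    ⟨min δ 1 / 2, by linarith [min_le_left δ 1], by positivity, by linarith [min_le_right δ 1]⟩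
  set C : ℕ := Fintype.card ι +
    (Fintype.card ({p : ι × ι // p.1 ≠ p.2} × Fin 4) + Fintype.card ((κ × ι) × Fin 4))
  have hbad : Tendsto (fun n : ℕ => (C : ENNReal) * ENNReal.ofReal (1 - d ^ 2 / 2) ^ n) atTop
      (𝓝 0) := by
    simpa using ENNReal.Tendsto.const_mul (ENNReal.tendsto_pow_atTop_nhds_zero_of_lt_one
      (ENNReal.ofReal_lt_one.2 (by nlinarith))) (Or.inr (ENNReal.natCast_ne_top C))
  filter_upwards [hbad.eventually_le_const (by simp : (0 : ENNReal) < 2⁻¹)] with n hn X hX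
  have hcover := (one_le_tupleVolume_nearOrtho_add (ι := ι) hd hd1 hX).trans
    (add_le_add (measure_mono (nearOrtho_mono hdδ X)) hn)
  rw [← ENNReal.inv_two_add_inv_two] at hcover
  exact (ENNReal.add_le_add_iff_right (by simp)).1 hcover

theorem eventually_half_le_tupleVolume_nearOrtho_empty (ι : Type*) [Fintype ι] [DecidableEq ι]
    {δ : ℝ} (hδ : 0 < δ) :
    ∀ᶠ n in atTop, 2⁻¹
      ≤ tupleVolume ι n (nearOrtho δ (Empty.elim : Empty → Cn n)) :=
  (eventually_half_le_tupleVolume_nearOrtho ι Empty hδ).mono fun _ h => h _ fun i => i.elim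

theorem eventually_le_tupleVolume_gram [Fintype ι] [DecidableEq ι] {q : Matrix ι ι ℂ}
    (hq : q.PosDef) {N : Set (Matrix ι ι ℂ)} (hN : N ∈ 𝓝 q) :
    ∀ᶠ n in atTop, 2⁻¹ * ENNReal.ofReal q.det.re ^ n
      ≤ tupleVolume ι n {W | gram ℂ W ∈ N} := by
  obtain ⟨D, rfl, -, hdet⟩ := exists_conjTranspose_mul_self_eq hq
  have hconj : Tendsto (fun M : Matrix ι ι ℂ => Dᴴ * M * D) (𝓝 1) (𝓝 (Dᴴ * D)) := by
    have hcont : Continuous fun M : Matrix ι ι ℂ => Dᴴ * M * D := by fun_prop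
    simpa only [Matrix.mul_one] using hcont.tendsto 1
  obtain ⟨δ, hδ, hδN⟩ := exists_entryBall_subset (hconj hN)
  filter_upwards [eventually_half_le_tupleVolume_nearOrtho_empty ι hδ] with n hn
  set A : Set (ι → Cn n) := nearOrtho δ (Empty.elim : Empty → Cn n)
  calc 2⁻¹ * ENNReal.ofReal (Dᴴ * D).det.re ^ n
      ≤ tupleVolume ι n A * ENNReal.ofReal (Dᴴ * D).det.re ^ n := by gcongr
    _ = tupleVolume ι n (linComb D '' A) := by rw [tupleVolume_image_linComb, hdet, mul_comm]
    _ ≤ tupleVolume ι n {W | gram ℂ W ∈ N} := by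
        refine measure_mono ?_
        rintro _ ⟨Z, hZ, rfl⟩
        simpa only [Set.mem_preimage, Set.mem_ofPred_eq, gram_linComb] using hδN hZ.2.1

end NearOrthogonality

/-! ### Hitting probabilities of random unitaries -/

section UnitaryAction

/-- The action of the unitary group on `ℂⁿ` by linear isometries. -/
noncomputable def unitaryIsometry (n : ℕ) :
    unitaryGroup (Fin n) ℂ ≃* (Cn n ≃ₗᵢ[ℂ] Cn n) :=
  (Unitary.mapEquiv
    { (Matrix.toEuclideanCLM (n := Fin n) (𝕜 := ℂ) : _ ≃* (Cn n →L[ℂ] Cn n)) with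
      map_star' := map_star (Matrix.toEuclideanCLM (n := Fin n) (𝕜 := ℂ)) }).toMulEquiv.trans
    Unitary.linearIsometryEquiv

variable {n : ℕ}

theorem unitaryIsometry_apply (U : unitaryGroup (Fin n) ℂ) (x : Cn n) :
    unitaryIsometry n U x = WithLp.toLp 2 ((U : Matrix (Fin n) (Fin n) ℂ) *ᵥ x.ofLp) :=
  rfl

theorem continuous_unitaryIsometry_apply {α : Type*} [TopologicalSpace α]
    {f : α → unitaryGroup (Fin n) ℂ} {g : α → Cn n} (hf : Continuous f) (hg : Continuous g) :
    Continuous fun a => unitaryIsometry n (f a) (g a) := by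
  simp only [unitaryIsometry_apply]
  exact (PiLp.continuous_toLp 2 _).comp ((continuous_subtype_val.comp hf).matrix_mulVec
    ((PiLp.continuous_ofLp 2 _).comp hg))

instance : SecondCountableTopology (unitaryGroup (Fin n) ℂ) :=
  haveI : SecondCountableTopology (Matrix (Fin n) (Fin n) ℂ) :=
    inferInstanceAs (SecondCountableTopology (Fin n → Fin n → ℂ))
  inferInstanceAs (SecondCountableTopology
    ((unitaryGroup (Fin n) ℂ : Set (Matrix (Fin n) (Fin n) ℂ))))

instance : CompactSpace (unitaryGroup (Fin n) ℂ) := by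
  refine isCompact_iff_compactSpace.mp
    (?_ : IsCompact (unitaryGroup (Fin n) ℂ : Set (Matrix (Fin n) (Fin n) ℂ)))
  have hK : IsCompact (Set.univ.pi fun _ : Fin n => Set.univ.pi fun _ : Fin n =>
      Metric.closedBall (0 : ℂ) 1) :=
    isCompact_univ_pi fun _ => isCompact_univ_pi fun _ => isCompact_closedBall _ _
  refine IsCompact.of_isClosed_subset (X := Matrix (Fin n) (Fin n) ℂ) hK
    (isClosed_unitary (R := Matrix (Fin n) (Fin n) ℂ)) fun U hU i _ j _ => ?_
  rw [mem_closedBall_zero_iff]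
  exact entry_norm_bound_of_unitary hU i j

end UnitaryAction

section HittingProbability

variable {ι : Type*} [Fintype ι] {n : ℕ}

/-- The probability that a unitary matrix with law `ν` moves the tuple `X` to within distance
`ρ` of the tuple `Y`. -/
noncomputable def hitProb (ν : Measure (unitaryGroup (Fin n) ℂ)) (X Y : ι → Cn n) (ρ : ℝ) :
    ENNReal :=
  ν {U | Y ∈ Metric.ball (unitaryIsometry n U ∘ X) ρ}

theorem isOpen_setOf_mem_ball_unitaryIsometry_comp (X : ι → Cn n) (ρ : ℝ) :
    IsOpen {p : (ι → Cn n) × unitaryGroup (Fin n) ℂ |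
      p.1 ∈ Metric.ball (unitaryIsometry n p.2 ∘ X) ρ} :=
  isOpen_lt (continuous_fst.dist (continuous_pi fun _ =>
    continuous_unitaryIsometry_apply continuous_snd continuous_const)) continuous_const

variable (ν : Measure (unitaryGroup (Fin n) ℂ))

theorem hitProb_le_of_dist_lt [ν.IsMulLeftInvariant] (X : ι → Cn n) {Y Y' : ι → Cn n}
    {ρ η ρ' : ℝ} (H : Cn n ≃ₗᵢ[ℂ] Cn n) (hH : dist (H ∘ Y) Y' < η) (hρ : ρ + η ≤ ρ') :
    hitProb ν X Y ρ ≤ hitProb ν X Y' ρ' := by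
  obtain ⟨G, rfl⟩ := (unitaryIsometry n).surjective H
  rw [hitProb, hitProb,
    ← measure_preimage_mul ν G {U | Y' ∈ Metric.ball (unitaryIsometry n U ∘ X) ρ'}]
  refine measure_mono fun U (hU : dist Y (unitaryIsometry n U ∘ X) < ρ) => ?_
  have hρ_pos : 0 < ρ := dist_nonneg.trans_lt hU
  have hG : dist (unitaryIsometry n G ∘ Y) (unitaryIsometry n (G * U) ∘ X) < ρ := by
    rw [dist_pi_lt_iff hρ_pos] at hU ⊢
    intro j
    rw [map_mul, LinearIsometryEquiv.coe_mul]
    exact ((unitaryIsometry n G).dist_map _ _).trans_lt (hU j)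
  change dist Y' (unitaryIsometry n (G * U) ∘ X) < ρ'
  linarith [dist_triangle_left Y' (unitaryIsometry n (G * U) ∘ X) (unitaryIsometry n G ∘ Y)]

theorem setLIntegral_hitProb [SFinite ν] (X : ι → Cn n) (ρ : ℝ) (A : Set (ι → Cn n)) :
    ∫⁻ Y in A, hitProb ν X Y ρ ∂(tupleVolume ι n) =
      ∫⁻ U, (tupleVolume ι n).restrict A (Metric.ball (unitaryIsometry n U ∘ X) ρ) ∂ν := by
  have hmeas := (isOpen_setOf_mem_ball_unitaryIsometry_comp X ρ).measurableSet
  exact (Measure.prod_apply (μ := (tupleVolume ι n).restrict A) (ν := ν) hmeas).symm.trans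
    (Measure.prod_apply_symm hmeas)

variable {ν} [IsProbabilityMeasure ν] {X Y : ι → Cn n} {ρ ρ' : ℝ} {A : Set (ι → Cn n)}

theorem hitProb_mul_tupleVolume_le (hρ' : 0 < ρ') (hA : MeasurableSet A)
    (h : ∀ Y' ∈ A, hitProb ν X Y ρ ≤ hitProb ν X Y' ρ') :
    hitProb ν X Y ρ * tupleVolume ι n A ≤ ENNReal.ofReal (ρ' ^ (2 * Fintype.card ι)) ^ n :=
  calc hitProb ν X Y ρ * tupleVolume ι n A
      = ∫⁻ _ in A, hitProb ν X Y ρ ∂(tupleVolume ι n) := by rw [setLIntegral_const]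
    _ ≤ ∫⁻ Y' in A, hitProb ν X Y' ρ' ∂(tupleVolume ι n) :=
      setLIntegral_mono_ae' hA (ae_of_all _ h)
    _ ≤ ∫⁻ _U, ENNReal.ofReal (ρ' ^ (2 * Fintype.card ι)) ^ n ∂ν := by
      rw [setLIntegral_hitProb]
      exact lintegral_mono fun U =>
        (Measure.restrict_apply_le _ _).trans_eq (tupleVolume_ball _ hρ')
    _ = ENNReal.ofReal (ρ' ^ (2 * Fintype.card ι)) ^ n := by simp

theorem le_hitProb_mul_tupleVolume {c : ENNReal} (hA : MeasurableSet A)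
    (h : ∀ Y' ∈ A, hitProb ν X Y' ρ' ≤ hitProb ν X Y ρ)
    (hc : ∀ U, c ≤ tupleVolume ι n (Metric.ball (unitaryIsometry n U ∘ X) ρ' ∩ A)) :
    c ≤ hitProb ν X Y ρ * tupleVolume ι n A :=
  calc c = ∫⁻ _U, c ∂ν := by simp
    _ ≤ ∫⁻ Y' in A, hitProb ν X Y' ρ' ∂(tupleVolume ι n) := by
      rw [setLIntegral_hitProb]
      simp_rw [Measure.restrict_apply' hA]
      exact lintegral_mono hc
    _ ≤ ∫⁻ _ in A, hitProb ν X Y ρ ∂(tupleVolume ι n) :=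
      setLIntegral_mono_ae' hA (ae_of_all _ h)
    _ = hitProb ν X Y ρ * tupleVolume ι n A := by rw [setLIntegral_const]

end HittingProbability

section HittingProbabilityUpper

theorem le_two_mul_of_mul_half_le {h : ENNReal} {d x y : ℝ} {n : ℕ} (hd : 0 < d)
    (hxy : x ≤ d * y) (hle : h * (ENNReal.ofReal d ^ n * 2⁻¹) ≤ ENNReal.ofReal x ^ n) :
    h ≤ 2 * ENNReal.ofReal y ^ n := by
  have hd_ne_zero : ENNReal.ofReal d ^ n ≠ 0 := pow_ne_zero _ (by simpa using hd)
  have hd_ne_top : ENNReal.ofReal d ^ n ≠ ⊤ := by finiteness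
  rw [← ENNReal.mul_le_mul_iff_right hd_ne_zero hd_ne_top]
  calc ENNReal.ofReal d ^ n * h
      = 2 * 2⁻¹ * (ENNReal.ofReal d ^ n * h) := by
        rw [ENNReal.mul_inv_cancel two_ne_zero (by simp), one_mul]
    _ = 2 * (h * (ENNReal.ofReal d ^ n * 2⁻¹)) := by ring
    _ ≤ 2 * ENNReal.ofReal (d * y) ^ n := by grw [hle, hxy]
    _ = ENNReal.ofReal d ^ n * (2 * ENNReal.ofReal y ^ n) := by
        rw [ENNReal.ofReal_mul hd.le, mul_pow]
        ring

variable (ι : Type*) [Fintype ι] [DecidableEq ι]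

theorem exists_nhds_one_hitProb_le {κ : ℝ} (hκ : 0 < κ) :
    ∃ N ∈ 𝓝 (1 : Matrix ι ι ℂ), ∀ ρ : ℝ, 0 < ρ → ∀ᶠ n in atTop,
      ∀ (ν : Measure (unitaryGroup (Fin n) ℂ)) [ν.IsMulLeftInvariant] [IsProbabilityMeasure ν]
        (X Y : ι → Cn n), gram ℂ Y ∈ N →
        hitProb ν X Y ρ ≤ 2 * ENNReal.ofReal ((1 + κ) * ρ ^ (2 * Fintype.card ι)) ^ n := by
  obtain ⟨η, hη, hηκ⟩ : ∃ η > 0, (1 + η) ^ (2 * Fintype.card ι) < 1 + κ / 2 := by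
    have hcont : Continuous fun η : ℝ => (1 + η) ^ (2 * Fintype.card ι) := by fun_prop
    exact ((hcont.tendsto 0).eventually_lt_const (by simpa using hκ)).exists_gt
  have hdet : ∀ᶠ M in 𝓝 (1 : Matrix ι ι ℂ), 1 + κ / 2 < M.det.re * (1 + κ) := by
    have hcont : Continuous fun M : Matrix ι ι ℂ => M.det.re * (1 + κ) := by fun_prop
    exact (hcont.tendsto 1).eventually_const_lt (by simpa using hκ)
  have hdiag : ∀ᶠ M in 𝓝 (1 : Matrix ι ι ℂ), ∀ j, (M j j).re < 2 ^ 2 :=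
    eventually_all.2 fun j => by
      have hcont : Continuous fun M : Matrix ι ι ℂ => (M j j).re := by fun_prop
      exact (hcont.tendsto 1).eventually_lt_const (by norm_num)
  refine ⟨_, hdet.and hdiag, fun ρ hρ => ?_⟩
  obtain ⟨δ, hδ, hδH⟩ :=
    exists_linearIsometryEquiv_dist_linComb_lt ι zero_le_two (mul_pos hη hρ)
  filter_upwards [eventually_half_le_tupleVolume_nearOrtho_empty ι hδ] with n hn ν _ _ X Y hY
  set A : Set (ι → Cn n) := nearOrtho δ (Empty.elim : Empty → Cn n)
  have hgram_pos : 0 < (gram ℂ Y).det.re := by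
    by_contra! h
    nlinarith [hY.1]
  have hgram : (gram ℂ Y).PosDef := by
    rw [(Matrix.posSemidef_gram ℂ Y).posDef_iff_det_ne_zero]
    intro h
    simp [h] at hgram_pos
  obtain ⟨D, hDY, hD, hD_det⟩ := exists_conjTranspose_mul_self_eq hgram
  have hA : MeasurableSet (linComb D '' A) := by
    rw [image_linComb_eq_preimage hD]
    exact ((isOpen_nearOrtho _ _).preimage
      (LinearMap.continuous_of_finiteDimensional _)).measurableSet
  have hmono : ∀ Y' ∈ linComb D '' A, hitProb ν X Y ρ ≤ hitProb ν X Y' ((1 + η) * ρ) := by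
    rintro _ ⟨Z, hZ, rfl⟩
    obtain ⟨H, hH⟩ := hδH (Cn n) D Y Z hD hDY (fun j => (hY.2 j).le) hZ.2.1
    exact hitProb_le_of_dist_lt ν X H hH (by linarith)
  refine le_two_mul_of_mul_half_le hgram_pos ?_
    (le_trans ?_ (hitProb_mul_tupleVolume_le (by positivity) hA hmono))
  · rw [mul_pow, ← mul_assoc]
    exact mul_le_mul_of_nonneg_right (hηκ.trans hY.1).le (by positivity)
  · rw [tupleVolume_image_linComb, hD_det]
    gcongr

end HittingProbabilityUpper

section HittingProbabilityLower

theorem smul_add_smul_mem_ball {E : Type*} [NormedAddCommGroup E] [NormedSpace ℂ E] {X G : E}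
    {a r ρ : ℝ} (ha : 0 ≤ a) (hr : 0 < r) (har : a ^ 2 + r ^ 2 = 1) (hX : ‖X‖ ≤ 2)
    (hG : G ∈ Metric.ball 0 1) (hρ : r + 2 * r ^ 2 ≤ ρ) :
    (r : ℂ) • G + (a : ℂ) • X ∈ Metric.ball X ρ := by
  have ha_le : a ≤ 1 := by nlinarith
  rw [mem_ball_zero_iff] at hG
  rw [mem_ball_iff_norm]
  calc ‖(r : ℂ) • G + (a : ℂ) • X - X‖ = ‖(r : ℂ) • G - ((1 - a : ℝ) : ℂ) • X‖ := by
        congr 1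
        push_cast
        module
    _ ≤ r * ‖G‖ + (1 - a) * ‖X‖ := by
        refine (norm_sub_le _ _).trans_eq ?_
        rw [norm_smul, norm_smul, Complex.norm_real, Complex.norm_real,
          Real.norm_of_nonneg hr.le, Real.norm_of_nonneg (by linarith)]
    _ < ρ := by nlinarith [norm_nonneg X]

variable {ι : Type*} [DecidableEq ι] {n : ℕ}

theorem norm_sq_lt_of_gram_mem_entryBall {Z : ι → Cn n} {δ : ℝ}
    (h : gram ℂ Z ∈ entryBall 1 δ) (j : ι) : ‖Z j‖ ^ 2 < 1 + δ := by
  have hre := (Complex.abs_re_le_norm _).trans_lt (h j j)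
  rw [Complex.sub_re, re_gram_apply_self, Matrix.one_apply_eq, Complex.one_re, abs_lt] at hre
  linarith

variable [Fintype ι]

theorem tupleVolume_gram_entryBall_le {δ θ : ℝ} (hθ : 0 < θ) (hδθ : δ ≤ θ) :
    tupleVolume ι n {Z | gram ℂ Z ∈ entryBall 1 δ}
      ≤ ENNReal.ofReal ((1 + θ) ^ Fintype.card ι) ^ n := by
  have hsqrt : 0 < √(1 + θ) := by positivity
  calc tupleVolume ι n {Z | gram ℂ Z ∈ entryBall 1 δ}
      ≤ tupleVolume ι n (Metric.ball 0 (√(1 + θ))) := by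
        refine measure_mono fun Z hZ => ?_
        rw [mem_ball_zero_iff, pi_norm_lt_iff hsqrt]
        exact fun j => Real.lt_sqrt_of_sq_lt
          ((norm_sq_lt_of_gram_mem_entryBall hZ j).trans_le (by linarith))
    _ = ENNReal.ofReal ((1 + θ) ^ Fintype.card ι) ^ n := by
        rw [tupleVolume_ball _ hsqrt, pow_mul, Real.sq_sqrt (by positivity)]

theorem gram_smul_add_smul_mem_entryBall {X G : ι → Cn n} {a r δ : ℝ} (ha : 0 ≤ a) (hr : 0 ≤ r)
    (har : a ^ 2 + r ^ 2 = 1) (hδ : 0 < δ) (hX : gram ℂ X ∈ entryBall 1 (δ / 4))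
    (hG : G ∈ nearOrtho (δ / 4) X) :
    gram ℂ ((r : ℂ) • G + (a : ℂ) • X) ∈ entryBall 1 δ := by
  intro i j
  have hexpand : gram ℂ ((r : ℂ) • G + (a : ℂ) • X) i j - (1 : Matrix ι ι ℂ) i j
      = ((r ^ 2 : ℝ) : ℂ) * (gram ℂ G i j - (1 : Matrix ι ι ℂ) i j)
        + ((a * r : ℝ) : ℂ) * (inner ℂ (X i) (G j) + inner ℂ (G i) (X j))
        + ((a ^ 2 : ℝ) : ℂ) * (gram ℂ X i j - (1 : Matrix ι ι ℂ) i j) := by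
    have har' : (a : ℂ) ^ 2 + (r : ℂ) ^ 2 = 1 := by exact_mod_cast har
    simp only [gram_apply, Pi.add_apply, Pi.smul_apply, inner_add_left, inner_add_right,
      inner_smul_left, inner_smul_right, Complex.conj_ofReal]
    push_cast
    linear_combination (1 : Matrix ι ι ℂ) i j * har'
  have hcross : ‖inner ℂ (X i) (G j) + inner ℂ (G i) (X j)‖ ≤ δ / 2 := by
    have hji := hG.2.2 j i
    rw [norm_inner_symm] at hji
    linarith [norm_add_le (inner ℂ (X i) (G j)) (inner ℂ (G i) (X j)), hG.2.2 i j]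
  calc ‖gram ℂ ((r : ℂ) • G + (a : ℂ) • X) i j - (1 : Matrix ι ι ℂ) i j‖
      ≤ r ^ 2 * ‖gram ℂ G i j - (1 : Matrix ι ι ℂ) i j‖
        + a * r * ‖inner ℂ (X i) (G j) + inner ℂ (G i) (X j)‖
        + a ^ 2 * ‖gram ℂ X i j - (1 : Matrix ι ι ℂ) i j‖ := by
        rw [hexpand]
        refine norm_add₃_le.trans_eq ?_
        simp only [norm_mul, Complex.norm_real, norm_pow, Real.norm_of_nonneg ha,
          Real.norm_of_nonneg hr]
    _ ≤ r ^ 2 * (δ / 4) + a * r * (δ / 2) + a ^ 2 * (δ / 4) := by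
        gcongr
        · exact (hG.2.1 i j).le
        · exact (hX i j).le
    _ < δ := by nlinarith [sq_nonneg (a - r)]

/-- Writing `a ^ 2 + r ^ 2 = 1`, the points `r G + a X` with `G` nearly orthonormal and nearly
orthogonal to `X` are nearly orthonormal and lie within about `r` of `X`. -/
theorem le_tupleVolume_ball_inter_gram {X : ι → Cn n} {r ρ δ : ℝ} (hr : 0 < r) (hr1 : r < 1)
    (hρ : r + 2 * r ^ 2 ≤ ρ) (hδ : 0 < δ) (hδ1 : δ ≤ 1) (hX : gram ℂ X ∈ entryBall 1 (δ / 4))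
    (hvol : 2⁻¹ ≤ tupleVolume ι n (nearOrtho (δ / 4) X)) :
    2⁻¹ * ENNReal.ofReal (r ^ (2 * Fintype.card ι)) ^ n
      ≤ tupleVolume ι n (Metric.ball X ρ ∩ {Y | gram ℂ Y ∈ entryBall 1 δ}) := by
  set a := √(1 - r ^ 2)
  have ha : 0 ≤ a := Real.sqrt_nonneg _
  have har : a ^ 2 + r ^ 2 = 1 := by rw [Real.sq_sqrt (by nlinarith), sub_add_cancel]
  set R : Matrix ι ι ℂ := (r : ℂ) • 1
  have hR : ∀ G : ι → Cn n, linComb R G = (r : ℂ) • G := fun G => by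
    funext j
    simp [R, linComb_apply, Matrix.one_apply]
  have hR_det : ‖R.det‖ ^ 2 = r ^ (2 * Fintype.card ι) := by
    rw [det_smul, det_one, mul_one, norm_pow, Complex.norm_real, Real.norm_of_nonneg hr.le,
      ← pow_mul, mul_comm]
  have hX_norm : ‖X‖ ≤ 2 := (pi_norm_le_iff_of_nonneg zero_le_two).2 fun j => by
    nlinarith [norm_sq_lt_of_gram_mem_entryBall hX j, norm_nonneg (X j)]
  have hsub : linComb R '' nearOrtho (δ / 4) X ⊆ (· + (a : ℂ) • X) ⁻¹'
      (Metric.ball X ρ ∩ {Y | gram ℂ Y ∈ entryBall 1 δ}) := by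
    rintro _ ⟨G, hG, rfl⟩
    rw [hR]
    exact ⟨smul_add_smul_mem_ball ha hr har hX_norm hG.1 hρ,
      gram_smul_add_smul_mem_entryBall ha hr.le har hδ hX hG⟩
  calc 2⁻¹ * ENNReal.ofReal (r ^ (2 * Fintype.card ι)) ^ n
      ≤ tupleVolume ι n (linComb R '' nearOrtho (δ / 4) X) := by
        rw [tupleVolume_image_linComb, hR_det, mul_comm]
        gcongr
    _ ≤ _ := (measure_mono hsub).trans_eq (measure_preimage_add_right _ _ _)

theorem half_mul_le_of_half_mul_le_mul {h : ENNReal} {d x y : ℝ} {n : ℕ} (hd : 0 < d)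
    (hyx : y * d ≤ x) (hle : 2⁻¹ * ENNReal.ofReal x ^ n ≤ h * ENNReal.ofReal d ^ n) :
    2⁻¹ * ENNReal.ofReal y ^ n ≤ h := by
  have hd_ne_zero : ENNReal.ofReal d ^ n ≠ 0 := pow_ne_zero _ (by simpa using hd)
  have hd_ne_top : ENNReal.ofReal d ^ n ≠ ⊤ := by finiteness
  rw [← ENNReal.mul_le_mul_iff_left hd_ne_zero hd_ne_top]
  calc 2⁻¹ * ENNReal.ofReal y ^ n * ENNReal.ofReal d ^ n
      = 2⁻¹ * ENNReal.ofReal (y * d) ^ n := by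
        rw [ENNReal.ofReal_mul' hd.le, mul_pow, mul_assoc]
    _ ≤ 2⁻¹ * ENNReal.ofReal x ^ n := by grw [hyx]
    _ ≤ h * ENNReal.ofReal d ^ n := hle

variable (ι)

theorem exists_nhds_one_le_hitProb {κ : ℝ} (hκ : 0 < κ) (hκ1 : κ < 1) :
    ∃ ρ₀ > 0, ∀ ρ : ℝ, 0 < ρ → ρ ≤ ρ₀ → ∃ N ∈ 𝓝 (1 : Matrix ι ι ℂ), ∀ᶠ n in atTop,
      ∀ (ν : Measure (unitaryGroup (Fin n) ℂ)) [ν.IsMulLeftInvariant] [IsProbabilityMeasure ν]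
        (X Y : ι → Cn n), gram ℂ X ∈ N → gram ℂ Y ∈ N →
        2⁻¹ * ENNReal.ofReal ((1 - κ) * ρ ^ (2 * Fintype.card ι)) ^ n ≤ hitProb ν X Y ρ := by
  obtain ⟨θ, hθ, hθκ, hθ1⟩ : ∃ θ : ℝ, 0 < θ ∧ (1 - κ) * (1 + θ) ^ Fintype.card ι
      < (1 - θ) ^ (2 * Fintype.card ι) ∧ θ < 1 := by
    have hcont : Continuous fun θ : ℝ => (1 - κ) * (1 + θ) ^ Fintype.card ι := by fun_prop
    have hcont' : Continuous fun θ : ℝ => (1 - θ) ^ (2 * Fintype.card ι) := by fun_prop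
    exact ((hcont.continuousAt.eventually_lt hcont'.continuousAt (by simpa)).and
      (eventually_lt_nhds one_pos)).exists_gt
  refine ⟨θ / 4, by positivity, fun ρ hρ hρθ => ?_⟩
  obtain ⟨δ₁, hδ₁, hδ₁H⟩ := exists_entryBall_one_linearIsometryEquiv ι
    (show 0 < θ * ρ / 2 by positivity)
  set δ := min δ₁ θ
  have hδ : 0 < δ := lt_min hδ₁ hθ
  have hδδ₁ : δ ≤ δ₁ := min_le_left _ _
  have hδθ : δ ≤ θ := min_le_right _ _
  refine ⟨entryBall 1 (δ / 4), entryBall_mem_nhds _ (by positivity), ?_⟩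
  filter_upwards [eventually_half_le_tupleVolume_nearOrtho ι ι (show 0 < δ / 4 by positivity)]
    with n hn ν _ _ X Y hX hY
  set A : Set (ι → Cn n) := {Z | gram ℂ Z ∈ entryBall 1 δ}
  have hA : MeasurableSet A := ((isOpen_entryBall 1 δ).preimage continuous_gram).measurableSet
  have hmono : ∀ Y' ∈ A, hitProb ν X Y' (ρ - θ * ρ / 2) ≤ hitProb ν X Y ρ := fun Y' hY' => by
    obtain ⟨H, hH⟩ := hδ₁H (Cn n) Y' Y (entryBall_mono _ hδδ₁ hY')
      (entryBall_mono _ (by linarith) hY)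
    exact hitProb_le_of_dist_lt ν X H hH (by linarith)
  have hr_sq : ((1 - θ) * ρ) ^ 2 ≤ θ / 4 * ρ :=
    (pow_le_pow_left₀ (mul_nonneg (by linarith) hρ.le) (by nlinarith) 2).trans
      ((sq ρ).trans_le (by gcongr))
  have hball : ∀ U, 2⁻¹ * ENNReal.ofReal (((1 - θ) * ρ) ^ (2 * Fintype.card ι)) ^ n
      ≤ tupleVolume ι n (Metric.ball (unitaryIsometry n U ∘ X) (ρ - θ * ρ / 2) ∩ A) := fun U => by
    have hUX : gram ℂ (unitaryIsometry n U ∘ X) ∈ entryBall 1 (δ / 4) := by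
      rwa [gram_linearIsometryEquiv]
    exact le_tupleVolume_ball_inter_gram (mul_pos (by linarith) hρ) (by nlinarith)
      (by nlinarith) hδ (hδθ.trans hθ1.le) hUX
      (hn _ fun j => by linarith [norm_sq_lt_of_gram_mem_entryBall hUX j])
  refine half_mul_le_of_half_mul_le_mul (by positivity) ?_
    ((le_hitProb_mul_tupleVolume hA hmono hball).trans
      (mul_le_mul_right (tupleVolume_gram_entryBall_le hθ hδθ) _))
  rw [mul_pow, mul_right_comm]
  exact mul_le_mul_of_nonneg_right hθκ.le (by positivity)

end HittingProbabilityLower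

/-! ### Suffix-closed sets of words -/

section Words

variable {S : Type*}

theorem mk_singleton_injective :
    Function.Injective fun a : S × Bool => FreeGroup.mk [a] := by
  classical
  intro a b hab
  simpa [FreeGroup.toWord_mk] using congrArg FreeGroup.toWord hab

theorem exists_eq_mk_mul_of_adj {g h : FreeGroup S} (hgh : (leftCayleyGraph S).Adj g h) :
    ∃ a, h = FreeGroup.mk [a] * g := by
  obtain ⟨-, ⟨s, hs⟩ | ⟨s, hs⟩⟩ := (SimpleGraph.fromRel_adj _ _ _).1 hgh
  · exact ⟨(s, true), hs⟩
  · exact ⟨(s, false), eq_inv_mul_of_mul_eq hs.symm⟩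

variable [DecidableEq S]

theorem toWord_mk_singleton_mul (a : S × Bool) (y : FreeGroup S) :
    (FreeGroup.mk [a] * y).toWord = a :: y.toWord ∨
      y.toWord = (a.1, !a.2) :: (FreeGroup.mk [a] * y).toWord := by
  have toWord_eq : (FreeGroup.mk [a] * y).toWord = FreeGroup.reduce (a :: y.toWord) := by
    conv_lhs => rw [← FreeGroup.mk_toWord (x := y)]
    rw [FreeGroup.mul_mk, FreeGroup.toWord_mk, List.singleton_append]
  rw [toWord_eq, FreeGroup.reduce.cons, FreeGroup.reduce_toWord]
  rcases y.toWord with _ | ⟨b, l⟩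
  · exact Or.inl rfl
  · by_cases hab : a.1 = b.1 ∧ a.2 = !b.2
    · exact Or.inr (by simp [hab])
    · exact Or.inl (by simp [hab])

/-- The element obtained from `g` by deleting the first letter of its reduced word: the neighbour
of `g` in the left Cayley graph that is closer to the identity. The parent of `1` is `1`. -/
def wordParent (g : FreeGroup S) : FreeGroup S :=
  FreeGroup.mk g.toWord.tail

theorem toWord_wordParent (g : FreeGroup S) : (wordParent g).toWord = g.toWord.tail :=
  FreeGroup.toWord_mk.trans
    (FreeGroup.IsReduced.reduce_eq (List.IsChain.tail FreeGroup.isReduced_toWord))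

theorem wordParent_of_toWord_eq_cons {g h : FreeGroup S} {a : S × Bool}
    (hg : g.toWord = a :: h.toWord) : wordParent g = h := by
  rw [wordParent, hg, List.tail_cons, FreeGroup.mk_toWord]

theorem exists_toWord_eq_cons {g : FreeGroup S} (hg : g ≠ 1) :
    ∃ a, g.toWord = a :: (wordParent g).toWord := by
  obtain ⟨a, l, hal⟩ := List.exists_cons_of_ne_nil (FreeGroup.toWord_eq_nil_iff.not.2 hg)
  exact ⟨a, by rw [toWord_wordParent, hal, List.tail_cons]⟩

theorem eq_mk_mul_wordParent {g : FreeGroup S} {a : S × Bool}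
    (ha : g.toWord = a :: (wordParent g).toWord) : g = FreeGroup.mk [a] * wordParent g := by
  rw [wordParent, FreeGroup.mul_mk, ← toWord_wordParent, List.singleton_append, ← ha,
    FreeGroup.mk_toWord]

theorem exists_eq_mk_mul_wordParent {g : FreeGroup S} (hg : g ≠ 1) :
    ∃ a, g = FreeGroup.mk [a] * wordParent g :=
  (exists_toWord_eq_cons hg).imp fun _ => eq_mk_mul_wordParent

theorem norm_wordParent_add_one {g : FreeGroup S} (hg : g ≠ 1) :
    (wordParent g).norm + 1 = g.norm := by
  obtain ⟨a, ha⟩ := exists_toWord_eq_cons hg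
  rw [FreeGroup.norm, FreeGroup.norm, ha, List.length_cons]

theorem wordParent_eq_inv_mul_or (s : S) (x : FreeGroup S) :
    (x ≠ 1 ∧ wordParent x = (FreeGroup.of s)⁻¹ * x) ∨
      ((FreeGroup.of s)⁻¹ * x ≠ 1 ∧ wordParent ((FreeGroup.of s)⁻¹ * x) = x) := by
  have of_mul : FreeGroup.mk [(s, true)] * ((FreeGroup.of s)⁻¹ * x) = x :=
    mul_inv_cancel_left (FreeGroup.of s) x
  have ne_one_of_cons {g h : FreeGroup S} {a : S × Bool} (hg : g.toWord = a :: h.toWord) :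
      g ≠ 1 := by
    rintro rfl
    simp at hg
  rcases toWord_mk_singleton_mul (s, true) ((FreeGroup.of s)⁻¹ * x) with hword | hword <;>
    rw [of_mul] at hword
  · exact Or.inl ⟨ne_one_of_cons hword, wordParent_of_toWord_eq_cons hword⟩
  · exact Or.inr ⟨ne_one_of_cons hword, wordParent_of_toWord_eq_cons hword⟩

theorem adj_wordParent {g : FreeGroup S} (hg : g ≠ 1) :
    (leftCayleyGraph S).Adj g (wordParent g) := by
  obtain ⟨⟨s, b⟩, hsb⟩ := exists_eq_mk_mul_wordParent hg
  refine (SimpleGraph.fromRel_adj _ _ _).2 ⟨fun heq => ?_, ?_⟩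
  · have hnorm := norm_wordParent_add_one hg
    rw [← heq] at hnorm
    lia
  · cases b
    · exact Or.inl ⟨s, eq_mul_of_inv_mul_eq hsb.symm⟩
    · exact Or.inr ⟨s, hsb⟩

theorem norm_le_length_add_norm {u v : FreeGroup S} (p : (leftCayleyGraph S).Walk u v) :
    v.norm ≤ p.length + u.norm := by
  induction p with
  | nil => simp
  | @cons u w v hadj p ih =>
    obtain ⟨a, rfl⟩ := exists_eq_mk_mul_of_adj hadj
    have hmul := FreeGroup.norm_mul_le (FreeGroup.mk [a]) u
    have hletter : (FreeGroup.mk [a]).norm ≤ 1 := FreeGroup.norm_mk_le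
    rw [SimpleGraph.Walk.length_cons]
    exact ih.trans (by lia)

theorem wordParent_induction {P : FreeGroup S → Prop} (one : P 1)
    (of_wordParent : ∀ g, g ≠ 1 → P (wordParent g) → P g) (g : FreeGroup S) : P g := by
  by_cases hg : g = 1
  · exact hg ▸ one
  · exact of_wordParent g hg (wordParent_induction one of_wordParent (wordParent g))
termination_by g.norm
decreasing_by exact Nat.lt_of_succ_le (norm_wordParent_add_one hg).le

theorem exists_walk_one_length_eq_norm (g : FreeGroup S) :
    ∃ p : (leftCayleyGraph S).Walk g 1, p.length = g.norm := by
  induction g using wordParent_induction with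
  | one => exact ⟨SimpleGraph.Walk.nil, by simp⟩
  | of_wordParent g hg ih =>
    obtain ⟨p, hp⟩ := ih
    exact ⟨SimpleGraph.Walk.cons (adj_wordParent hg) p, by
      rw [SimpleGraph.Walk.length_cons, hp, norm_wordParent_add_one hg]⟩

theorem mem_cayleyBall [Finite S] {n : ℕ} {g : FreeGroup S} :
    g ∈ cayleyBall S n ↔ g.norm ≤ n := by
  rw [cayleyBall, Set.Finite.mem_toFinset]
  refine ⟨fun (hg : (leftCayleyGraph S).edist 1 g ≤ n) => ?_, fun hg => ?_⟩
  · obtain ⟨p, hp⟩ := SimpleGraph.exists_walk_of_edist_ne_top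
      (ne_top_of_le_ne_top (ENat.natCast_ne_top n) hg)
    have hlength : p.length ≤ n := by exact_mod_cast hp.trans_le hg
    simpa using (norm_le_length_add_norm p).trans (Nat.add_le_add_right hlength _)
  · obtain ⟨p, hp⟩ := exists_walk_one_length_eq_norm g
    refine (SimpleGraph.edist_le p.reverse).trans ?_
    rw [SimpleGraph.Walk.length_reverse, hp]
    exact_mod_cast hg

omit [DecidableEq S] in
theorem exists_subset_cayleyBall [Finite S] (F : Finset (FreeGroup S)) :
    ∃ n, F ⊆ cayleyBall S n := by
  classical
  exact ⟨F.sup FreeGroup.norm, fun _ hg =>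
    mem_cayleyBall.2 (Finset.le_sup (f := FreeGroup.norm) hg)⟩

omit [DecidableEq S] in
theorem cayleyBall_mono [Finite S] {m n : ℕ} (hmn : m ≤ n) :
    cayleyBall S m ⊆ cayleyBall S n := by
  classical
  exact fun _ hg => mem_cayleyBall.2 ((mem_cayleyBall.1 hg).trans hmn)

/-- A finite set of group elements containing `1` and closed under deleting the first letter of
reduced words. These are exactly the grounded sets, in the form that permits induction. -/
structure SuffixClosed (F : Finset (FreeGroup S)) : Prop where
  one_mem : 1 ∈ F
  wordParent_mem : ∀ g ∈ F, g ≠ 1 → wordParent g ∈ F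

variable {F : Finset (FreeGroup S)}

/- Along a walk from `g` to `1`, the word of `g` is at some point no longer a suffix of the current
word; the vertex reached at that point is the parent of `g`. -/
theorem wordParent_mem_of_walk {g : FreeGroup S} {u v : (F : Set (FreeGroup S))}
    (p : ((leftCayleyGraph S).induce (F : Set (FreeGroup S))).Walk u v)
    (hu : g.toWord <:+ u.1.toWord) (hv : ¬ g.toWord <:+ v.1.toWord) : wordParent g ∈ F := by
  induction p with
  | nil => exact absurd hu hv
  | @cons u w v huw _ ih =>
    by_cases hw : g.toWord <:+ w.1.toWord
    · exact ih hw hv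
    obtain ⟨a, ha⟩ : ∃ a, w.1 = FreeGroup.mk [a] * u.1 :=
      exists_eq_mk_mul_of_adj (SimpleGraph.comap_adj.1 huw)
    rcases toWord_mk_singleton_mul a u.1 with hword | hword <;> rw [← ha] at hword
    · exact absurd (hu.trans (hword ▸ List.suffix_cons _ _)) hw
    · rw [hword, List.suffix_cons_iff] at hu
      rw [wordParent_of_toWord_eq_cons (hu.resolve_right hw)]
      exact w.2

theorem IsGrounded.suffixClosed (hF : IsGrounded F) : SuffixClosed F := by
  refine ⟨hF.1, fun g hg hg1 => ?_⟩
  obtain ⟨p⟩ := hF.2.preconnected ⟨g, hg⟩ ⟨1, hF.1⟩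
  refine wordParent_mem_of_walk p List.suffix_rfl fun hsuffix => hg1 ?_
  rwa [FreeGroup.toWord_one, List.suffix_nil, FreeGroup.toWord_eq_nil_iff] at hsuffix

theorem SuffixClosed.isGrounded (hF : SuffixClosed F) : IsGrounded F := by
  have reachable_one (g : FreeGroup S) : ∀ hg : g ∈ F,
      ((leftCayleyGraph S).induce (F : Set (FreeGroup S))).Reachable ⟨g, hg⟩ ⟨1, hF.one_mem⟩ := by
    induction g using wordParent_induction with
    | one => exact fun _ => SimpleGraph.Reachable.refl _
    | of_wordParent g hg1 ih =>
      intro hg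
      have hparent := hF.wordParent_mem g hg hg1
      have hadj : ((leftCayleyGraph S).induce (F : Set (FreeGroup S))).Adj ⟨g, hg⟩
          ⟨wordParent g, hparent⟩ := SimpleGraph.comap_adj.2 (adj_wordParent hg1)
      exact hadj.reachable.trans (ih hparent)
  have : Nonempty (F : Set (FreeGroup S)) := ⟨⟨1, hF.one_mem⟩⟩
  exact ⟨hF.one_mem, ⟨fun u v => (reachable_one u.1 u.2).trans (reachable_one v.1 v.2).symm⟩⟩

theorem suffixClosed_cayleyBall [Finite S] (n : ℕ) : SuffixClosed (cayleyBall S n) where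
  one_mem := by simp [mem_cayleyBall]
  wordParent_mem g hg hg1 := by
    rw [mem_cayleyBall] at hg ⊢
    have := norm_wordParent_add_one hg1
    lia

theorem suffixClosed_singleton_one : SuffixClosed ({1} : Finset (FreeGroup S)) where
  one_mem := Finset.mem_singleton_self 1
  wordParent_mem _ hg hg1 := absurd (Finset.mem_singleton.1 hg) hg1

theorem SuffixClosed.erase (hF : SuffixClosed F) {g : FreeGroup S} (hg1 : g ≠ 1)
    (hg : ∀ h ∈ F, h.norm ≤ g.norm) : SuffixClosed (F.erase g) where
  one_mem := Finset.mem_erase.2 ⟨hg1.symm, hF.one_mem⟩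
  wordParent_mem h hh hh1 := by
    have hhF := Finset.mem_of_mem_erase hh
    refine Finset.mem_erase.2 ⟨?_, hF.wordParent_mem h hhF hh1⟩
    rintro rfl
    have := norm_wordParent_add_one hh1
    have := hg h hhF
    lia

end Words

section Edges

variable {S : Type*} [DecidableEq S] {F : Finset (FreeGroup S)} {s : S}

/-- The set `F ∩ sF`, whose element `x` stands for the edge from `s⁻¹x` to `x` of the left Cayley
graph. -/
abbrev EdgeSet (F : Finset (FreeGroup S)) (s : S) : Finset (FreeGroup S) :=
  F ∩ (FreeGroup.of s • F)

theorem mem_edgeSet {x : FreeGroup S} :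
    x ∈ EdgeSet F s ↔ x ∈ F ∧ (FreeGroup.of s)⁻¹ * x ∈ F := by
  rw [EdgeSet, Finset.mem_inter, ← Finset.inv_smul_mem_iff, smul_eq_mul]

/-- The end `x` of the edge from `s⁻¹x` to `x`. -/
def edgeTgt (x : EdgeSet F s) : F :=
  ⟨x.1, (mem_edgeSet.1 x.2).1⟩

/-- The beginning `s⁻¹x` of the edge from `s⁻¹x` to `x`. -/
def edgeSrc (x : EdgeSet F s) : F :=
  ⟨(FreeGroup.of s)⁻¹ * x.1, (mem_edgeSet.1 x.2).2⟩

theorem edgeTgt_injective : Function.Injective (edgeTgt (F := F) (s := s)) :=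
  fun _ _ hxy => Subtype.ext (congrArg Subtype.val hxy :)

/-- The endpoint of an edge that is further from the identity. -/
def edgeChild (e : Σ s : S, EdgeSet F s) : F :=
  if (edgeSrc e.2).1.norm < (edgeTgt e.2).1.norm then edgeTgt e.2 else edgeSrc e.2

theorem edgeChild_cases (e : Σ s : S, EdgeSet F s) :
    (edgeChild e = edgeTgt e.2 ∧ (edgeChild e).1 ≠ 1 ∧
        wordParent (edgeChild e).1 = (edgeSrc e.2).1) ∨
      (edgeChild e = edgeSrc e.2 ∧ (edgeChild e).1 ≠ 1 ∧
        wordParent (edgeChild e).1 = (edgeTgt e.2).1) := by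
  rcases wordParent_eq_inv_mul_or e.1 e.2.1 with ⟨hne, hparent⟩ | ⟨hne, hparent⟩ <;>
    have hnorm := norm_wordParent_add_one hne <;> rw [hparent] at hnorm
  · have hchild : edgeChild e = edgeTgt e.2 := if_pos (Nat.lt_of_succ_le hnorm.le)
    exact Or.inl ⟨hchild, hchild ▸ hne, hchild ▸ hparent⟩
  · have hchild : edgeChild e = edgeSrc e.2 :=
      if_neg (Nat.lt_of_succ_le hnorm.le).le.not_gt
    exact Or.inr ⟨hchild, hchild ▸ hne, hchild ▸ hparent⟩

theorem edgeChild_ne_one (e : Σ s : S, EdgeSet F s) : (edgeChild e).1 ≠ 1 := by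
  rcases edgeChild_cases e with ⟨-, hne, -⟩ | ⟨-, hne, -⟩ <;> exact hne

theorem exists_edgeChild_eq_mk_mul (e : Σ s : S, EdgeSet F s) :
    ∃ b : Bool, (edgeChild e).1 = FreeGroup.mk [(e.1, b)] * wordParent (edgeChild e).1 ∧
      e.2.1 = if b then (edgeChild e).1 else wordParent (edgeChild e).1 := by
  rcases edgeChild_cases e with ⟨hchild, -, hparent⟩ | ⟨hchild, -, hparent⟩
  · refine ⟨true, ?_, congrArg Subtype.val hchild.symm⟩
    rw [hparent, hchild]
    exact (mul_inv_cancel_left (FreeGroup.of e.1) e.2.1).symm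
  · refine ⟨false, ?_, hparent.symm⟩
    rw [hparent, hchild]
    rfl

/- The first letter of the child is the label of the edge with its direction, so it recovers the
edge. -/
theorem edgeChild_injective : Function.Injective (edgeChild (F := F)) := by
  rintro ⟨s, x⟩ ⟨t, y⟩ hxy
  obtain ⟨b, hb, hx⟩ := exists_edgeChild_eq_mk_mul ⟨s, x⟩
  obtain ⟨c, hc, hy⟩ := exists_edgeChild_eq_mk_mul ⟨t, y⟩
  rw [← hxy] at hc hy
  obtain ⟨rfl, rfl⟩ : s = t ∧ b = c :=
    Prod.ext_iff.1 (mk_singleton_injective (mul_right_cancel (hb.symm.trans hc)))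
  exact congrArg (Sigma.mk s) (Subtype.ext (hx.trans hy.symm))

theorem SuffixClosed.exists_edgeChild_eq (hF : SuffixClosed F) {g : F} (hg : g.1 ≠ 1) :
    ∃ e : Σ s : S, EdgeSet F s, edgeChild e = g := by
  obtain ⟨⟨s, b⟩, hsb⟩ := exists_eq_mk_mul_wordParent hg
  have hparent := hF.wordParent_mem g.1 g.2 hg
  have hnorm := norm_wordParent_add_one hg
  cases b
  · have hsrc : (FreeGroup.of s)⁻¹ * wordParent g.1 = g := hsb.symm
    refine ⟨⟨s, wordParent g.1, mem_edgeSet.2 ⟨hparent, by rw [hsrc]; exact g.2⟩⟩, Subtype.ext ?_⟩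
    rw [edgeChild, if_neg]
    · exact hsrc
    · change ¬ ((FreeGroup.of s)⁻¹ * wordParent g.1).norm < (wordParent g.1).norm
      rw [hsrc]
      lia
  · have hsrc : (FreeGroup.of s)⁻¹ * g.1 = wordParent g.1 := inv_mul_eq_of_eq_mul hsb
    refine ⟨⟨s, g.1, mem_edgeSet.2 ⟨g.2, hsrc ▸ hparent⟩⟩, if_pos ?_⟩
    change ((FreeGroup.of s)⁻¹ * g.1).norm < g.1.norm
    rw [hsrc]
    lia

theorem notMem_edgeSet_or_of_forall_norm_le {g : FreeGroup S} (hg : ∀ h ∈ F, h.norm ≤ g.norm)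
    (s : S) : g ∉ EdgeSet F s ∨ FreeGroup.of s * g ∉ EdgeSet F s := by
  by_contra! hmem
  have wordParent_of_mem {h : FreeGroup S} (hh : h ∈ F)
      (hgh : (g ≠ 1 ∧ wordParent g = h) ∨ (h ≠ 1 ∧ wordParent h = g)) : wordParent g = h := by
    refine (hgh.resolve_right ?_).2
    rintro ⟨hne, hparent⟩
    have hnorm := norm_wordParent_add_one hne
    have := hg h hh
    rw [hparent] at hnorm
    lia
  have wordParent_eq_src := wordParent_of_mem (mem_edgeSet.1 hmem.1).2
    (wordParent_eq_inv_mul_or s g)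
  have wordParent_eq_tgt := wordParent_of_mem (mem_edgeSet.1 hmem.2).1
    ((by simpa using wordParent_eq_inv_mul_or s (FreeGroup.of s * g) :
      (FreeGroup.of s * g ≠ 1 ∧ wordParent (FreeGroup.of s * g) = g) ∨ _).symm)
  have letters_eq := mk_singleton_injective (a₁ := (s, false)) (a₂ := (s, true))
    (mul_right_cancel (wordParent_eq_src.symm.trans wordParent_eq_tgt))
  simp at letters_eq

end Edges

/-! ### Edges and defects -/

section Split

variable {α σ ι E : Type*} {κ : σ → Type*} [MeasurableSpace E]

theorem measurableSet_comp_sum_sigma [Countable σ] (e : α ⊕ (Σ s, κ s) ≃ ι) {B : Set (α → E)}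
    (hB : MeasurableSet B) {C : ∀ s, Set (κ s → E)} (hC : ∀ s, MeasurableSet (C s)) :
    MeasurableSet {Z : ι → E | (fun i => Z (e (Sum.inl i))) ∈ B ∧
      ∀ s, (fun j => Z (e (Sum.inr ⟨s, j⟩))) ∈ C s} := by
  have measurable_inl : Measurable fun (Z : ι → E) i => Z (e (Sum.inl i)) := by fun_prop
  have measurable_inr (s : σ) : Measurable fun (Z : ι → E) j => Z (e (Sum.inr ⟨s, j⟩)) := by
    fun_prop
  rw [Set.ofPred_and, Set.ofPred_forall]
  exact (measurable_inl hB).inter (MeasurableSet.iInter fun s => measurable_inr s (hC s))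

variable [Fintype α] [Fintype σ] [Fintype ι] [∀ s, Fintype (κ s)] (μ : Measure E) [SigmaFinite μ]

theorem measurePreserving_sum_sigma (e : α ⊕ (Σ s, κ s) ≃ ι) :
    MeasurePreserving
      (fun (z : (α → E) × (∀ s, κ s → E)) i => Sum.elim z.1 (fun p => z.2 p.1 p.2) (e.symm i))
      ((Measure.pi fun _ => μ).prod (Measure.pi fun s => Measure.pi fun _ : κ s => μ))
      (Measure.pi fun _ : ι => μ) := by
  have measurable_elim : Measurable fun (z : (α → E) × (∀ s, κ s → E)) i =>
      Sum.elim z.1 (fun p => z.2 p.1 p.2) (e.symm i) := by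
    refine measurable_pi_iff.2 fun i => ?_
    rcases e.symm i with a | ⟨s, j⟩
    · simp only [Sum.elim_inl]
      fun_prop
    · simp only [Sum.elim_inr]
      fun_prop
  refine ⟨measurable_elim, (Measure.pi_eq fun A hA => ?_).symm⟩
  have preimage_pi : (fun (z : (α → E) × (∀ s, κ s → E)) i =>
        Sum.elim z.1 (fun p => z.2 p.1 p.2) (e.symm i)) ⁻¹' Set.univ.pi A
      = (Set.univ.pi fun a => A (e (Sum.inl a))) ×ˢ
        (Set.univ.pi fun s => Set.univ.pi fun j => A (e (Sum.inr ⟨s, j⟩))) := by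
    ext z
    simp [← e.forall_congr_right, Sum.forall, Sigma.forall]
  rw [Measure.map_apply measurable_elim (MeasurableSet.univ_pi hA), preimage_pi,
    Measure.prod_prod, ← Equiv.prod_comp e, Fintype.prod_sum_type, Fintype.prod_sigma]
  simp only [Measure.pi_pi]

theorem pi_comp_sum_sigma (e : α ⊕ (Σ s, κ s) ≃ ι) {B : Set (α → E)} (hB : MeasurableSet B)
    {C : ∀ s, Set (κ s → E)} (hC : ∀ s, MeasurableSet (C s)) :
    Measure.pi (fun _ : ι => μ) {Z | (fun i => Z (e (Sum.inl i))) ∈ B ∧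
        ∀ s, (fun j => Z (e (Sum.inr ⟨s, j⟩))) ∈ C s}
      = Measure.pi (fun _ => μ) B * ∏ s, Measure.pi (fun _ : κ s => μ) (C s) := by
  rw [← (measurePreserving_sum_sigma μ e).measure_preimage
    (measurableSet_comp_sum_sigma e hB hC).nullMeasurableSet, ← Measure.pi_pi, ← Measure.prod_prod]
  congr 1
  ext z
  simp

end Split

section Tree

variable {S : Type*} [DecidableEq S] {F : Finset (FreeGroup S)} {k n : ℕ}

/-- The positions of the component at the identity in a tuple or block matrix over `F`. -/
def rootIdx (hF : SuffixClosed F) (i : Fin k) : F × Fin k := (⟨1, hF.one_mem⟩, i)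

/-- The positions of the ends of the edges with label `s` in a tuple or block matrix over `F`. -/
def tgtIdx (s : S) (p : EdgeSet F s × Fin k) : F × Fin k := (edgeTgt p.1, p.2)

/-- The positions of the beginnings of the edges with label `s` in a tuple or block matrix
over `F`. -/
def srcIdx (s : S) (p : EdgeSet F s × Fin k) : F × Fin k := (edgeSrc p.1, p.2)

/-- The root and the edges of a suffix closed set enumerate it, an edge standing for its child. -/
noncomputable def edgeEquiv (hF : SuffixClosed F) (k : ℕ) :
    Fin k ⊕ (Σ s : S, EdgeSet F s × Fin k) ≃ F × Fin k :=
  Equiv.ofBijective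
    (Sum.elim (rootIdx hF) fun p => (edgeChild ⟨p.1, p.2.1⟩, p.2.2)) <| by
    constructor
    · rintro (i | ⟨s, x, i⟩) (j | ⟨t, y, j⟩) hij
      · simpa [rootIdx] using hij
      · exact absurd (congrArg (fun q : F × Fin k => q.1.1) hij).symm (edgeChild_ne_one _)
      · exact absurd (congrArg (fun q : F × Fin k => q.1.1) hij) (edgeChild_ne_one _)
      · obtain ⟨child_eq, rfl : i = j⟩ := Prod.ext_iff.1 hij
        cases edgeChild_injective child_eq
        rfl
    · rintro ⟨g, i⟩
      by_cases hg : g.1 = 1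
      · exact ⟨Sum.inl i, by simp [rootIdx, ← hg]⟩
      · obtain ⟨⟨s, x⟩, hx⟩ := hF.exists_edgeChild_eq hg
        exact ⟨Sum.inr ⟨s, x, i⟩, by simp [hx]⟩

/-- The defects `W x - U s (W (s⁻¹x))` of a tuple along the edges with label `s`. They vanish if
`W` is the orbit of its component at the root under the representation that maps `s` to `U s`. -/
noncomputable def edgeDiff (U : S → unitaryGroup (Fin n) ℂ) (W : F × Fin k → Cn n) (s : S) :
    EdgeSet F s × Fin k → Cn n :=
  fun p => W (tgtIdx s p) - unitaryIsometry n (U s) (W (srcIdx s p))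

/-- The operator that transports each vector of a tuple from the parent to the child, so that
`W - treeShift hF U W` lists the component of `W` at the root and, up to isometries, the defects
of `W` along the edges. It is only real linear because the volume on tuples is a real Haar
measure. -/
noncomputable def treeShift (hF : SuffixClosed F) (U : S → unitaryGroup (Fin n) ℂ) :
    Module.End ℝ (F × Fin k → Cn n) where
  toFun W p := if hp : p.1.1 = 1 then 0 else
    unitaryIsometry n (FreeGroup.lift U (p.1.1 * (wordParent p.1.1)⁻¹))
      (W (⟨wordParent p.1.1, hF.wordParent_mem _ p.1.2 hp⟩, p.2))
  map_add' W W' := by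
    funext p
    by_cases hp : p.1.1 = 1 <;> simp [hp]
  map_smul' c W := by
    funext p
    by_cases hp : p.1.1 = 1
    · simp [hp]
    · simp only [hp, dite_false, Pi.smul_apply, RingHom.id_apply]
      rw [← Complex.coe_smul, map_smul, Complex.coe_smul]

theorem treeShift_apply_root (hF : SuffixClosed F) (U : S → unitaryGroup (Fin n) ℂ)
    (W : F × Fin k → Cn n) {p : F × Fin k} (hp : p.1.1 = 1) : treeShift hF U W p = 0 :=
  dif_pos hp

theorem treeShift_apply_of_ne_one (hF : SuffixClosed F) (U : S → unitaryGroup (Fin n) ℂ)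
    (W : F × Fin k → Cn n) {p : F × Fin k} (hp : p.1.1 ≠ 1) :
    treeShift hF U W p = unitaryIsometry n (FreeGroup.lift U (p.1.1 * (wordParent p.1.1)⁻¹))
      (W (⟨wordParent p.1.1, hF.wordParent_mem _ p.1.2 hp⟩, p.2)) :=
  dif_neg hp

theorem treeShift_pow_apply_of_norm_lt (hF : SuffixClosed F) (U : S → unitaryGroup (Fin n) ℂ)
    (W : F × Fin k → Cn n) {m : ℕ} {p : F × Fin k} (hp : p.1.1.norm < m) :
    (treeShift hF U ^ m) W p = 0 := by
  induction m generalizing p with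
  | zero => exact absurd hp (Nat.not_lt_zero _)
  | succ m ih =>
    rw [pow_succ', Module.End.mul_apply]
    by_cases hp1 : p.1.1 = 1
    · exact treeShift_apply_root hF U _ hp1
    · have hnorm := norm_wordParent_add_one hp1
      rw [treeShift_apply_of_ne_one hF U _ hp1, ih (by dsimp only; lia), map_zero]

theorem isNilpotent_treeShift (hF : SuffixClosed F) (U : S → unitaryGroup (Fin n) ℂ) :
    IsNilpotent (treeShift (k := k) hF U) :=
  ⟨F.sup FreeGroup.norm + 1, LinearMap.ext fun W => funext fun p =>
    treeShift_pow_apply_of_norm_lt hF U W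
      (Nat.lt_succ_of_le (Finset.le_sup (f := FreeGroup.norm) p.1.2))⟩

theorem det_one_sub_of_isNilpotent {K M : Type*} [Field K] [AddCommGroup M] [Module K M]
    [Module.Finite K M] {f : Module.End K M} (hf : IsNilpotent f) :
    LinearMap.det (1 - f) = 1 := by
  have eval_charpoly_one := LinearMap.eval_charpoly f 1
  rw [IsNilpotent.charpoly_eq_X_pow_finrank hf] at eval_charpoly_one
  simpa using eval_charpoly_one.symm

theorem measurePreserving_sub_treeShift (hF : SuffixClosed F)
    (U : S → unitaryGroup (Fin n) ℂ) :
    MeasurePreserving (fun W => W - treeShift hF U W) (tupleVolume (F × Fin k) n)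
      (tupleVolume (F × Fin k) n) := by
  have hdet := det_one_sub_of_isNilpotent (isNilpotent_treeShift (k := k) hF U)
  refine ⟨(LinearMap.continuous_of_finiteDimensional (1 - treeShift (k := k) hF U)).measurable,
    (Measure.map_linearMap_addHaar_eq_smul_addHaar (tupleVolume (F × Fin k) n)
      (f := 1 - treeShift hF U) (hdet ▸ one_ne_zero)).trans ?_⟩
  simp [hdet]

/-- The isometry that takes the defect of a tuple at the child of an edge to the defect along the
edge: `1` if the edge points away from the identity, and `-U s` otherwise. -/
noncomputable def edgeIsometry (U : S → unitaryGroup (Fin n) ℂ) (s : S) (x : EdgeSet F s) :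
    Cn n ≃ₗᵢ[ℂ] Cn n :=
  if edgeChild ⟨s, x⟩ = edgeTgt x then LinearIsometryEquiv.refl ℂ _
  else (unitaryIsometry n (U s)).trans (LinearIsometryEquiv.neg ℂ)

theorem edgeIsometry_sub_treeShift (hF : SuffixClosed F) (U : S → unitaryGroup (Fin n) ℂ)
    (W : F × Fin k → Cn n) (s : S) (p : EdgeSet F s × Fin k) :
    edgeIsometry U s p.1 ((W - treeShift hF U W) (edgeEquiv hF k (Sum.inr ⟨s, p⟩)))
      = edgeDiff U W s p := by
  obtain ⟨x, i⟩ := p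
  have edgeEquiv_eq : edgeEquiv hF k (Sum.inr ⟨s, (x, i)⟩) = (edgeChild ⟨s, x⟩, i) := rfl
  have hne := edgeChild_ne_one ⟨s, x⟩
  have treeShift_eq {y : F} (hy : wordParent (edgeChild ⟨s, x⟩).1 = y) :
      treeShift hF U W (edgeChild ⟨s, x⟩, i)
        = unitaryIsometry n (FreeGroup.lift U ((edgeChild ⟨s, x⟩).1 * y.1⁻¹)) (W (y, i)) := by
    rw [treeShift_apply_of_ne_one hF U W hne]
    simp only [hy]
  rw [edgeEquiv_eq, Pi.sub_apply]
  rcases edgeChild_cases ⟨s, x⟩ with ⟨hchild, -, hparent⟩ | ⟨hchild, hne', hparent⟩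
  · have quotient_eq : (edgeTgt x).1 * (edgeSrc x).1⁻¹ = FreeGroup.of s := by
      simp [edgeTgt, edgeSrc]
    rw [treeShift_eq hparent, edgeIsometry, if_pos hchild, hchild, quotient_eq,
      FreeGroup.lift_apply_of]
    rfl
  · have child_ne_tgt : edgeChild ⟨s, x⟩ ≠ edgeTgt x := by
      intro heq
      have hnorm := norm_wordParent_add_one hne'
      rw [hparent, heq] at hnorm
      lia
    have quotient_eq : (edgeSrc x).1 * (edgeTgt x).1⁻¹ = (FreeGroup.of s)⁻¹ := by
      simp [edgeTgt, edgeSrc]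
    rw [treeShift_eq hparent, edgeIsometry, if_neg child_ne_tgt, hchild, quotient_eq, map_inv,
      FreeGroup.lift_apply_of, map_inv, LinearIsometryEquiv.trans_apply, map_sub,
      LinearIsometryEquiv.inv_def, LinearIsometryEquiv.apply_symm_apply]
    simp [edgeDiff, tgtIdx, srcIdx]

theorem tupleVolume_edgeDiff [Fintype S] (hF : SuffixClosed F) (U : S → unitaryGroup (Fin n) ℂ)
    {B : Set (Fin k → Cn n)} (hB : MeasurableSet B)
    {C : ∀ s : S, Set (EdgeSet F s × Fin k → Cn n)} (hC : ∀ s, MeasurableSet (C s)) :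
    tupleVolume (F × Fin k) n
        {W | W ∘ rootIdx hF ∈ B ∧ ∀ s, edgeDiff U W s ∈ C s}
      = tupleVolume (Fin k) n B * ∏ s, tupleVolume (EdgeSet F s × Fin k) n (C s) := by
  have isometry_preserving (s : S) : MeasurePreserving
      (fun (Z : EdgeSet F s × Fin k → Cn n) p => edgeIsometry U s p.1 (Z p))
      (tupleVolume (EdgeSet F s × Fin k) n) (tupleVolume (EdgeSet F s × Fin k) n) :=
    measurePreserving_pi (fun _ => unitBallVolume n) (fun _ => unitBallVolume n)
      fun p : EdgeSet F s × Fin k => measurePreserving_unitBallVolume (edgeIsometry U s p.1)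
  have measurableSet_preimage (s : S) := (isometry_preserving s).measurable (hC s)
  rw [← Finset.prod_congr rfl fun s _ =>
    (isometry_preserving s).measure_preimage (hC s).nullMeasurableSet]
  refine Eq.trans ?_ (pi_comp_sum_sigma (unitBallVolume n) (edgeEquiv hF k) hB
    measurableSet_preimage)
  refine Eq.trans ?_ ((measurePreserving_sub_treeShift hF U).measure_preimage
    (measurableSet_comp_sum_sigma (edgeEquiv hF k) hB measurableSet_preimage).nullMeasurableSet)
  congr 1
  ext W
  refine and_congr ?_ (forall_congr' fun s => ?_)
  · have root_eq : (fun i => (W - treeShift hF U W) (edgeEquiv hF k (Sum.inl i)))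
        = W ∘ rootIdx hF := by
      funext i
      rw [Pi.sub_apply, treeShift_apply_root hF U W rfl, sub_zero]
      rfl
    rw [root_eq]
  · rw [← funext (edgeIsometry_sub_treeShift hF U W s)]
    rfl

end Tree

section GramPerturbation

variable {ι : Type*} [Fintype ι] {E : Type*} [NormedAddCommGroup E] [InnerProductSpace ℂ E]

theorem norm_gram_sub_gram_le (W W' : ι → E) (i j : ι) :
    ‖gram ℂ W i j - gram ℂ W' i j‖ ≤ (‖W‖ + ‖W'‖) * dist W W' := by
  have hdist (l : ι) : ‖W l - W' l‖ ≤ dist W W' := dist_eq_norm W W' ▸ norm_le_pi_norm (W - W') l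
  have expand : gram ℂ W i j - gram ℂ W' i j
      = inner ℂ (W i) (W j - W' j) + inner ℂ (W i - W' i) (W' j) := by
    simp only [gram_apply, inner_sub_left, inner_sub_right]
    ring
  calc ‖gram ℂ W i j - gram ℂ W' i j‖
      ≤ ‖W i‖ * ‖W j - W' j‖ + ‖W i - W' i‖ * ‖W' j‖ :=
        expand ▸ norm_add_le_of_le (norm_inner_le_norm _ _) (norm_inner_le_norm _ _)
    _ ≤ ‖W‖ * dist W W' + dist W W' * ‖W'‖ := by
      gcongr
      exacts [norm_le_pi_norm W i, hdist j, hdist i, norm_le_pi_norm W' j]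
    _ = (‖W‖ + ‖W'‖) * dist W W' := by ring

theorem gram_mem_entryBall_gram {W W' : ι → E} {τ : ℝ} (h : (‖W‖ + ‖W'‖) * dist W W' < τ) :
    gram ℂ W ∈ entryBall (gram ℂ W') τ :=
  fun i j => (norm_gram_sub_gram_le W W' i j).trans_lt h

end GramPerturbation

section Orbit

variable {S : Type*} {F : Finset (FreeGroup S)} {k n : ℕ}

/-- The translates `π(g) V` of the tuple `V`, for `g ∈ F`, under the representation `π` of the free
group that maps `s` to `U s`. -/
noncomputable def orbitTuple (F : Finset (FreeGroup S)) (U : S → unitaryGroup (Fin n) ℂ)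
    (V : Fin k → Cn n) : F × Fin k → Cn n :=
  fun p => unitaryIsometry n (FreeGroup.lift U p.1.1) (V p.2)

theorem continuous_lift (g : FreeGroup S) :
    Continuous fun U : S → unitaryGroup (Fin n) ℂ => FreeGroup.lift U g := by
  induction g using FreeGroup.induction_on with
  | C1 => simpa using continuous_const
  | of s => simpa using continuous_apply s
  | inv_of s _ =>
    simp only [map_inv, FreeGroup.lift_apply_of]
    exact (continuous_apply s).inv
  | mul g h hg hh =>
    simp only [map_mul]
    exact hg.mul hh

theorem continuous_orbitTuple : Continuous fun p : (Fin k → Cn n) × (S → unitaryGroup (Fin n) ℂ) =>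
    orbitTuple F p.2 p.1 :=
  continuous_pi fun q => continuous_unitaryIsometry_apply
    ((continuous_lift q.1.1).comp continuous_snd) ((continuous_apply q.2).comp continuous_fst)

theorem isOpen_setOf_gram_orbitTuple_mem (V : Fin k → Cn n)
    {G : Set (Matrix (F × Fin k) (F × Fin k) ℂ)} (hG : IsOpen G) :
    IsOpen {U : S → unitaryGroup (Fin n) ℂ | gram ℂ (orbitTuple F U V) ∈ G} :=
  hG.preimage (continuous_gram.comp (continuous_orbitTuple.comp (Continuous.prodMk_right V)))

theorem norm_orbitTuple_le (U : S → unitaryGroup (Fin n) ℂ) (V : Fin k → Cn n) :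
    ‖orbitTuple F U V‖ ≤ ‖V‖ :=
  (pi_norm_le_iff_of_nonneg (norm_nonneg V)).2 fun p =>
    (LinearIsometryEquiv.norm_map _ _).trans_le (norm_le_pi_norm V p.2)

theorem dist_orbitTuple_le (U : S → unitaryGroup (Fin n) ℂ) (V V' : Fin k → Cn n) :
    dist (orbitTuple F U V) (orbitTuple F U V') ≤ dist V V' :=
  (dist_pi_le_iff dist_nonneg).2 fun p =>
    (LinearIsometryEquiv.dist_map _ _ _).trans_le (dist_le_pi_dist V V' p.2)

theorem lift_conj {G : Type*} [Group G] (x : G) (U : S → G) (g : FreeGroup S) :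
    FreeGroup.lift (fun s => x * U s * x⁻¹) g = x * FreeGroup.lift U g * x⁻¹ := by
  have comp_lift : (MulAut.conj x).toMonoidHom.comp (FreeGroup.lift U)
      = FreeGroup.lift (fun s => x * U s * x⁻¹) := by
    ext s
    simp
  rw [← comp_lift]
  simp

theorem orbitTuple_conj (G : unitaryGroup (Fin n) ℂ) (U : S → unitaryGroup (Fin n) ℂ)
    (V : Fin k → Cn n) :
    orbitTuple F (fun s => G * U s * G⁻¹) (unitaryIsometry n G ∘ V)
      = unitaryIsometry n G ∘ orbitTuple F U V := by
  funext p
  simp [orbitTuple, lift_conj]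

theorem measurePreserving_conj (ν : Measure (unitaryGroup (Fin n) ℂ)) [ν.IsHaarMeasure]
    [IsProbabilityMeasure ν] (G : unitaryGroup (Fin n) ℂ) :
    MeasurePreserving (fun U => G * U * G⁻¹) ν ν := by
  have hcont : Continuous fun U : unitaryGroup (Fin n) ℂ => G * U * G⁻¹ := by fun_prop
  have hcont_symm : Continuous (MulAut.conj G).symm := by
    change Continuous fun U : unitaryGroup (Fin n) ℂ => G⁻¹ * U * G
    fun_prop
  have : (ν.map (MulAut.conj G)).IsHaarMeasure :=
    MulEquiv.isHaarMeasure_map ν (MulAut.conj G) hcont hcont_symm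
  have : IsProbabilityMeasure (ν.map (MulAut.conj G)) :=
    Measure.isProbabilityMeasure_map hcont.measurable.aemeasurable
  exact ⟨hcont.measurable,
    Measure.isHaarMeasure_eq_of_isProbabilityMeasure (ν.map (MulAut.conj G)) ν⟩

variable [Fintype S]

theorem measure_gram_orbitTuple_linearIsometryEquiv (ν : S → Measure (unitaryGroup (Fin n) ℂ))
    [∀ s, (ν s).IsHaarMeasure] [∀ s, IsProbabilityMeasure (ν s)] (H : Cn n ≃ₗᵢ[ℂ] Cn n)
    (V : Fin k → Cn n) {G : Set (Matrix (F × Fin k) (F × Fin k) ℂ)} (hG : IsOpen G) :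
    Measure.pi ν {U | gram ℂ (orbitTuple F U (H ∘ V)) ∈ G}
      = Measure.pi ν {U | gram ℂ (orbitTuple F U V) ∈ G} := by
  obtain ⟨x, rfl⟩ := (unitaryIsometry n).surjective H
  rw [← (measurePreserving_pi ν ν fun s => measurePreserving_conj (ν s) x).measure_preimage
    (isOpen_setOf_gram_orbitTuple_mem _ hG).measurableSet.nullMeasurableSet]
  simp only [Set.preimage, Set.mem_ofPred_eq, orbitTuple_conj, gram_linearIsometryEquiv]

theorem norm_le_two_of_gram_mem_entryBall {V : Fin k → Cn n} {δ : ℝ} (hδ : δ ≤ 3)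
    (hV : gram ℂ V ∈ entryBall 1 δ) : ‖V‖ ≤ 2 :=
  (pi_norm_le_iff_of_nonneg two_pos.le).2 fun j => by
    nlinarith [norm_sq_lt_of_gram_mem_entryBall hV j, norm_nonneg (V j)]

theorem exists_measure_gram_orbitTuple_le (q : Matrix (F × Fin k) (F × Fin k) ℂ) {ε ε' : ℝ}
    (hεε' : ε < ε') :
    ∃ δ > 0, δ ≤ 3 ∧ ∀ (n : ℕ) (ν : S → Measure (unitaryGroup (Fin n) ℂ))
      [∀ s, (ν s).IsHaarMeasure] [∀ s, IsProbabilityMeasure (ν s)] (V V' : Fin k → Cn n),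
      gram ℂ V ∈ entryBall 1 δ → gram ℂ V' ∈ entryBall 1 δ →
      Measure.pi ν {U | gram ℂ (orbitTuple F U V) ∈ entryBall q ε}
        ≤ Measure.pi ν {U | gram ℂ (orbitTuple F U V') ∈ entryBall q ε'} := by
  obtain ⟨δ, hδ, hδH⟩ := exists_entryBall_one_linearIsometryEquiv (Fin k)
    (show 0 < (ε' - ε) / 4 by linarith)
  refine ⟨min δ 3, by positivity, min_le_right _ _, fun n ν _ _ V V' hV hV' => ?_⟩
  obtain ⟨H, hH⟩ := hδH (Cn n) V V' (entryBall_mono _ (min_le_left _ _) hV)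
    (entryBall_mono _ (min_le_left _ _) hV')
  rw [← measure_gram_orbitTuple_linearIsometryEquiv ν H V (isOpen_entryBall q ε)]
  refine measure_mono fun U hU => entryBall_subset_entryBall (τ := ε) hU (sub_add_cancel _ _).le
    (gram_mem_entryBall_gram ?_)
  have hHV : ‖orbitTuple F U (H ∘ V)‖ ≤ 2 := (norm_orbitTuple_le U _).trans
    (norm_le_two_of_gram_mem_entryBall (min_le_right δ 3) (by rwa [gram_linearIsometryEquiv]))
  have hV'_norm : ‖orbitTuple F U V'‖ ≤ 2 := (norm_orbitTuple_le U _).trans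
    (norm_le_two_of_gram_mem_entryBall (min_le_right δ 3) hV')
  have hdist : dist (orbitTuple F U V') (orbitTuple F U (H ∘ V)) < (ε' - ε) / 4 :=
    (dist_orbitTuple_le U _ _).trans_lt (dist_comm _ V' ▸ hH)
  calc (‖orbitTuple F U V'‖ + ‖orbitTuple F U (H ∘ V)‖) *
        dist (orbitTuple F U V') (orbitTuple F U (H ∘ V))
      ≤ (2 + 2) * dist (orbitTuple F U V') (orbitTuple F U (H ∘ V)) := by gcongr
    _ < ε' - ε := by linarith

end Orbit

section EdgeNear

variable {S : Type*} [DecidableEq S] {F : Finset (FreeGroup S)} {k n : ℕ}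

/-- The defects of the tuple `W` along the edges lie in the ellipsoids that are the images under
`D s` of the polyballs of radius `ρ`. -/
def EdgeNear (D : ∀ s : S, Matrix (EdgeSet F s × Fin k) (EdgeSet F s × Fin k) ℂ) (ρ : ℝ)
    (U : S → unitaryGroup (Fin n) ℂ) (W : F × Fin k → Cn n) : Prop :=
  ∀ s, linComb (D s)⁻¹ (edgeDiff U W s) ∈ Metric.ball 0 ρ

theorem edgeDiff_sub (U : S → unitaryGroup (Fin n) ℂ) (W W' : F × Fin k → Cn n) (s : S) :
    edgeDiff U (W - W') s = edgeDiff U W s - edgeDiff U W' s := by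
  funext p
  simp only [edgeDiff, Pi.sub_apply, map_sub]
  abel

theorem edgeDiff_orbitTuple (U : S → unitaryGroup (Fin n) ℂ) (V : Fin k → Cn n) (s : S) :
    edgeDiff U (orbitTuple F U V) s = 0 := by
  funext p
  simp [edgeDiff, orbitTuple, tgtIdx, srcIdx, edgeTgt, edgeSrc]

theorem orbitTuple_comp_rootIdx (hF : SuffixClosed F) (U : S → unitaryGroup (Fin n) ℂ)
    (V : Fin k → Cn n) : orbitTuple F U V ∘ rootIdx hF = V := by
  funext i
  simp [orbitTuple, rootIdx]

variable (D : ∀ s : S, Matrix (EdgeSet F s × Fin k) (EdgeSet F s × Fin k) ℂ) {ρ : ℝ}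

theorem continuous_edgeDiff (s : S) :
    Continuous fun p : (F × Fin k → Cn n) × (S → unitaryGroup (Fin n) ℂ) => edgeDiff p.2 p.1 s :=
  continuous_pi fun p => ((continuous_apply (tgtIdx s p)).comp continuous_fst).sub
    (continuous_unitaryIsometry_apply ((continuous_apply s).comp continuous_snd)
      ((continuous_apply (srcIdx s p)).comp continuous_fst))

theorem isOpen_linComb_preimage_ball {ι : Type*} [Fintype ι] (A : Matrix ι ι ℂ) :
    IsOpen (linComb A ⁻¹' Metric.ball (0 : ι → Cn n) ρ) :=
  Metric.isOpen_ball.preimage (LinearMap.continuous_of_finiteDimensional _)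

theorem isOpen_setOf_edgeNear [Finite S] :
    IsOpen {p : (F × Fin k → Cn n) × (S → unitaryGroup (Fin n) ℂ) | EdgeNear D ρ p.2 p.1} := by
  have near_eq : {p : (F × Fin k → Cn n) × (S → unitaryGroup (Fin n) ℂ) | EdgeNear D ρ p.2 p.1}
      = ⋂ s, (fun p => edgeDiff p.2 p.1 s) ⁻¹' (linComb (D s)⁻¹ ⁻¹' Metric.ball 0 ρ) := by
    ext
    simp [EdgeNear]
  rw [near_eq]
  exact isOpen_iInter_of_finite fun s =>
    (isOpen_linComb_preimage_ball (D s)⁻¹).preimage (continuous_edgeDiff s)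

theorem pi_edgeNear [Fintype S] (ν : S → Measure (unitaryGroup (Fin n) ℂ))
    [∀ s, SigmaFinite (ν s)] (W : F × Fin k → Cn n) :
    Measure.pi ν {U | EdgeNear D ρ U W} = ∏ s, hitProb (ν s)
      (linComb (D s)⁻¹ (W ∘ srcIdx s)) (linComb (D s)⁻¹ (W ∘ tgtIdx s)) ρ := by
  simp only [hitProb]
  rw [← Measure.pi_pi]
  congr 1
  ext U
  simp only [Set.mem_univ_pi, Set.mem_ofPred_eq, EdgeNear]
  refine forall_congr' fun s => ?_
  have edgeDiff_eq : edgeDiff U W s = W ∘ tgtIdx s - unitaryIsometry n (U s) ∘ (W ∘ srcIdx s) := rfl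
  rw [edgeDiff_eq, map_sub, linComb_map, mem_ball_zero_iff, ← dist_eq_norm, Metric.mem_ball]

theorem tupleVolume_linComb_preimage_ball {ι : Type*} [Fintype ι] [DecidableEq ι]
    {A : Matrix ι ι ℂ} (hA : IsUnit A.det) (hρ : 0 < ρ) :
    tupleVolume ι n (linComb A⁻¹ ⁻¹' Metric.ball 0 ρ)
      = ENNReal.ofReal (‖A.det‖ ^ 2 * ρ ^ (2 * Fintype.card ι)) ^ n := by
  rw [← image_linComb_eq_preimage hA, tupleVolume_image_linComb, tupleVolume_ball _ hρ, ← mul_pow,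
    ENNReal.ofReal_mul (by positivity)]

/-- The number of real coordinates, per dimension of `ℂⁿ`, of the defects along the edges: the
exponent of the radius in the volume of a product of polyballs. -/
def edgeDim [Fintype S] (F : Finset (FreeGroup S)) (k : ℕ) : ℕ :=
  ∑ s : S, 2 * Fintype.card (EdgeSet F s × Fin k)

theorem prod_ofReal_mul_pow_edgeDim [Fintype S] {a : S → ℝ} (ha : ∀ s, 0 ≤ a s) (hρ : 0 ≤ ρ) :
    ∏ s, ENNReal.ofReal (a s * ρ ^ (2 * Fintype.card (EdgeSet F s × Fin k))) ^ n
      = ENNReal.ofReal ((∏ s, a s) * ρ ^ edgeDim F k) ^ n := by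
  rw [Finset.prod_pow, ← ENNReal.ofReal_prod_of_nonneg fun s _ =>
    mul_nonneg (ha s) (pow_nonneg hρ _), Finset.prod_mul_distrib, Finset.prod_pow_eq_pow_sum,
    edgeDim]

variable {D}

-- Integrate the defects first: for fixed `U` their law does not depend on `U`.
theorem lintegral_edgeNear [Fintype S] (hF : SuffixClosed F)
    (ν : S → Measure (unitaryGroup (Fin n) ℂ)) [∀ s, IsProbabilityMeasure (ν s)]
    (hD : ∀ s, IsUnit (D s).det) (hρ : 0 < ρ)
    {B : Set ((Fin k → Cn n) × (S → unitaryGroup (Fin n) ℂ))} (hB : IsOpen B) :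
    ∫⁻ W, Measure.pi ν {U | (W ∘ rootIdx hF, U) ∈ B ∧ EdgeNear D ρ U W} ∂tupleVolume (F × Fin k) n
      = (∫⁻ V, Measure.pi ν {U | (V, U) ∈ B} ∂tupleVolume (Fin k) n) *
        ENNReal.ofReal ((∏ s, ‖(D s).det‖ ^ 2) * ρ ^ edgeDim F k) ^ n := by
  have measurableSet_near : MeasurableSet {p : (F × Fin k → Cn n) × (S → unitaryGroup (Fin n) ℂ) |
      (p.1 ∘ rootIdx hF, p.2) ∈ B ∧ EdgeNear D ρ p.2 p.1} :=
    ((hB.preimage (by fun_prop)).inter (isOpen_setOf_edgeNear D)).measurableSet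
  have measurableSet_section (U : S → unitaryGroup (Fin n) ℂ) : MeasurableSet {V | (V, U) ∈ B} :=
    (hB.preimage (Continuous.prodMk_left U)).measurableSet
  calc ∫⁻ W, Measure.pi ν {U | (W ∘ rootIdx hF, U) ∈ B ∧ EdgeNear D ρ U W}
        ∂tupleVolume (F × Fin k) n
      = ∫⁻ U, tupleVolume (F × Fin k) n {W | W ∘ rootIdx hF ∈ {V | (V, U) ∈ B} ∧
          ∀ s, edgeDiff U W s ∈ linComb (D s)⁻¹ ⁻¹' Metric.ball 0 ρ} ∂Measure.pi ν :=
        (Measure.prod_apply measurableSet_near).symm.trans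
          (Measure.prod_apply_symm measurableSet_near)
    _ = ∫⁻ U, tupleVolume (Fin k) n {V | (V, U) ∈ B} *
          ENNReal.ofReal ((∏ s, ‖(D s).det‖ ^ 2) * ρ ^ edgeDim F k) ^ n ∂Measure.pi ν := by
        refine lintegral_congr fun U => ?_
        rw [tupleVolume_edgeDiff hF U (measurableSet_section U) fun s =>
          (isOpen_linComb_preimage_ball (D s)⁻¹).measurableSet]
        simp only [tupleVolume_linComb_preimage_ball (hD _) hρ]
        rw [prod_ofReal_mul_pow_edgeDim (fun s => sq_nonneg _) hρ.le]
    _ = (∫⁻ V, Measure.pi ν {U | (V, U) ∈ B} ∂tupleVolume (Fin k) n) *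
          ENNReal.ofReal ((∏ s, ‖(D s).det‖ ^ 2) * ρ ^ edgeDim F k) ^ n := by
        rw [lintegral_mul_const' _ _ (by finiteness)]
        congr 1
        exact (Measure.prod_apply_symm hB.measurableSet).symm.trans
          (Measure.prod_apply hB.measurableSet)

theorem norm_apply_le_of_norm_edgeDiff_le (hF : SuffixClosed F) (U : S → unitaryGroup (Fin n) ℂ)
    {Δ : F × Fin k → Cn n} {r : ℝ} (hroot : Δ ∘ rootIdx hF = 0) (hr : ∀ s, ‖edgeDiff U Δ s‖ ≤ r)
    (g : F) (i : Fin k) : ‖Δ (g, i)‖ ≤ g.1.norm * r := by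
  have hedge (s : S) (x : EdgeSet F s) :
      |‖Δ (edgeTgt x, i)‖ - ‖Δ (edgeSrc x, i)‖| ≤ r := by
    rw [← LinearIsometryEquiv.norm_map (unitaryIsometry n (U s)) (Δ (edgeSrc x, i))]
    exact (abs_norm_sub_norm_le _ _).trans
      ((norm_le_pi_norm (edgeDiff U Δ s) (x, i)).trans (hr s))
  have hstep (g : F) (hg : g.1 ≠ 1) :
      ‖Δ (g, i)‖ ≤ ‖Δ (⟨wordParent g.1, hF.wordParent_mem g.1 g.2 hg⟩, i)‖ + r := by
    obtain ⟨⟨s, x⟩, rfl⟩ := hF.exists_edgeChild_eq hg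
    obtain ⟨hlower, hupper⟩ := abs_le.1 (hedge s x)
    rcases edgeChild_cases ⟨s, x⟩ with ⟨hchild, -, hparent⟩ | ⟨hchild, -, hparent⟩ <;>
      simp only [hparent, Subtype.coe_eta] <;> rw [hchild] <;> linarith
  obtain ⟨g, hg⟩ := g
  induction g using wordParent_induction with
  | one =>
    have hΔ : Δ (⟨1, hg⟩, i) = 0 := congrFun hroot i
    simp [hΔ]
  | of_wordParent g hg1 ih =>
    have hnorm : (g.norm : ℝ) = (wordParent g).norm + 1 :=
      mod_cast (norm_wordParent_add_one hg1).symm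
    rw [hnorm, add_one_mul]
    linarith [ih (hF.wordParent_mem g hg hg1), hstep ⟨g, hg⟩ hg1]

theorem exists_dist_orbitTuple_le [Finite S] (hF : SuffixClosed F) (hD : ∀ s, IsUnit (D s).det) :
    ∃ C > 0, ∀ (n : ℕ) (ρ : ℝ) (U : S → unitaryGroup (Fin n) ℂ) (W : F × Fin k → Cn n), 0 < ρ →
      EdgeNear D ρ U W → dist (orbitTuple F U (W ∘ rootIdx hF)) W ≤ C * ρ := by
  obtain ⟨M, hM⟩ := Finite.exists_le fun p : Σ s : S, EdgeSet F s × Fin k =>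
    (((D p.1)ᴴ * D p.1) p.2 p.2).re
  set b := max M 1
  have hMb : M ≤ b ^ 2 :=
    (le_max_left M 1).trans (le_self_pow₀ (le_max_right M 1) two_ne_zero)
  set C := b * Fintype.card (F × Fin k)
  refine ⟨F.sup FreeGroup.norm * C + 1, by positivity, fun n ρ U W hρ hUW => ?_⟩
  have hedge (s : S) : ‖edgeDiff U (W - orbitTuple F U (W ∘ rootIdx hF)) s‖ ≤ C * ρ := by
    have hcard : Fintype.card (EdgeSet F s × Fin k) ≤ Fintype.card (F × Fin k) :=
      Fintype.card_le_of_injective (tgtIdx s) (edgeTgt_injective.prodMap Function.injective_id)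
    rw [edgeDiff_sub, edgeDiff_orbitTuple, sub_zero, ← linComb_inv_linComb (hD s)
      (edgeDiff U W s)]
    refine (norm_linComb_le (by positivity) (fun j => (hM ⟨s, j⟩).trans hMb) _).trans ?_
    exact mul_le_mul (mul_le_mul_of_nonneg_left (mod_cast hcard) (by positivity))
      (mem_ball_zero_iff.1 (hUW s)).le (by positivity) (by positivity)
  rw [dist_comm, dist_eq_norm]
  refine (pi_norm_le_iff_of_nonneg (by positivity)).2 fun p => ?_
  have hroot : (W - orbitTuple F U (W ∘ rootIdx hF)) ∘ rootIdx hF = 0 := by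
    rw [← sub_self (W ∘ rootIdx hF)]
    exact congrArg (W ∘ rootIdx hF - ·) (orbitTuple_comp_rootIdx hF U _)
  have hnorm : (p.1.1.norm : ℝ) ≤ F.sup FreeGroup.norm :=
    mod_cast Finset.le_sup (f := FreeGroup.norm) p.1.2
  calc ‖(W - orbitTuple F U (W ∘ rootIdx hF)) p‖
      ≤ p.1.1.norm * (C * ρ) := norm_apply_le_of_norm_edgeDiff_le hF U hroot hedge p.1 p.2
    _ ≤ (F.sup FreeGroup.norm : ℕ) * (C * ρ) := by gcongr
    _ ≤ ((F.sup FreeGroup.norm : ℕ) * C + 1) * ρ := by linarith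

theorem exists_gram_orbitTuple_mem_entryBall [Finite S] (hF : SuffixClosed F)
    (hD : ∀ s, IsUnit (D s).det) {τ : ℝ} (hτ : 0 < τ) :
    ∃ ρ₀ > 0, ∀ (n : ℕ) (ρ : ℝ) (U : S → unitaryGroup (Fin n) ℂ) (W : F × Fin k → Cn n),
      0 < ρ → ρ ≤ ρ₀ → ‖W ∘ rootIdx hF‖ ≤ 2 → EdgeNear D ρ U W →
      gram ℂ (orbitTuple F U (W ∘ rootIdx hF)) ∈ entryBall (gram ℂ W) τ := by
  obtain ⟨C, hC, hdist⟩ := exists_dist_orbitTuple_le hF hD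
  refine ⟨min 1 (τ / 6) / C, by positivity, fun n ρ U W hρ hρρ₀ hroot hUW =>
    gram_mem_entryBall_gram ?_⟩
  set W' := orbitTuple F U (W ∘ rootIdx hF)
  have hdist' : dist W' W ≤ min 1 (τ / 6) := (hdist n ρ U W hρ hUW).trans <| by
    rwa [le_div_iff₀' hC] at hρρ₀
  have hW' : ‖W'‖ ≤ 2 := (norm_orbitTuple_le U _).trans hroot
  have hW : ‖W‖ ≤ 3 := by
    linarith [norm_le_norm_add_norm_sub' W W', dist_eq_norm' W' W, hdist'.trans (min_le_left _ _)]
  calc (‖W'‖ + ‖W‖) * dist W' W ≤ (2 + 3) * (τ / 6) := by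
        gcongr
        exact hdist'.trans (min_le_right _ _)
    _ < τ := by linarith

end EdgeNear

section SmallSets

variable {α : Type*} [MeasurableSpace α] {μ : Measure α} {f : α → ENNReal} {c : ENNReal}
  {A : Set α}

theorem mul_measure_le_lintegral (hA : MeasurableSet A) (hf : ∀ x ∈ A, c ≤ f x) :
    c * μ A ≤ ∫⁻ x, f x ∂μ :=
  (lintegral_indicator_const hA c).symm.trans_le (lintegral_mono (Set.indicator_le hf))

theorem lintegral_le_mul_measure (hf : ∀ x ∈ A, f x ≤ c) (hf0 : ∀ x ∉ A, f x = 0) :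
    ∫⁻ x, f x ∂μ ≤ c * μ A :=
  (lintegral_mono (Set.le_indicator hf fun x hx => (hf0 x hx).le)).trans
    (lintegral_indicator_const_le A c)

end SmallSets

theorem eventually_mul_ofReal_pow_le {K : ENNReal} (hK : K ≠ ⊤) {x y : ℝ} (hx : 0 ≤ x)
    (hxy : x < y) : ∀ᶠ n : ℕ in atTop, K * ENNReal.ofReal x ^ n ≤ ENNReal.ofReal y ^ n := by
  have hy : 0 < y := hx.trans_lt hxy
  have hlim : Tendsto (fun n : ℕ => K.toReal * (x / y) ^ n) atTop (𝓝 0) := by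
    simpa using (tendsto_pow_atTop_nhds_zero_of_lt_one (by positivity)
      ((div_lt_one hy).2 hxy)).const_mul K.toReal
  filter_upwards [hlim.eventually_le_const one_pos] with n hn
  rw [div_pow, mul_div_assoc', div_le_one (by positivity)] at hn
  rw [← ENNReal.ofReal_toReal hK, ← ENNReal.ofReal_pow hx, ← ENNReal.ofReal_pow hy.le,
    ← ENNReal.ofReal_mul ENNReal.toReal_nonneg]
  exact ENNReal.ofReal_le_ofReal hn

section DoubleCounting

variable {S : Type*} [DecidableEq S] [Fintype S] {F : Finset (FreeGroup S)} {k n : ℕ}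
  {D : ∀ s : S, Matrix (EdgeSet F s × Fin k) (EdgeSet F s × Fin k) ℂ} {ρ : ℝ}
  {A : Set (Fin k → Cn n)} {G N : Set (Matrix (F × Fin k) (F × Fin k) ℂ)} {p K : ENNReal}

theorem mul_tupleVolume_mul_le_mul_tupleVolume_gram (hF : SuffixClosed F)
    (ν : S → Measure (unitaryGroup (Fin n) ℂ)) [∀ s, IsProbabilityMeasure (ν s)]
    (hD : ∀ s, IsUnit (D s).det) (hρ : 0 < ρ) (hA : IsOpen A) (hG : IsOpen G)
    (hp : ∀ V ∈ A, p ≤ Measure.pi ν {U | gram ℂ (orbitTuple F U V) ∈ G})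
    (hK : ∀ W, gram ℂ W ∈ N → Measure.pi ν {U | EdgeNear D ρ U W} ≤ K)
    (hN : ∀ U W, W ∘ rootIdx hF ∈ A → gram ℂ (orbitTuple F U (W ∘ rootIdx hF)) ∈ G →
      EdgeNear D ρ U W → gram ℂ W ∈ N) :
    p * tupleVolume (Fin k) n A * ENNReal.ofReal ((∏ s, ‖(D s).det‖ ^ 2) * ρ ^ edgeDim F k) ^ n
      ≤ K * tupleVolume (F × Fin k) n {W | gram ℂ W ∈ N} := by
  set B : Set ((Fin k → Cn n) × (S → unitaryGroup (Fin n) ℂ)) :=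
    {x | x.1 ∈ A ∧ gram ℂ (orbitTuple F x.2 x.1) ∈ G}
  have hB : IsOpen B := (hA.preimage continuous_fst).inter
    (hG.preimage (continuous_gram.comp continuous_orbitTuple))
  calc p * tupleVolume (Fin k) n A *
        ENNReal.ofReal ((∏ s, ‖(D s).det‖ ^ 2) * ρ ^ edgeDim F k) ^ n
      ≤ (∫⁻ V, Measure.pi ν {U | (V, U) ∈ B} ∂tupleVolume (Fin k) n) *
        ENNReal.ofReal ((∏ s, ‖(D s).det‖ ^ 2) * ρ ^ edgeDim F k) ^ n := by
        gcongr
        exact mul_measure_le_lintegral hA.measurableSet fun V hV =>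
          (hp V hV).trans (measure_mono fun U hU => ⟨hV, hU⟩)
    _ = ∫⁻ W, Measure.pi ν {U | (W ∘ rootIdx hF, U) ∈ B ∧ EdgeNear D ρ U W}
          ∂tupleVolume (F × Fin k) n := (lintegral_edgeNear hF ν hD hρ hB).symm
    _ ≤ K * tupleVolume (F × Fin k) n {W | gram ℂ W ∈ N} := by
        refine lintegral_le_mul_measure
          (fun W hW => (measure_mono fun U hU => hU.2).trans (hK W hW)) fun W hW => ?_
        exact measure_mono_null (fun U hU => hW (hN U W hU.1.1 hU.1.2 hU.2)) measure_empty

theorem mul_tupleVolume_gram_le_mul_tupleVolume_mul (hF : SuffixClosed F)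
    (ν : S → Measure (unitaryGroup (Fin n) ℂ)) [∀ s, IsProbabilityMeasure (ν s)]
    (hD : ∀ s, IsUnit (D s).det) (hρ : 0 < ρ) (hA : IsOpen A) (hG : IsOpen G) (hN : IsOpen N)
    (hp : ∀ V ∈ A, Measure.pi ν {U | gram ℂ (orbitTuple F U V) ∈ G} ≤ p)
    (hK : ∀ W, gram ℂ W ∈ N → K ≤ Measure.pi ν {U | EdgeNear D ρ U W})
    (hroot : ∀ W, gram ℂ W ∈ N → W ∘ rootIdx hF ∈ A)
    (horbit : ∀ U (W : F × Fin k → Cn n), gram ℂ W ∈ N → EdgeNear D ρ U W →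
      gram ℂ (orbitTuple F U (W ∘ rootIdx hF)) ∈ G) :
    K * tupleVolume (F × Fin k) n {W | gram ℂ W ∈ N} ≤
      p * tupleVolume (Fin k) n A *
        ENNReal.ofReal ((∏ s, ‖(D s).det‖ ^ 2) * ρ ^ edgeDim F k) ^ n := by
  set B : Set ((Fin k → Cn n) × (S → unitaryGroup (Fin n) ℂ)) :=
    {x | x.1 ∈ A ∧ gram ℂ (orbitTuple F x.2 x.1) ∈ G}
  have hB : IsOpen B := (hA.preimage continuous_fst).inter
    (hG.preimage (continuous_gram.comp continuous_orbitTuple))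
  calc K * tupleVolume (F × Fin k) n {W | gram ℂ W ∈ N}
      ≤ ∫⁻ W, Measure.pi ν {U | (W ∘ rootIdx hF, U) ∈ B ∧ EdgeNear D ρ U W}
          ∂tupleVolume (F × Fin k) n :=
        mul_measure_le_lintegral (hN.preimage continuous_gram).measurableSet fun W hW =>
          (hK W hW).trans (measure_mono fun U hU => ⟨⟨hroot W hW, horbit U W hW hU⟩, hU⟩)
    _ = (∫⁻ V, Measure.pi ν {U | (V, U) ∈ B} ∂tupleVolume (Fin k) n) *
          ENNReal.ofReal ((∏ s, ‖(D s).det‖ ^ 2) * ρ ^ edgeDim F k) ^ n :=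
        lintegral_edgeNear hF ν hD hρ hB
    _ ≤ p * tupleVolume (Fin k) n A *
          ENNReal.ofReal ((∏ s, ‖(D s).det‖ ^ 2) * ρ ^ edgeDim F k) ^ n := by
        gcongr
        refine lintegral_le_mul_measure
          (fun V hV => (measure_mono fun U hU => hU.2).trans (hp V hV)) fun V hV => ?_
        exact measure_mono_null (fun U hU => hV hU.1) measure_empty

end DoubleCounting

section EdgeFactors

variable {S : Type*} [DecidableEq S] {F : Finset (FreeGroup S)} {k : ℕ}

/-- The block of an `F`-by-`F` block matrix at the ends of the edges with label `s`, that is, the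
block indexed by `F ∩ sF`. -/
abbrev edgeBlock (q : Matrix (F × Fin k) (F × Fin k) ℂ) (s : S) :
    Matrix (EdgeSet F s × Fin k) (EdgeSet F s × Fin k) ℂ :=
  q.submatrix (tgtIdx s) (tgtIdx s)

theorem exists_edge_factors {q : Matrix (F × Fin k) (F × Fin k) ℂ}
    (hq : ∀ s : S, (edgeBlock q s).PosDef) :
    ∃ D : ∀ s : S, Matrix (EdgeSet F s × Fin k) (EdgeSet F s × Fin k) ℂ,
      (∀ s, IsUnit (D s).det) ∧ (∀ s, ((D s)⁻¹)ᴴ * edgeBlock q s * (D s)⁻¹ = 1) ∧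
      ∀ s, ‖(D s).det‖ ^ 2 = (edgeBlock q s).det.re := by
  choose D hDq hD hdet using fun s => exists_conjTranspose_mul_self_eq (hq s)
  exact ⟨D, hD, fun s => hDq s ▸ conjTranspose_inv_mul_conjTranspose_mul_self_mul_inv (hD s), hdet⟩

theorem eventually_conjTranspose_mul_submatrix_mul_mem {ι κ : Type*} [Fintype ι] [DecidableEq ι]
    {q : Matrix κ κ ℂ} {T : Matrix ι ι ℂ} {f : ι → κ} (hq : Tᴴ * q.submatrix f f * T = 1)
    {N : Set (Matrix ι ι ℂ)} (hN : N ∈ 𝓝 1) :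
    ∀ᶠ M in 𝓝 q, Tᴴ * M.submatrix f f * T ∈ N := by
  have hcont : Continuous fun M : Matrix κ κ ℂ => Tᴴ * M.submatrix f f * T := by fun_prop
  exact hcont.continuousAt.eventually_mem (hq ▸ hN)

variable [Fintype S] {D : ∀ s : S, Matrix (EdgeSet F s × Fin k) (EdgeSet F s × Fin k) ℂ}
  {q : Matrix (F × Fin k) (F × Fin k) ℂ}

theorem exists_nhds_pi_edgeNear_le (hDq : ∀ s, ((D s)⁻¹)ᴴ * edgeBlock q s * (D s)⁻¹ = 1)
    {κ : ℝ} (hκ : 0 < κ) :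
    ∃ N ∈ 𝓝 q, ∀ ρ : ℝ, 0 < ρ → ∀ᶠ n in atTop, ∀ (ν : S → Measure (unitaryGroup (Fin n) ℂ))
      [∀ s, (ν s).IsMulLeftInvariant] [∀ s, IsProbabilityMeasure (ν s)] (W : F × Fin k → Cn n),
      gram ℂ W ∈ N →
      Measure.pi ν {U | EdgeNear D ρ U W} ≤ ENNReal.ofReal ((1 + κ) * ρ ^ edgeDim F k) ^ n := by
  obtain ⟨κ', hκ', hκκ'⟩ : ∃ κ' > 0, (1 + κ') ^ Fintype.card S < 1 + κ := by
    have hcont : Continuous fun κ' : ℝ => (1 + κ') ^ Fintype.card S := by fun_prop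
    exact ((hcont.tendsto 0).eventually_lt_const (by simpa)).exists_gt
  choose N hN hhit using fun s : S => exists_nhds_one_hitProb_le (EdgeSet F s × Fin k) hκ'
  refine ⟨_, eventually_all.2 fun s =>
    eventually_conjTranspose_mul_submatrix_mul_mem (hDq s) (hN s), fun ρ hρ => ?_⟩
  filter_upwards [eventually_all.2 fun s => hhit s ρ hρ, eventually_mul_ofReal_pow_le
    (K := 2 ^ Fintype.card S) (by finiteness) (by positivity) hκκ'] with n hhit_n habsorb ν _ _ W hW
  calc Measure.pi ν {U | EdgeNear D ρ U W}
      ≤ ∏ s, 2 * ENNReal.ofReal ((1 + κ') * ρ ^ (2 * Fintype.card (EdgeSet F s × Fin k))) ^ n := by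
        rw [pi_edgeNear]
        refine Finset.prod_le_prod' fun s _ => hhit_n s (ν s) _ _ ?_
        rw [gram_linComb]
        exact hW s
    _ = 2 ^ Fintype.card S * ENNReal.ofReal ((1 + κ') ^ Fintype.card S) ^ n *
          ENNReal.ofReal (ρ ^ edgeDim F k) ^ n := by
        rw [Finset.prod_mul_distrib, prod_ofReal_mul_pow_edgeDim (fun _ => by positivity) hρ.le,
          ENNReal.ofReal_mul (by positivity), mul_pow, ← mul_assoc]
        simp
    _ ≤ ENNReal.ofReal (1 + κ) ^ n * ENNReal.ofReal (ρ ^ edgeDim F k) ^ n := by gcongr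
    _ = ENNReal.ofReal ((1 + κ) * ρ ^ edgeDim F k) ^ n := by
        rw [← mul_pow, ENNReal.ofReal_mul (by positivity)]

theorem exists_nhds_le_pi_edgeNear (hDq : ∀ s, ((D s)⁻¹)ᴴ * edgeBlock q s * (D s)⁻¹ = 1)
    (hsrc : ∀ s : S, q.submatrix (srcIdx s) (srcIdx s) = edgeBlock q s)
    {κ : ℝ} (hκ : 0 < κ) (hκ1 : κ ≤ 1) :
    ∃ ρ₀ > 0, ∀ ρ : ℝ, 0 < ρ → ρ ≤ ρ₀ → ∃ N ∈ 𝓝 q, ∀ᶠ n in atTop,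
      ∀ (ν : S → Measure (unitaryGroup (Fin n) ℂ)) [∀ s, (ν s).IsMulLeftInvariant]
        [∀ s, IsProbabilityMeasure (ν s)] (W : F × Fin k → Cn n), gram ℂ W ∈ N →
        ENNReal.ofReal ((1 - κ) * ρ ^ edgeDim F k) ^ n ≤ Measure.pi ν {U | EdgeNear D ρ U W} := by
  obtain ⟨κ', hκ', hκκ', hκ'1⟩ : ∃ κ' > 0, 1 - κ < (1 - κ') ^ Fintype.card S ∧ κ' < 1 := by
    have hcont : Continuous fun κ' : ℝ => (1 - κ') ^ Fintype.card S := by fun_prop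
    exact (((hcont.tendsto 0).eventually_const_lt (by simpa)).and
      (eventually_lt_nhds one_pos)).exists_gt
  choose ρ₀ hρ₀ hhit using fun s : S => exists_nhds_one_le_hitProb (EdgeSet F s × Fin k) hκ' hκ'1
  obtain ⟨ρ₁, hρ₁, hρ₁ρ₀⟩ : ∃ ρ₁ > 0, ∀ s, ρ₁ ≤ ρ₀ s :=
    (eventually_all.2 fun s => eventually_le_nhds (hρ₀ s)).exists_gt
  refine ⟨ρ₁, hρ₁, fun ρ hρ hρρ₁ => ?_⟩
  choose N hN hhit using fun s => hhit s ρ hρ (hρρ₁.trans (hρ₁ρ₀ s))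
  refine ⟨_, eventually_all.2 fun s =>
    (eventually_conjTranspose_mul_submatrix_mul_mem (hsrc s ▸ hDq s) (hN s)).and
      (eventually_conjTranspose_mul_submatrix_mul_mem (hDq s) (hN s)), ?_⟩
  filter_upwards [eventually_all.2 hhit, eventually_mul_ofReal_pow_le
    (K := 2 ^ Fintype.card S) (by finiteness) (sub_nonneg.2 hκ1) hκκ']
    with n hhit_n habsorb ν _ _ W hW
  calc ENNReal.ofReal ((1 - κ) * ρ ^ edgeDim F k) ^ n
      = (2⁻¹) ^ Fintype.card S * (2 ^ Fintype.card S * ENNReal.ofReal (1 - κ) ^ n) *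
          ENNReal.ofReal (ρ ^ edgeDim F k) ^ n := by
        rw [← mul_assoc, ← mul_pow, ENNReal.inv_mul_cancel two_ne_zero ENNReal.ofNat_ne_top,
          one_pow, one_mul, ← mul_pow, ENNReal.ofReal_mul (sub_nonneg.2 hκ1)]
    _ ≤ (2⁻¹) ^ Fintype.card S * ENNReal.ofReal ((1 - κ') ^ Fintype.card S) ^ n *
          ENNReal.ofReal (ρ ^ edgeDim F k) ^ n := by gcongr
    _ = ∏ s, 2⁻¹ *
          ENNReal.ofReal ((1 - κ') * ρ ^ (2 * Fintype.card (EdgeSet F s × Fin k))) ^ n := by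
        rw [Finset.prod_mul_distrib, prod_ofReal_mul_pow_edgeDim
          (fun _ => sub_nonneg.2 hκ'1.le) hρ.le, Finset.prod_const, Finset.prod_const,
          Finset.card_univ, ENNReal.ofReal_mul (pow_nonneg (sub_nonneg.2 hκ'1.le) _), mul_pow,
          ← mul_assoc]
    _ ≤ Measure.pi ν {U | EdgeNear D ρ U W} := by
        rw [pi_edgeNear]
        refine Finset.prod_le_prod' fun s _ => hhit_n s (ν s) _ _ ?_ ?_ <;> rw [gram_linComb]
        exacts [(hW s).1, (hW s).2]

end EdgeFactors

/-! ### Local estimates of orbit probabilities -/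

section Cancellation

variable {h a v : ENNReal} {c d x y : ℝ} {n : ℕ}

theorem le_two_mul_of_mul_mul_le (hd : 0 < d) (hy : 0 ≤ y) (hxy : x * y ≤ d * c) (ha : 2⁻¹ ≤ a)
    (hv : v ≤ ENNReal.ofReal y ^ n)
    (hle : h * a * ENNReal.ofReal d ^ n ≤ ENNReal.ofReal x ^ n * v) :
    h ≤ 2 * ENNReal.ofReal c ^ n := by
  refine le_two_mul_of_mul_half_le hd hxy ?_
  calc h * (ENNReal.ofReal d ^ n * 2⁻¹) = h * 2⁻¹ * ENNReal.ofReal d ^ n := by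
        rw [mul_comm (_ ^ n), mul_assoc]
    _ ≤ h * a * ENNReal.ofReal d ^ n := by gcongr
    _ ≤ ENNReal.ofReal x ^ n * ENNReal.ofReal y ^ n := hle.trans (by gcongr)
    _ = ENNReal.ofReal (x * y) ^ n := by rw [← mul_pow, ENNReal.ofReal_mul' hy]

theorem half_mul_le_of_mul_le_mul_mul {z : ℝ} (hd : 0 < d) (hy : 0 ≤ y) (hz : 0 < z)
    (hxy : c * (z * d) ≤ x * y) (hv : 2⁻¹ * ENNReal.ofReal y ^ n ≤ v)
    (ha : a ≤ ENNReal.ofReal z ^ n)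
    (hle : ENNReal.ofReal x ^ n * v ≤ h * a * ENNReal.ofReal d ^ n) :
    2⁻¹ * ENNReal.ofReal c ^ n ≤ h := by
  refine half_mul_le_of_half_mul_le_mul (mul_pos hz hd) hxy ?_
  calc 2⁻¹ * ENNReal.ofReal (x * y) ^ n
      = 2⁻¹ * (ENNReal.ofReal x ^ n * ENNReal.ofReal y ^ n) := by
        rw [← mul_pow, ENNReal.ofReal_mul' hy]
    _ = ENNReal.ofReal x ^ n * (2⁻¹ * ENNReal.ofReal y ^ n) := mul_left_comm _ _ _
    _ ≤ ENNReal.ofReal x ^ n * v := by gcongr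
    _ ≤ h * ENNReal.ofReal z ^ n * ENNReal.ofReal d ^ n := hle.trans (by gcongr)
    _ = h * ENNReal.ofReal (z * d) ^ n := by
        rw [mul_assoc, ← mul_pow, ENNReal.ofReal_mul hz.le]

end Cancellation

section LocalEstimates

variable {S : Type*} [DecidableEq S] [Fintype S] {F : Finset (FreeGroup S)} {k : ℕ}
  {D : ∀ s : S, Matrix (EdgeSet F s × Fin k) (EdgeSet F s × Fin k) ℂ}
  {q : Matrix (F × Fin k) (F × Fin k) ℂ} {c : ℝ}

theorem exists_measure_gram_orbitTuple_mul_le (hF : SuffixClosed F)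
    (q : Matrix (F × Fin k) (F × Fin k) ℂ) (hD : ∀ s, IsUnit (D s).det) {ε : ℝ} (hε : 0 < ε) :
    ∃ δ > 0, ∃ ρ > 0, ∀ (n : ℕ) (ν : S → Measure (unitaryGroup (Fin n) ℂ))
      [∀ s, (ν s).IsHaarMeasure] [∀ s, IsProbabilityMeasure (ν s)] (V : Fin k → Cn n)
      (K : ENNReal), gram ℂ V = 1 →
      (∀ W, gram ℂ W ∈ entryBall q ε → Measure.pi ν {U | EdgeNear D ρ U W} ≤ K) →
      Measure.pi ν {U | gram ℂ (orbitTuple F U V) ∈ entryBall q (ε / 3)} *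
          tupleVolume (Fin k) n {Z | gram ℂ Z ∈ entryBall 1 δ} *
          ENNReal.ofReal ((∏ s, ‖(D s).det‖ ^ 2) * ρ ^ edgeDim F k) ^ n
        ≤ K * tupleVolume (F × Fin k) n {W | gram ℂ W ∈ entryBall q ε} := by
  obtain ⟨δ, hδ, hδ3, hroot⟩ :=
    exists_measure_gram_orbitTuple_le (S := S) q (show ε / 3 < 2 * ε / 3 by linarith)
  obtain ⟨ρ, hρ, horbit⟩ :=
    exists_gram_orbitTuple_mem_entryBall hF hD (show 0 < ε / 3 by positivity)
  refine ⟨δ, hδ, ρ, hρ, fun n ν _ _ V K hV hK => ?_⟩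
  refine mul_tupleVolume_mul_le_mul_tupleVolume_gram hF ν hD hρ
    ((isOpen_entryBall 1 δ).preimage continuous_gram) (isOpen_entryBall q (2 * ε / 3))
    (fun V' hV' => hroot n ν V V' ?_ hV') hK fun U W hA hG hUW => ?_
  · exact hV.symm ▸ mem_of_mem_nhds (entryBall_mem_nhds 1 hδ)
  · exact entryBall_subset_entryBall hG (by linarith) (mem_entryBall_comm.1
      (horbit n ρ U W hρ le_rfl (norm_le_two_of_gram_mem_entryBall hδ3 hA) hUW))

theorem exists_mul_tupleVolume_gram_le (hF : SuffixClosed F)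
    (hq1 : q.submatrix (rootIdx hF) (rootIdx hF) = 1) (hD : ∀ s, IsUnit (D s).det) {ε κ : ℝ}
    (hε : 0 < ε) (hκ : 0 < κ) :
    ∃ δ > 0, δ ≤ κ ∧ ∃ ρ₀ > 0, ∀ ρ, 0 < ρ → ρ ≤ ρ₀ → ∀ (n : ℕ)
      (ν : S → Measure (unitaryGroup (Fin n) ℂ)) [∀ s, (ν s).IsHaarMeasure]
      [∀ s, IsProbabilityMeasure (ν s)] (V : Fin k → Cn n)
      (N : Set (Matrix (F × Fin k) (F × Fin k) ℂ)) (K : ENNReal), gram ℂ V = 1 →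
      IsOpen N → N ⊆ entryBall q δ →
      (∀ W, gram ℂ W ∈ N → K ≤ Measure.pi ν {U | EdgeNear D ρ U W}) →
      K * tupleVolume (F × Fin k) n {W | gram ℂ W ∈ N} ≤
        Measure.pi ν {U | gram ℂ (orbitTuple F U V) ∈ entryBall q ε} *
          tupleVolume (Fin k) n {Z | gram ℂ Z ∈ entryBall 1 δ} *
          ENNReal.ofReal ((∏ s, ‖(D s).det‖ ^ 2) * ρ ^ edgeDim F k) ^ n := by
  obtain ⟨δ₀, hδ₀, hδ₀3, htrans⟩ :=
    exists_measure_gram_orbitTuple_le (S := S) q (show ε / 2 < ε by linarith)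
  obtain ⟨ρ₀, hρ₀, horbit⟩ :=
    exists_gram_orbitTuple_mem_entryBall hF hD (show 0 < ε / 4 by positivity)
  obtain ⟨δ, hδ, hδδ₀, hδκ, hδε⟩ : ∃ δ > 0, δ ≤ δ₀ ∧ δ ≤ κ ∧ δ ≤ ε / 4 :=
    ⟨min δ₀ (min κ (ε / 4)), by positivity, by simp, by simp, by simp⟩
  refine ⟨δ, hδ, hδκ, ρ₀, hρ₀, fun ρ hρ hρρ₀ n ν _ _ V N K hV hN hNδ hK => ?_⟩
  have hroot : ∀ W : F × Fin k → Cn n, gram ℂ W ∈ N → gram ℂ (W ∘ rootIdx hF) ∈ entryBall 1 δ := by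
    intro W hW i j
    rw [← hq1]
    exact hNδ hW (rootIdx hF i) (rootIdx hF j)
  refine mul_tupleVolume_gram_le_mul_tupleVolume_mul hF ν hD hρ
    ((isOpen_entryBall 1 δ).preimage continuous_gram) (isOpen_entryBall q (ε / 2)) hN
    (fun V' hV' => htrans n ν V' V (entryBall_mono 1 hδδ₀ hV') ?_) hK hroot
    fun U W hW hUW => ?_
  · exact hV.symm ▸ mem_of_mem_nhds (entryBall_mem_nhds 1 hδ₀)
  · exact entryBall_subset_entryBall (hNδ hW) (by linarith) (horbit n ρ U W hρ hρρ₀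
      (norm_le_two_of_gram_mem_entryBall (hδδ₀.trans hδ₀3) (hroot W hW)) hUW)

theorem exists_nhds_measure_gram_orbitTuple_le (hF : SuffixClosed F) (hq : q.PosSemidef)
    (hedge : ∀ s : S, (edgeBlock q s).PosDef)
    (hc : q.det.re < c * ∏ s : S, (edgeBlock q s).det.re) :
    ∃ N ∈ 𝓝 q, ∀ᶠ n in atTop, ∀ (ν : S → Measure (unitaryGroup (Fin n) ℂ))
      [∀ s, (ν s).IsHaarMeasure] [∀ s, IsProbabilityMeasure (ν s)] (V : Fin k → Cn n),
      gram ℂ V = 1 →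
      Measure.pi ν {U | gram ℂ (orbitTuple F U V) ∈ N} ≤ ENNReal.ofReal c ^ n := by
  obtain ⟨D, hD, hDq, hdet⟩ := exists_edge_factors hedge
  rw [← Finset.prod_congr rfl fun s _ => hdet s] at hc
  have hP : 0 < ∏ s, ‖(D s).det‖ ^ 2 :=
    Finset.prod_pos fun s _ => pow_pos (norm_pos_iff.2 (hD s).ne_zero) 2
  set P := ∏ s, ‖(D s).det‖ ^ 2
  have hdetq : 0 ≤ q.det.re := (Complex.le_def.1 hq.det_nonneg).1
  obtain ⟨c₁, hdetq_c₁, hc₁c⟩ := exists_between ((div_lt_iff₀ hP).2 hc)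
  obtain ⟨v, hdetq_v, hv⟩ := exists_between ((div_lt_iff₀ hP).1 hdetq_c₁)
  have hv_pos : 0 < v := hdetq.trans_lt hdetq_v
  obtain ⟨Nvol, hNvol, -, hvol⟩ := exists_nhds_tupleVolume_gram_le hq hdetq_v
  obtain ⟨Nedge, hNedge, hedgeNear⟩ :=
    exists_nhds_pi_edgeNear_le hDq (sub_pos.2 ((one_lt_div hv_pos).2 hv))
  obtain ⟨ε, hε, hεN⟩ := exists_entryBall_subset (inter_mem hNvol hNedge)
  obtain ⟨δ, hδ, ρ, hρ, hcount⟩ := exists_measure_gram_orbitTuple_mul_le hF q hD hε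
  refine ⟨entryBall q (ε / 3), entryBall_mem_nhds q (by positivity), ?_⟩
  filter_upwards [hedgeNear ρ hρ, eventually_le_tupleVolume_gram PosDef.one
    (entryBall_mem_nhds (1 : Matrix (Fin k) (Fin k) ℂ) hδ), eventually_mul_ofReal_pow_le
    (K := 2) (by finiteness) ((div_nonneg hdetq hP.le).trans hdetq_c₁.le) hc₁c]
    with n hedgeNear_n hroot habsorb ν _ _ V hV
  simp only [det_one, Complex.one_re, ENNReal.ofReal_one, one_pow, mul_one] at hroot
  have hvol_n : tupleVolume (F × Fin k) n {W | gram ℂ W ∈ entryBall q ε} ≤ ENNReal.ofReal v ^ n :=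
    le_trans (measure_mono fun W hW => (hεN hW).1) (hvol n)
  refine (le_two_mul_of_mul_mul_le (by positivity) hv_pos.le ?_ hroot hvol_n (hcount n ν V _ hV
    fun W hW => hedgeNear_n ν W (hεN hW).2)).trans habsorb
  rw [add_sub_cancel, mul_right_comm, div_mul_cancel₀ _ hv_pos.ne', mul_comm c₁, mul_right_comm]

theorem eventually_le_measure_gram_orbitTuple (hF : SuffixClosed F) (hq : q.PosDef)
    (hq1 : q.submatrix (rootIdx hF) (rootIdx hF) = 1)
    (hsrc : ∀ s : S, q.submatrix (srcIdx s) (srcIdx s) = edgeBlock q s) (hc0 : 0 ≤ c)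
    (hc : c * ∏ s : S, (edgeBlock q s).det.re < q.det.re)
    {N₀ : Set (Matrix (F × Fin k) (F × Fin k) ℂ)} (hN₀ : N₀ ∈ 𝓝 q) :
    ∀ᶠ n in atTop, ∀ (ν : S → Measure (unitaryGroup (Fin n) ℂ))
      [∀ s, (ν s).IsHaarMeasure] [∀ s, IsProbabilityMeasure (ν s)] (V : Fin k → Cn n),
      gram ℂ V = 1 →
      ENNReal.ofReal c ^ n ≤ Measure.pi ν {U | gram ℂ (orbitTuple F U V) ∈ N₀} := by
  obtain ⟨D, hD, hDq, hdet⟩ := exists_edge_factors fun s : S =>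
    hq.submatrix (edgeTgt_injective.prodMap Function.injective_id)
  rw [← Finset.prod_congr rfl fun s _ => hdet s] at hc
  have hP : 0 < ∏ s, ‖(D s).det‖ ^ 2 :=
    Finset.prod_pos fun s _ => pow_pos (norm_pos_iff.2 (hD s).ne_zero) 2
  set P := ∏ s, ‖(D s).det‖ ^ 2
  have hdetq : 0 ≤ q.det.re := (Complex.le_def.1 hq.posSemidef.det_nonneg).1
  obtain ⟨c₁, hcc₁, hc₁⟩ := exists_between ((lt_div_iff₀ hP).2 hc)
  obtain ⟨κ, hκ, hκc₁, hκ1⟩ : ∃ κ > 0, c₁ * ((1 + κ) ^ k * P) < (1 - κ) * q.det.re ∧ κ < 1 := by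
    have hleft : Continuous fun κ : ℝ => c₁ * ((1 + κ) ^ k * P) := by fun_prop
    have hright : Continuous fun κ : ℝ => (1 - κ) * q.det.re := by fun_prop
    exact (((hleft.tendsto 0).eventually_lt (hright.tendsto 0)
      (by simpa using (lt_div_iff₀ hP).1 hc₁)).and (eventually_lt_nhds one_pos)).exists_gt
  obtain ⟨ε, hε, hεN₀⟩ := exists_entryBall_subset hN₀
  obtain ⟨δ, hδ, hδκ, ρ₀, hρ₀, hcount⟩ := exists_mul_tupleVolume_gram_le hF hq1 hD hε hκ
  obtain ⟨ρ₁, hρ₁, hedgeNear⟩ := exists_nhds_le_pi_edgeNear hDq hsrc hκ hκ1.le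
  obtain ⟨ρ, hρ, hρρ₀, hρρ₁⟩ : ∃ ρ > 0, ρ ≤ ρ₀ ∧ ρ ≤ ρ₁ :=
    ⟨min ρ₀ ρ₁, lt_min hρ₀ hρ₁, min_le_left _ _, min_le_right _ _⟩
  obtain ⟨Nedge, hNedge, hedgeNear⟩ := hedgeNear ρ hρ hρρ₁
  obtain ⟨τ, hτ, hτN⟩ := exists_entryBall_subset (inter_mem hNedge (entryBall_mem_nhds q hδ))
  filter_upwards [hedgeNear, eventually_le_tupleVolume_gram hq (entryBall_mem_nhds q hτ),
    eventually_mul_ofReal_pow_le (K := 2) (by finiteness) hc0 hcc₁]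
    with n hedgeNear_n hvol habsorb ν _ _ V hV
  have hroot : tupleVolume (Fin k) n {Z | gram ℂ Z ∈ entryBall 1 δ} ≤
      ENNReal.ofReal ((1 + κ) ^ k) ^ n := by
    simpa using tupleVolume_gram_entryBall_le (ι := Fin k) (n := n) hκ hδκ
  refine (ENNReal.mul_le_iff_le_inv two_ne_zero ENNReal.ofNat_ne_top).1 habsorb |>.trans <|
    (half_mul_le_of_mul_le_mul_mul (by positivity) hdetq (by positivity) ?_ hvol hroot
      (hcount ρ hρ hρρ₀ n ν V _ _ hV (isOpen_entryBall q τ) (fun _ hM => (hτN hM).2)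
        fun W hW => hedgeNear_n ν W (hτN hW).1)).trans (measure_mono fun U hU => hεN₀ hU)
  nlinarith [pow_pos hρ (edgeDim F k)]

end LocalEstimates

/-! ### The entropy of restrictions -/

section Restriction

variable {Γ : Type*} [Group Γ] {k : ℕ} (φ : unitalPD Γ k) {E F : Finset Γ} {m : Type*}
  {f : m → F} {g : m → E}

theorem submatrix_restrictPD_eq (h : ∀ x y, (f x : Γ)⁻¹ * f y = (g x : Γ)⁻¹ * g y) :
    (restrictPD φ F).1.submatrix (Prod.map f id) (Prod.map f id)
      = (restrictPD φ E).1.submatrix (Prod.map g id) (Prod.map g id) := by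
  ext p q
  simp [restrictPD, h]

theorem posDef_submatrix_restrictPD (hE : (restrictPD φ E).1.PosDef) (hg : Function.Injective g)
    (h : ∀ x y, (f x : Γ)⁻¹ * f y = (g x : Γ)⁻¹ * g y) :
    ((restrictPD φ F).1.submatrix (Prod.map f id) (Prod.map f id)).PosDef := by
  rw [submatrix_restrictPD_eq φ h]
  exact hE.submatrix (hg.prodMap Function.injective_id)

theorem posDef_restrictPD_of_subset (h : E ⊆ F) (hF : (restrictPD φ F).1.PosDef) :
    (restrictPD φ E).1.PosDef :=
  posDef_submatrix_restrictPD φ (f := id) (g := Set.inclusion h) hF (Set.inclusion_injective h)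
    fun _ _ => rfl

end Restriction

section PartialPD

variable {S : Type*} [DecidableEq S] {k : ℕ} {F : Finset (FreeGroup S)} (q : partialPD k F)

theorem submatrix_rootIdx_partialPD (hF : SuffixClosed F) :
    q.1.submatrix (rootIdx hF) (rootIdx hF) = 1 :=
  Matrix.ext fun i j => q.2.2.1 ⟨1, hF.one_mem⟩ i j

theorem submatrix_srcIdx_partialPD (s : S) :
    q.1.submatrix (srcIdx s) (srcIdx s) = edgeBlock q.1 s :=
  Matrix.ext fun x y => q.2.2.2 _ _ _ _ (by simp only [edgeSrc, edgeTgt]; group) x.2 y.2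

theorem partialPD_singleton_eq_one {Γ : Type*} [Group Γ] [DecidableEq Γ] {g : Γ}
    (q : partialPD k {g}) : q.1 = 1 := by
  ext ⟨x, i⟩ ⟨y, j⟩
  obtain rfl := Subsingleton.elim x y
  simp [q.2.2.1, Matrix.one_apply]

theorem posDef_edgeBlock (hq : q.1.PosDef) (s : S) : (edgeBlock q.1 s).PosDef :=
  hq.submatrix (edgeTgt_injective.prodMap Function.injective_id)

end PartialPD

section SingularSets

variable {S : Type*} [DecidableEq S] {k : ℕ} (φ : unitalPD (FreeGroup S) k)
  {F : Finset (FreeGroup S)}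

theorem posDef_edgeBlock_of_erase {g : FreeGroup S} (hg : ∀ h ∈ F, h.norm ≤ g.norm)
    (hφ : (restrictPD φ (F.erase g)).1.PosDef) (s : S) :
    (edgeBlock (restrictPD φ F).1 s).PosDef := by
  rcases notMem_edgeSet_or_of_forall_norm_le hg s with hgs | hgs
  · have mem_erase (x : EdgeSet F s) : x.1 ∈ F.erase g :=
      Finset.mem_erase.2 ⟨fun hx => hgs (hx ▸ x.2), (edgeTgt x).2⟩
    exact posDef_submatrix_restrictPD φ (f := edgeTgt) (g := fun x => ⟨x.1, mem_erase x⟩) hφ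
      (fun x y hxy => Subtype.ext (congrArg Subtype.val hxy :)) fun _ _ => rfl
  · have inv_mul_mem_erase (x : EdgeSet F s) : (FreeGroup.of s)⁻¹ * x.1 ∈ F.erase g :=
      Finset.mem_erase.2
        ⟨fun hx => hgs (hx ▸ (mul_inv_cancel_left _ x.1).symm ▸ x.2), (edgeSrc x).2⟩
    exact posDef_submatrix_restrictPD φ (f := edgeTgt) (g := fun x => ⟨_, inv_mul_mem_erase x⟩) hφ
      (fun x y hxy => Subtype.ext (mul_left_cancel (congrArg Subtype.val hxy :)))
      fun x y => by simp only [edgeTgt]; group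

theorem exists_singular_posDef_edgeBlock (hF : SuffixClosed F)
    (hφ : ¬ (restrictPD φ F).1.PosDef) :
    ∃ E, SuffixClosed E ∧ ¬ (restrictPD φ E).1.PosDef ∧
      ∀ s, (edgeBlock (restrictPD φ E).1 s).PosDef := by
  obtain ⟨E, ⟨hE, hφE⟩, hmin⟩ := Finset.isWellFounded_ssubset.wf.has_min
    {E | SuffixClosed E ∧ ¬ (restrictPD φ E).1.PosDef} ⟨F, hF, hφ⟩
  obtain ⟨g, hgE, hg⟩ := E.exists_max_image FreeGroup.norm ⟨1, hE.one_mem⟩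
  have hg1 : g ≠ 1 := by
    rintro rfl
    obtain rfl : E = {1} := Finset.eq_singleton_iff_unique_mem.2 ⟨hE.one_mem, fun h hh => by
      simpa using hg h hh⟩
    exact hφE (partialPD_singleton_eq_one (restrictPD φ {1}) ▸ PosDef.one)
  refine ⟨E, hE, hφE, posDef_edgeBlock_of_erase φ hg ?_⟩
  by_contra hsing
  exact hmin _ ⟨hE.erase hg1 hg, hsing⟩ (Finset.erase_ssubset hgE)

end SingularSets

section Entropy

variable {S : Type*} [DecidableEq S] [Fintype S] {k : ℕ} {F : Finset (FreeGroup S)}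
  {q : partialPD k F}

theorem prod_det_edgeBlock_pos {q : Matrix (F × Fin k) (F × Fin k) ℂ}
    (hq : ∀ s : S, (edgeBlock q s).PosDef) : 0 < ∏ s : S, (edgeBlock q s).det.re :=
  Finset.prod_pos fun s _ => (Complex.lt_def.1 (hq s).det_pos).1

theorem hF_of_posDef (hq : q.1.PosDef) :
    hF F q
      = ((Real.log q.1.det.re - Real.log (∏ s : S, (edgeBlock q.1 s).det.re) : ℝ) : EReal) := by
  have hunit := hq.isUnit
  rw [Real.log_prod fun s _ => (Complex.lt_def.1 (posDef_edgeBlock q hq s).det_pos).1.ne']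
  obtain rfl : ‹DecidableEq S› = fun a b => Classical.propDecidable (a = b) :=
    Subsingleton.elim _ _
  exact if_pos (by convert! hunit)

omit [DecidableEq S] in
theorem hF_of_not_posDef (hq : ¬ q.1.PosDef) : hF F q = ⊥ := by
  classical
  exact if_neg fun hu => hq (q.2.1.posDef_iff_isUnit.2 (by convert! hu))

theorem hF_lt_coe_iff (hq : q.1.PosDef) (a : ℝ) :
    hF F q < a ↔ q.1.det.re < Real.exp a * ∏ s : S, (edgeBlock q.1 s).det.re := by
  rw [hF_of_posDef hq, EReal.coe_lt_coe_iff, sub_lt_iff_lt_add,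
    Real.log_lt_iff_lt_exp (Complex.lt_def.1 hq.det_pos).1, Real.exp_add,
    Real.exp_log (prod_det_edgeBlock_pos (posDef_edgeBlock q hq))]

theorem coe_lt_hF_iff (hq : q.1.PosDef) (a : ℝ) :
    a < hF F q ↔ Real.exp a * ∏ s : S, (edgeBlock q.1 s).det.re < q.1.det.re := by
  rw [hF_of_posDef hq, EReal.coe_lt_coe_iff, lt_sub_iff_add_lt,
    Real.lt_log_iff_exp_lt (Complex.lt_def.1 hq.det_pos).1, Real.exp_add,
    Real.exp_log (prod_det_edgeBlock_pos (posDef_edgeBlock q hq))]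

omit [DecidableEq S] in
theorem hF_singleton (g : FreeGroup S) (q : partialPD k {g}) : hF {g} q = 0 := by
  classical
  have isEmpty_edgeSet (s : S) : IsEmpty (EdgeSet {g} s) := by
    refine ⟨fun x => FreeGroup.of_ne_one s ?_⟩
    obtain ⟨hx, hsx⟩ := mem_edgeSet.1 x.2
    rwa [Finset.mem_singleton.1 hx, Finset.mem_singleton, mul_eq_right, inv_eq_one] at hsx
  have hq := partialPD_singleton_eq_one q
  rw [hF_of_posDef (hq ▸ PosDef.one), hq]
  simp [Matrix.det_isEmpty]

/- The upper estimate needs nonsingular edge blocks. If `φ[F]` is singular, they are available at a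
minimal suffix closed set at which `φ` is singular, whose determinant vanishes. -/
theorem exists_nhds_measure_le_exp (φ : unitalPD (FreeGroup S) k) (hFsuffix : SuffixClosed F)
    {a : ℝ} (ha : hF F (restrictPD φ F) < a) :
    ∃ E : Finset (FreeGroup S), ∃ N ∈ 𝓝 (restrictPD φ E).1, ∀ᶠ n in atTop,
      ∀ (ν : S → Measure (unitaryGroup (Fin n) ℂ)) [∀ s, (ν s).IsHaarMeasure]
      [∀ s, IsProbabilityMeasure (ν s)] (V : Fin k → Cn n), gram ℂ V = 1 →
      Measure.pi ν {U | gram ℂ (orbitTuple E U V) ∈ N} ≤ ENNReal.ofReal (Real.exp a) ^ n := by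
  by_cases hφ : (restrictPD φ F).1.PosDef
  · exact ⟨F, exists_nhds_measure_gram_orbitTuple_le hFsuffix hφ.posSemidef (posDef_edgeBlock _ hφ)
      ((hF_lt_coe_iff hφ a).1 ha)⟩
  · obtain ⟨E, hE, hφE, hedge⟩ := exists_singular_posDef_edgeBlock φ hFsuffix hφ
    refine ⟨E, exists_nhds_measure_gram_orbitTuple_le hE (restrictPD φ E).2.1 hedge ?_⟩
    rw [(restrictPD φ E).2.1.posDef_iff_det_ne_zero, not_not] at hφE
    rw [hφE, Complex.zero_re]
    exact mul_pos (Real.exp_pos a) (prod_det_edgeBlock_pos hedge)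

theorem eventually_exp_le_measure (hFsuffix : SuffixClosed F) {a : ℝ} (ha : (a : EReal) < hF F q)
    {N : Set (Matrix (F × Fin k) (F × Fin k) ℂ)} (hN : N ∈ 𝓝 q.1) :
    ∀ᶠ n in atTop, ∀ (ν : S → Measure (unitaryGroup (Fin n) ℂ))
      [∀ s, (ν s).IsHaarMeasure] [∀ s, IsProbabilityMeasure (ν s)] (V : Fin k → Cn n),
      gram ℂ V = 1 →
      ENNReal.ofReal (Real.exp a) ^ n ≤ Measure.pi ν {U | gram ℂ (orbitTuple F U V) ∈ N} := by
  have hq : q.1.PosDef := by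
    by_contra hq
    exact not_lt_bot (hF_of_not_posDef hq ▸ ha)
  exact eventually_le_measure_gram_orbitTuple hFsuffix hq (submatrix_rootIdx_partialPD q hFsuffix)
    (submatrix_srcIdx_partialPD q) (Real.exp_pos a).le ((coe_lt_hF_iff hq a).1 ha) hN

theorem exists_isHaarMeasure_isProbabilityMeasure (n : ℕ) :
    ∃ ν : Measure (unitaryGroup (Fin n) ℂ), ν.IsHaarMeasure ∧ IsProbabilityMeasure ν :=
  ⟨Measure.haarMeasure ⊤, inferInstance, ⟨Measure.haarMeasure_self⟩⟩

theorem exists_gram_eq_one {k n : ℕ} (hkn : k ≤ n) : ∃ V : Fin k → Cn n, gram ℂ V = 1 :=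
  ⟨_, gram_eq_one_iff_orthonormal.2 <| (EuclideanSpace.basisFun (Fin n) ℂ).orthonormal.comp
    (Fin.castLE hkn) (Fin.castLE_injective hkn)⟩

/- Both sides are exponential rates of probabilities, and a neighbourhood of `φ[E]` gives a
neighbourhood of `φ[F]`. -/
theorem hF_anti (φ : unitalPD (FreeGroup S) k) {E : Finset (FreeGroup S)} (hE : SuffixClosed E)
    (hFsuffix : SuffixClosed F) (hEF : E ⊆ F) :
    hF F (restrictPD φ F) ≤ hF E (restrictPD φ E) := by
  by_cases hφ : (restrictPD φ F).1.PosDef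
  swap
  · exact (hF_of_not_posDef hφ).trans_le bot_le
  by_contra! hlt
  obtain ⟨b, hEb, hbF⟩ := EReal.exists_between_coe_real hlt
  obtain ⟨a, hEa, hab⟩ := EReal.exists_between_coe_real hEb
  have hφE := posDef_restrictPD_of_subset φ hEF hφ
  obtain ⟨N, hN, hupper⟩ := exists_nhds_measure_gram_orbitTuple_le hE hφE.posSemidef
    (posDef_edgeBlock _ hφE) ((hF_lt_coe_iff hφE a).1 hEa)
  have hcont : Continuous fun M : Matrix (F × Fin k) (F × Fin k) ℂ =>
      M.submatrix (Prod.map (Set.inclusion hEF) id) (Prod.map (Set.inclusion hEF) id) := by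
    fun_prop
  have hlower := eventually_exp_le_measure hFsuffix hbF (hcont.continuousAt.preimage_mem_nhds hN)
  obtain ⟨n, hupper_n, hlower_n, hkn, hn⟩ := (hupper.and (hlower.and
    ((eventually_ge_atTop k).and (eventually_ne_atTop 0)))).exists
  obtain ⟨ν, _, _⟩ := exists_isHaarMeasure_isProbabilityMeasure n
  obtain ⟨V, hV⟩ := exists_gram_eq_one hkn
  have hpow := (hlower_n (fun _ => ν) V hV).trans (hupper_n (fun _ => ν) V hV)
  rw [ENNReal.pow_le_pow_left_iff hn, ENNReal.ofReal_le_ofReal_iff (Real.exp_pos a).le,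
    Real.exp_le_exp] at hpow
  exact (EReal.coe_lt_coe_iff.1 hab).not_ge hpow

omit [DecidableEq S] in
theorem tendsto_hF_cayleyBall (φ : unitalPD (FreeGroup S) k) :
    Tendsto (fun n : ℕ => hF (cayleyBall S n) (restrictPD φ (cayleyBall S n))) atTop
      (𝓝 (⨅ (F : Finset (FreeGroup S)) (_ : IsGrounded F), hF F (restrictPD φ F))) := by
  classical
  refine tendsto_order.2 ⟨fun b hb => Eventually.of_forall fun n => hb.trans_le
    (iInf₂_le _ (suffixClosed_cayleyBall n).isGrounded), fun b hb => ?_⟩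
  obtain ⟨F, hFb⟩ := iInf_lt_iff.1 hb
  obtain ⟨hFgrounded, hFb⟩ := iInf_lt_iff.1 hFb
  obtain ⟨m, hm⟩ := exists_subset_cayleyBall F
  filter_upwards [eventually_ge_atTop m] with n hn
  exact (hF_anti φ hFgrounded.suffixClosed (suffixClosed_cayleyBall n)
    (hm.trans (cayleyBall_mono hn))).trans_lt hFb

end Entropy

/-! ### Large deviations -/

section Space

variable {Γ : Type*} [Group Γ] {k : ℕ}

theorem continuous_unitalPD_apply (g : Γ) : Continuous fun φ : unitalPD Γ k => φ.1 g :=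
  (continuous_apply g).comp continuous_subtype_val

theorem continuous_restrictPD (F : Finset Γ) :
    Continuous fun φ : unitalPD Γ k => (restrictPD φ F).1 :=
  continuous_matrix fun _ _ => (continuous_unitalPD_apply _).matrix_elem _ _

theorem norm_unitalPD_apply_le_one (φ : unitalPD Γ k) (g : Γ) (i j : Fin k) :
    ‖φ.1 g i j‖ ≤ 1 := by
  have hminor := φ.2.2.submatrix (![(1, i), (g, j)] : Fin 2 → Γ × Fin k)
  have hdet := (Complex.le_def.1 hminor.det_nonneg).1
  rw [Matrix.det_fin_two, ← hminor.1.apply 1 0] at hdet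
  simp only [Complex.zero_re, submatrix_apply, of_apply, cons_val_zero, cons_val_one, inv_one,
    one_mul, inv_mul_cancel, φ.2.1, one_apply_eq, mul_one, RCLike.star_def, Complex.mul_conj',
    Complex.sub_re, Complex.one_re] at hdet
  norm_cast at hdet
  exact (sq_le_one_iff₀ (norm_nonneg _)).1 (sub_nonneg.1 hdet)

theorem isClosed_unitalPD : IsClosed (unitalPD Γ k) := by
  refine (isClosed_eq (continuous_apply 1) continuous_const).inter
    (IsClosed.inter (s₁ := {φ : Γ → Matrix (Fin k) (Fin k) ℂ |
      (Matrix.of fun p q : Γ × Fin k => φ (p.1⁻¹ * q.1) p.2 q.2).IsHermitian})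
      (isClosed_eq (by fun_prop) (by fun_prop)) ?_)
  change IsClosed {φ : Γ → Matrix (Fin k) (Fin k) ℂ | ∀ x : Γ × Fin k →₀ ℂ,
    0 ≤ x.sum fun p a => x.sum fun q b => star a * φ (p.1⁻¹ * q.1) p.2 q.2 * b}
  rw [Set.ofPred_forall]
  refine isClosed_iInter fun x => isClosed_le continuous_const ?_
  simp only [Finsupp.sum]
  fun_prop

instance compactSpace_unitalPD : CompactSpace (unitalPD Γ k) := by
  rw [← isCompact_iff_compactSpace]
  have hpi : IsCompact (Set.univ.pi fun _ : Γ => Set.univ.pi fun _ : Fin k => Set.univ.pi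
      fun _ : Fin k => Metric.closedBall (0 : ℂ) 1) :=
    isCompact_univ_pi fun _ => isCompact_univ_pi fun _ => isCompact_univ_pi fun _ =>
      isCompact_closedBall 0 1
  exact hpi.of_isClosed_subset isClosed_unitalPD fun φ hφ g _ i _ j _ =>
    mem_closedBall_zero_iff.2 (norm_unitalPD_apply_le_one ⟨φ, hφ⟩ g i j)

theorem exists_finset_restrictPD_nhds (φ : unitalPD Γ k) {A : Set (unitalPD Γ k)}
    (hA : A ∈ 𝓝 φ) :
    ∃ J : Finset Γ, ∀ F, 1 ∈ F → J ⊆ F →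
      ∃ N ∈ 𝓝 (restrictPD φ F).1, ∀ ψ : unitalPD Γ k, (restrictPD ψ F).1 ∈ N → ψ ∈ A := by
  rw [nhds_subtype_eq_comap, Filter.mem_comap] at hA
  obtain ⟨T, hT, hTA⟩ := hA
  rw [nhds_pi, Filter.mem_pi'] at hT
  obtain ⟨J, t, ht, hJt⟩ := hT
  refine ⟨J, fun F h1 hJF => ?_⟩
  set value : F → Matrix (F × Fin k) (F × Fin k) ℂ → Matrix (Fin k) (Fin k) ℂ := fun g M =>
    M.submatrix (fun i => (⟨1, h1⟩, i)) fun i => (g, i)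
  have hvalue (ψ : unitalPD Γ k) (g : F) : value g (restrictPD ψ F).1 = ψ.1 g := by
    ext i j
    simp [value, restrictPD]
  have hcont (g : F) : Continuous (value g) := by fun_prop
  refine ⟨⋂ g, value g ⁻¹' t g, iInter_mem.2 fun g =>
    (hcont g).continuousAt.preimage_mem_nhds (hvalue φ g ▸ ht g), fun ψ hψ => ?_⟩
  refine hTA (hJt fun g hg => ?_)
  rw [← hvalue ψ ⟨g, hJF hg⟩]
  exact Set.mem_preimage.1 (Set.mem_iInter.1 hψ ⟨g, hJF hg⟩)

end Space

section RandomRep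

variable {k n : ℕ} {S : Type*}

/-- The columns of an `n`-by-`k` matrix, as a `k`-tuple of vectors of `ℂⁿ`; it turns the
orthonormal tuples of `unitaryTuples` into tuples with Gram matrix `1`. -/
def columnTuple (V : Matrix (Fin n) (Fin k) ℂ) : Fin k → Cn n :=
  fun i => WithLp.toLp 2 fun a => V a i

theorem inner_columnTuple (V W : Matrix (Fin n) (Fin k) ℂ) (i j : Fin k) :
    inner ℂ (columnTuple V i) (columnTuple W j) = (Vᴴ * W) i j := by
  simp [columnTuple, PiLp.inner_apply, Matrix.mul_apply, mul_comm]

theorem gram_columnTuple (V : unitaryTuples k n) : gram ℂ (columnTuple V.1) = 1 :=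
  Matrix.ext fun i j => (inner_columnTuple _ _ i j).trans
    (congrFun₂ (show (V.1)ᴴ * V.1 = 1 from V.2) i j)

theorem unitaryIsometry_columnTuple (U : unitaryGroup (Fin n) ℂ) (V : Matrix (Fin n) (Fin k) ℂ)
    (i : Fin k) : unitaryIsometry n U (columnTuple V i) = columnTuple (U.1 * V) i :=
  rfl

theorem gram_orbitTuple_columnTuple {F : Finset (FreeGroup S)} (U : S → unitaryGroup (Fin n) ℂ)
    (V : unitaryTuples k n) :
    gram ℂ (orbitTuple F U (columnTuple V.1))
      = (restrictPD (typeOf (FreeGroup.lift U) V) F).1 := by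
  ext p q
  rw [gram_apply, orbitTuple, orbitTuple, unitaryIsometry_columnTuple,
    unitaryIsometry_columnTuple, inner_columnTuple]
  change _ = ((V.1)ᴴ * (FreeGroup.lift U (p.1.1⁻¹ * q.1.1)).1 * V.1) p.2 q.2
  simp [Matrix.mul_assoc, Matrix.star_eq_conjTranspose, Matrix.conjTranspose_mul]

theorem continuous_typeOf_lift (V : unitaryTuples k n) :
    Continuous fun U : S → unitaryGroup (Fin n) ℂ => typeOf (FreeGroup.lift U) V :=
  Continuous.subtype_mk (continuous_pi fun g => (continuous_const.matrix_mul
    (continuous_subtype_val.comp (continuous_lift g))).matrix_mul continuous_const) _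

theorem lift_comp_of {G : Type*} [Group G] (f : FreeGroup S →* G) :
    FreeGroup.lift (fun s => f (FreeGroup.of s)) = f :=
  FreeGroup.lift.apply_symm_apply f

variable {Ω : Type*} [MeasurableSpace Ω] {P : Measure Ω} [IsProbabilityMeasure P]
  {π : Ω → (FreeGroup S →* unitaryGroup (Fin n) ℂ)}

theorem IsUniformRandomRep.measurable_typeOf [Finite S] (hπ : IsUniformRandomRep P π)
    (V : unitaryTuples k n) : Measurable fun ω => typeOf (π ω) V := by
  have := (continuous_typeOf_lift V).measurable.comp (measurable_pi_iff.2 hπ.measurable)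
  simpa only [Function.comp_def, lift_comp_of] using this

variable [Fintype S]

theorem IsUniformRandomRep.map_typeOf (hπ : IsUniformRandomRep P π) (V : unitaryTuples k n) :
    P.map (fun ω => typeOf (π ω) V)
      = (Measure.pi fun s => P.map fun ω => π ω (FreeGroup.of s)).map
        fun U => typeOf (FreeGroup.lift U) V := by
  rw [← (iIndepFun_iff_map_fun_eq_pi_map fun s => (hπ.measurable s).aemeasurable).1 hπ.indep,
    Measure.map_map (continuous_typeOf_lift V).measurable (measurable_pi_iff.2 hπ.measurable)]
  simp only [Function.comp_def, lift_comp_of]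

theorem IsUniformRandomRep.map_typeOf_apply (hπ : IsUniformRandomRep P π) (V : unitaryTuples k n)
    (F : Finset (FreeGroup S)) {N : Set (Matrix (F × Fin k) (F × Fin k) ℂ)} (hN : IsOpen N) :
    P.map (fun ω => typeOf (π ω) V) {φ | (restrictPD φ F).1 ∈ N}
      = Measure.pi (fun s => P.map fun ω => π ω (FreeGroup.of s))
        {U | gram ℂ (orbitTuple F U (columnTuple V.1)) ∈ N} := by
  rw [hπ.map_typeOf]
  refine (Measure.map_apply (continuous_typeOf_lift V).measurable
    (hN.preimage (continuous_restrictPD F)).measurableSet).trans ?_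
  simp only [gram_orbitTuple_columnTuple]
  rfl

end RandomRep

section Law

variable {S : Type*} [Fintype S] {k : ℕ} {Ω : Type*} [MeasurableSpace Ω] {P : Measure Ω}
  [IsProbabilityMeasure P] {π : ∀ n : ℕ, Ω → (FreeGroup S →* unitaryGroup (Fin n) ℂ)}
  (hπ : ∀ n, IsUniformRandomRep P (π n)) (V : ∀ n : ℕ, k ≤ n → unitaryTuples k n)
  {φ : unitalPD (FreeGroup S) k} {a : ℝ}

include hπ

theorem exists_nhds_law_le_exp
    (ha : (⨅ (F : Finset (FreeGroup S)) (_ : IsGrounded F), hF F (restrictPD φ F)) < a) :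
    ∃ U ∈ 𝓝 φ, ∀ᶠ n in atTop, ∀ hn : k ≤ n,
      (P.map fun ω => typeOf (π n ω) (V n hn)).real U ≤ Real.exp (a * n) := by
  classical
  have (n : ℕ) (s : S) := (hπ n).haar s
  have (n : ℕ) (s : S) : IsProbabilityMeasure (P.map fun ω => π n ω (FreeGroup.of s)) :=
    Measure.isProbabilityMeasure_map ((hπ n).measurable s).aemeasurable
  obtain ⟨F, ha⟩ := iInf_lt_iff.1 ha
  obtain ⟨hFgrounded, ha⟩ := iInf_lt_iff.1 ha
  obtain ⟨E, N, hN, hbound⟩ := exists_nhds_measure_le_exp φ hFgrounded.suffixClosed ha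
  refine ⟨{ψ | (restrictPD ψ E).1 ∈ interior N},
    (continuous_restrictPD E).continuousAt.preimage_mem_nhds (interior_mem_nhds.2 hN), ?_⟩
  filter_upwards [hbound] with n hbound_n hn
  refine ENNReal.toReal_le_of_le_ofReal (Real.exp_pos _).le ?_
  calc P.map (fun ω => typeOf (π n ω) (V n hn)) {ψ | (restrictPD ψ E).1 ∈ interior N}
      = Measure.pi (fun s => P.map fun ω => π n ω (FreeGroup.of s))
          {U | gram ℂ (orbitTuple E U (columnTuple (V n hn).1)) ∈ interior N} :=
        (hπ n).map_typeOf_apply (V n hn) E isOpen_interior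
    _ ≤ Measure.pi (fun s => P.map fun ω => π n ω (FreeGroup.of s))
          {U | gram ℂ (orbitTuple E U (columnTuple (V n hn).1)) ∈ N} :=
        measure_mono fun U hU => interior_subset (s := N) hU
    _ ≤ ENNReal.ofReal (Real.exp a) ^ n := hbound_n _ _ (gram_columnTuple (V n hn))
    _ = ENNReal.ofReal (Real.exp (a * n)) := by
        rw [← ENNReal.ofReal_pow (Real.exp_pos a).le, ← Real.exp_nat_mul, mul_comm]

theorem eventually_exp_le_law
    (ha : a < ⨅ (F : Finset (FreeGroup S)) (_ : IsGrounded F), hF F (restrictPD φ F))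
    {A : Set (unitalPD (FreeGroup S) k)} (hA : A ∈ 𝓝 φ) :
    ∀ᶠ n in atTop, ∀ hn : k ≤ n,
      Real.exp (a * n) ≤ (P.map fun ω => typeOf (π n ω) (V n hn)).real A := by
  classical
  have (n : ℕ) (s : S) := (hπ n).haar s
  have (n : ℕ) (s : S) : IsProbabilityMeasure (P.map fun ω => π n ω (FreeGroup.of s)) :=
    Measure.isProbabilityMeasure_map ((hπ n).measurable s).aemeasurable
  obtain ⟨J, hJ⟩ := exists_finset_restrictPD_nhds φ hA
  obtain ⟨m, hm⟩ := exists_subset_cayleyBall J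
  have hball := suffixClosed_cayleyBall (S := S) m
  obtain ⟨N, hN, hNA⟩ := hJ _ hball.one_mem hm
  filter_upwards [eventually_exp_le_measure hball (ha.trans_le (iInf₂_le _ hball.isGrounded))
    (interior_mem_nhds.2 hN)] with n hbound_n hn
  refine (ENNReal.ofReal_le_iff_le_toReal (measure_ne_top _ _)).1 ?_
  calc ENNReal.ofReal (Real.exp (a * n)) = ENNReal.ofReal (Real.exp a) ^ n := by
        rw [← ENNReal.ofReal_pow (Real.exp_pos a).le, ← Real.exp_nat_mul, mul_comm]
    _ ≤ Measure.pi (fun s => P.map fun ω => π n ω (FreeGroup.of s))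
          {U | gram ℂ (orbitTuple _ U (columnTuple (V n hn).1)) ∈ interior N} :=
        hbound_n _ _ (gram_columnTuple (V n hn))
    _ = P.map (fun ω => typeOf (π n ω) (V n hn)) {ψ | (restrictPD ψ _).1 ∈ interior N} :=
        ((hπ n).map_typeOf_apply (V n hn) _ isOpen_interior).symm
    _ ≤ P.map (fun ω => typeOf (π n ω) (V n hn)) A :=
        measure_mono fun ψ hψ => hNA ψ (interior_subset (s := N) hψ)

end Law

theorem mainTheorem6 {S : Type*} [Fintype S] (k : ℕ) (hk : 0 < k)
    {Ω : Type*} [MeasurableSpace Ω] (P : Measure Ω) [IsProbabilityMeasure P]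
    (π : ∀ n : ℕ, Ω → (FreeGroup S →* unitaryGroup (Fin n) ℂ))
    (hπ : ∀ n : ℕ, IsUniformRandomRep P (π n))
    (V : ∀ n : ℕ, k ≤ n → unitaryTuples k n) :
    LDP (fun (n : ℕ) (hn : k ≤ n) => P.map fun ω => typeOf (π n ω) (V n hn))
      (fun φ : unitalPD (FreeGroup S) k =>
        -⨅ (F : Finset (FreeGroup S)) (_ : IsGrounded F), hF F (restrictPD φ F)) ∧
    ∀ φ : unitalPD (FreeGroup S) k,
      Tendsto (fun n : ℕ => hF (cayleyBall S n) (restrictPD φ (cayleyBall S n))) atTop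
        (𝓝 (⨅ (F : Finset (FreeGroup S)) (_ : IsGrounded F), hF F (restrictPD φ F))) := by
  classical
  refine ⟨⟨fun n hn => ?prob, fun φ => ?nonneg, fun φ a ha => ?upper, fun φ a ha A hA => ?lower,
    fun a _ => ?tight⟩, tendsto_hF_cayleyBall⟩
  case prob =>
    exact Measure.isProbabilityMeasure_map ((hπ n).measurable_typeOf (V n hn)).aemeasurable
  case nonneg =>
    rw [EReal.neg_nonneg]
    exact (iInf₂_le _ suffixClosed_singleton_one.isGrounded).trans (hF_singleton 1 _).le
  case upper =>
    rw [EReal.lt_neg_comm, ← EReal.coe_neg] at ha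
    obtain ⟨U, hU, hbound⟩ := exists_nhds_law_le_exp hπ V ha
    exact ⟨U, hU, 0, isLittleO_zero _ _, by simpa using hbound⟩
  case lower =>
    rw [EReal.neg_lt_comm, ← EReal.coe_neg] at ha
    exact ⟨0, isLittleO_zero _ _, by simpa using eventually_exp_le_law hπ V ha hA⟩
  case tight =>
    exact ⟨Set.univ, isCompact_univ, 0, isLittleO_zero _ _, Eventually.of_forall fun n hn => by
      simpa using (Real.exp_pos _).le⟩
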